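/- Let $p>1$, $\mathbb{T}=\mathbb{R}/2\pi\mathbb{Z}$, $\omega_p=\frac{4}{(p-1)(p+3)}$, and for $\omega>0$ let $$R_\omega(x)=\omega^{\frac1{p-1}}\Big(\frac{p+1}{2}\Big)^{\frac1{p-1}}\operatorname{sech}^{\frac{2}{p-1}}\Big(\frac{p-1}{2}\sqrt{\omega}\,x\Big),\qquad \psi_{\omega}=\frac{R_\omega^{\frac{p+1}{2}}}{\|R_\omega^{\frac{p+1}{2}}\cos y\|_{L^2(\mathbb{R}\times\mathbb{T})}} .$$ Put $\mathcal{F}(\omega,u)=-\partial_x^2u-\partial_y^2u+\omega u-|u|^{p-1}u$ for real-valued $u\in H^2(\mathbb{R}\times\mathbb{T})$, let $\langle u,v\rangle=\int_{\mathbb{R}\times\mathbb{T}}uv$, $P_\perp f=f-\langle f,\psi_{\omega_p}\cos y\rangle\psi_{\omega_p}\cos y$, and let $X_2$ be the space of real-valued $u\in H^2(\mathbb{R}\times\mathbb{T})$ that are even in $x$ and in $y$ and satisfy $\langle u,\psi_{\omega_p}\cos y\rangle=0$. There exist $0<a_0\le 1$, $0<\delta_0<\omega_p$, $r_0>0$ and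 a $C^1$ map $\eta\colon(\omega_p-\delta_0,\omega_p+\delta_0)\times(-a_0,a_0)\to X_2$ with $\|\eta(\omega,a)\|_{H^2}<r_0$ such that, for all $(\omega,a)$ in this rectangle and all $h\in X_2$ with $\|h\|_{H^2}<r_0$, the auxiliary equation $$P_\perp\mathcal{F}(\omega,R_{\omega_p}+a\psi_{\omega_p}\cos y+h)=0$$ holds if and only if $h=\eta(\omega,a)$; and such that the following holds for (the continuous representative of) $\varphi(\omega,a)=R_{\omega_p}+a\psi_{\omega_p}\cos y+\eta(\omega,a)$. There is $\varepsilon_1>0$ such that for every $0<\varepsilon<\varepsilon_1$ there are $0<a_\varepsilon<a_0$ and $C_1(\varepsilon)>1$ with $$\frac{1}{C_1(\varepsilon)}e^{-(\sqrt\omega+\varepsilon)|x|}\le\varphi(\omega,a)(x,y)\le C_1(\varepsilon)e^{-(\sqrt\omega-\varepsilon)|x|}$$ for all $\omega\in(\omega_p-\delta_0,\omega_p+\delta_0)$, $a\in(-a_\varepsilon,a_\varepsilon)$, $x\in\mathbb{R}$, $y\in\mathbb{T}$. In particular $\varphi(\omega,a)$ is positive for these $\omega$ and $a$. All of $a_0,\delta_0,r_0,\eta,\varepsilon_1$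 depend only on $p$, and $a_\varepsilon,C_1(\varepsilon)$ only on $p$ and $\varepsilon$. -/

import Mathlib

open MeasureTheory Set

noncomputable section

namespace LineSoliton

/-- The torus `ℝ / 2πℤ`; its `volume` has total mass `2π`. -/
abbrev Torus : Type := AddCircle (2 * Real.pi)

instance instFactTwoPiPos : Fact (0 < 2 * Real.pi) := ⟨Real.two_pi_pos⟩

/-- The cylinder `ℝ × 𝕋`. -/
abbrev Cyl : Type := ℝ × Torus

/-- `cos y` as a function on the torus. -/
def cosT : Torus → ℝ := Real.cos_periodic.lift

/-- Real-valued `L²(ℝ × 𝕋)`. -/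
abbrev L2 : Type := Lp ℝ 2 (volume : Measure Cyl)

/-! ### The Sobolev space `H²(ℝ × 𝕋)` -/

/-- Real test functions on `ℝ × 𝕋`: compactly supported, with smooth `2π`-periodic lift to `ℝ²`. -/
structure IsTest (τ : Cyl → ℝ) : Prop where
  smooth : ContDiff ℝ (⊤ : ℕ∞) (fun z : ℝ × ℝ => τ (z.1, (z.2 : Torus)))
  compact : HasCompactSupport τ

/-- Classical `∂ₓ` on `ℝ × 𝕋`. -/
def dx (τ : Cyl → ℝ) (z : Cyl) : ℝ := deriv (fun s : ℝ => τ (s, z.2)) z.1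

/-- Classical `∂_y` on `ℝ × 𝕋`. -/
def dy (τ : Cyl → ℝ) (z : Cyl) : ℝ := deriv (fun t : ℝ => τ (z.1, z.2 + (t : Torus))) 0

/-- `v` is the weak `x`-derivative of `u`. -/
def IsWeakDx (u v : L2) : Prop :=
  ∀ τ : Cyl → ℝ, IsTest τ → ∫ z, u z * dx τ z = - ∫ z, v z * τ z

/-- `v` is the weak `y`-derivative of `u`. -/
def IsWeakDy (u v : L2) : Prop :=
  ∀ τ : Cyl → ℝ, IsTest τ → ∫ z, u z * dy τ z = - ∫ z, v z * τ z

theorem isOpenQuotientMap_lift :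
    IsOpenQuotientMap (fun z : ℝ × ℝ => ((z.1, (z.2 : Torus)) : Cyl)) := by
  have h2 : IsOpenQuotientMap (fun y : ℝ => (y : Torus)) :=
    QuotientAddGroup.isOpenQuotientMap_mk
  exact IsOpenQuotientMap.id.prodMap h2

theorem IsTest.continuous {τ : Cyl → ℝ} (h : IsTest τ) : Continuous τ :=
  isOpenQuotientMap_lift.isQuotientMap.continuous_iff.2 h.smooth.continuous

theorem IsTest.dx_lift {τ : Cyl → ℝ} (h : IsTest τ) (z : ℝ × ℝ) :
    dx τ (z.1, (z.2 : Torus)) =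
      fderiv ℝ (fun z : ℝ × ℝ => τ (z.1, (z.2 : Torus))) z (1, 0) := by
  have hd := (h.smooth.differentiable (by simp) z).hasFDerivAt
  have hg : HasDerivAt (fun s : ℝ => (s, z.2)) ((1 : ℝ), (0 : ℝ)) z.1 :=
    (hasDerivAt_id z.1).prodMk (hasDerivAt_const z.1 z.2)
  exact (HasFDerivAt.comp_hasDerivAt z.1 (f := fun s : ℝ => (s, z.2)) hd hg).deriv

theorem IsTest.dy_lift {τ : Cyl → ℝ} (h : IsTest τ) (z : ℝ × ℝ) :
    dy τ (z.1, (z.2 : Torus)) =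
      fderiv ℝ (fun z : ℝ × ℝ => τ (z.1, (z.2 : Torus))) z (0, 1) := by
  have hd := (h.smooth.differentiable (by simp) (z.1, z.2 + 0)).hasFDerivAt
  have hg : HasDerivAt (fun t : ℝ => (z.1, z.2 + t)) ((0 : ℝ), (1 : ℝ)) 0 :=
    (hasDerivAt_const 0 z.1).prodMk ((hasDerivAt_id (0 : ℝ)).const_add z.2)
  have := (HasFDerivAt.comp_hasDerivAt 0 (f := fun t : ℝ => (z.1, z.2 + t)) hd hg).deriv
  simpa [dy, Function.comp_def] using this

theorem IsTest.continuous_dx {τ : Cyl → ℝ} (h : IsTest τ) : Continuous (dx τ) := by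
  refine isOpenQuotientMap_lift.isQuotientMap.continuous_iff.2 ?_
  have : dx τ ∘ (fun z : ℝ × ℝ => ((z.1, (z.2 : Torus)) : Cyl)) =
      fun z => fderiv ℝ (fun z : ℝ × ℝ => τ (z.1, (z.2 : Torus))) z (1, 0) :=
    funext h.dx_lift
  rw [this]
  exact (h.smooth.continuous_fderiv (by simp)).clm_apply continuous_const

theorem IsTest.continuous_dy {τ : Cyl → ℝ} (h : IsTest τ) : Continuous (dy τ) := by
  refine isOpenQuotientMap_lift.isQuotientMap.continuous_iff.2 ?_
  have : dy τ ∘ (fun z : ℝ × ℝ => ((z.1, (z.2 : Torus)) : Cyl)) =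
      fun z => fderiv ℝ (fun z : ℝ × ℝ => τ (z.1, (z.2 : Torus))) z (0, 1) :=
    funext h.dy_lift
  rw [this]
  exact (h.smooth.continuous_fderiv (by simp)).clm_apply continuous_const

theorem IsTest.hasCompactSupport_dx {τ : Cyl → ℝ} (h : IsTest τ) :
    HasCompactSupport (dx τ) := by
  refine HasCompactSupport.intro h.compact fun z hz => ?_
  have h0 := notMem_tsupport_iff_eventuallyEq.1 hz
  have hc : Filter.Tendsto (fun s : ℝ => ((s, z.2) : Cyl)) (nhds z.1) (nhds z) := by
    have : Continuous (fun s : ℝ => ((s, z.2) : Cyl)) := by fun_prop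
    simpa using this.tendsto z.1
  have h1 : (fun s : ℝ => τ (s, z.2)) =ᶠ[nhds z.1] fun _ => (0 : ℝ) := hc.eventually h0
  simp [dx, h1.deriv_eq]

theorem IsTest.hasCompactSupport_dy {τ : Cyl → ℝ} (h : IsTest τ) :
    HasCompactSupport (dy τ) := by
  refine HasCompactSupport.intro h.compact fun z hz => ?_
  have h0 := notMem_tsupport_iff_eventuallyEq.1 hz
  have hc : Filter.Tendsto (fun t : ℝ => ((z.1, z.2 + (t : Torus)) : Cyl)) (nhds 0) (nhds z) := by
    have : Continuous (fun t : ℝ => ((z.1, z.2 + (t : Torus)) : Cyl)) :=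
      continuous_const.prodMk (continuous_const.add (AddCircle.continuous_mk' _))
    simpa using this.tendsto 0
  have h1 : (fun t : ℝ => τ (z.1, z.2 + (t : Torus))) =ᶠ[nhds 0] fun _ => (0 : ℝ) :=
    hc.eventually h0
  simp [dy, h1.deriv_eq]

theorem integrable_mul_of_compactSupport (u : L2) {τ : Cyl → ℝ} (hc : Continuous τ)
    (hs : HasCompactSupport τ) : Integrable (fun z => u z * τ z) :=
  (Lp.memLp u).integrable_mul (q := 2) (hc.memLp_of_hasCompactSupport hs)

theorem integral_add_mul (u v : L2) {τ : Cyl → ℝ} (hc : Continuous τ)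
    (hs : HasCompactSupport τ) :
    ∫ z, (u + v) z * τ z = (∫ z, u z * τ z) + ∫ z, v z * τ z := by
  rw [← integral_add (integrable_mul_of_compactSupport u hc hs)
    (integrable_mul_of_compactSupport v hc hs)]
  refine integral_congr_ae ?_
  filter_upwards [Lp.coeFn_add u v] with z hz
  rw [hz, Pi.add_apply, add_mul]

theorem integral_smul_mul (c : ℝ) (u : L2) (τ : Cyl → ℝ) :
    ∫ z, (c • u) z * τ z = c * ∫ z, u z * τ z := by
  rw [← integral_const_mul]
  refine integral_congr_ae ?_
  filter_upwards [Lp.coeFn_smul c u] with z hz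
  rw [hz, Pi.smul_apply, smul_eq_mul, mul_assoc]

theorem IsWeakDx.add {u v u' v' : L2} (h : IsWeakDx u v) (h' : IsWeakDx u' v') :
    IsWeakDx (u + u') (v + v') := fun τ hτ => by
  rw [integral_add_mul _ _ hτ.continuous_dx hτ.hasCompactSupport_dx,
    integral_add_mul _ _ hτ.continuous hτ.compact, h τ hτ, h' τ hτ, neg_add]

theorem IsWeakDy.add {u v u' v' : L2} (h : IsWeakDy u v) (h' : IsWeakDy u' v') :
    IsWeakDy (u + u') (v + v') := fun τ hτ => by
  rw [integral_add_mul _ _ hτ.continuous_dy hτ.hasCompactSupport_dy,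
    integral_add_mul _ _ hτ.continuous hτ.compact, h τ hτ, h' τ hτ, neg_add]

theorem IsWeakDx.smul (c : ℝ) {u v : L2} (h : IsWeakDx u v) : IsWeakDx (c • u) (c • v) :=
  fun τ hτ => by rw [integral_smul_mul, integral_smul_mul, h τ hτ, mul_neg]

theorem IsWeakDy.smul (c : ℝ) {u v : L2} (h : IsWeakDy u v) : IsWeakDy (c • u) (c • v) :=
  fun τ hτ => by rw [integral_smul_mul, integral_smul_mul, h τ hτ, mul_neg]

theorem isWeakDx_zero : IsWeakDx 0 0 := fun τ _ => by simp

theorem isWeakDy_zero : IsWeakDy 0 0 := fun τ _ => by simp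

/-- `H²(ℝ × 𝕋)`: a function `u ∈ L²` together with its weak derivatives of order at most two, listed
as `(u, u_x, u_y, u_xx, u_xy, u_yy)`; the weak derivatives are determined by `u`. The norm inherited
from the `ℓ²`-sum of six copies of `L²` is the usual `H²` norm
`(∑_{|α| ≤ 2} ‖∂^α u‖²)^{1/2}`. -/
def H2space : Submodule ℝ (PiLp 2 (fun _ : Fin 6 => L2)) where
  carrier := {U | IsWeakDx (U 0) (U 1) ∧ IsWeakDy (U 0) (U 2) ∧ IsWeakDx (U 1) (U 3) ∧
    IsWeakDy (U 1) (U 4) ∧ IsWeakDy (U 2) (U 5)}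
  add_mem' := fun h h' => ⟨h.1.add h'.1, h.2.1.add h'.2.1, h.2.2.1.add h'.2.2.1,
    h.2.2.2.1.add h'.2.2.2.1, h.2.2.2.2.add h'.2.2.2.2⟩
  zero_mem' := ⟨isWeakDx_zero, isWeakDy_zero, isWeakDx_zero, isWeakDy_zero, isWeakDy_zero⟩
  smul_mem' := fun c _ h => ⟨h.1.smul c, h.2.1.smul c, h.2.2.1.smul c, h.2.2.2.1.smul c,
    h.2.2.2.2.smul c⟩

/-- `H²(ℝ × 𝕋)` as a normed space. -/
abbrev H2 : Type := H2space

/-- The underlying function of an element of `H²`. -/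
def H2.fn (u : H2) : L2 := u.1 0

/-- The weak derivative `∂ₓ² u`. -/
def H2.dxx (u : H2) : L2 := u.1 3

/-- The weak derivative `∂_y² u`. -/
def H2.dyy (u : H2) : L2 := u.1 5

/-! ### The line soliton and the auxiliary equation -/

/-- `ω_p = 4 / ((p - 1)(p + 3))`. -/
def omegaP (p : ℝ) : ℝ := 4 / ((p - 1) * (p + 3))

/-- The line soliton `R_ω(x) = ω^{1/(p-1)} ((p+1)/2)^{1/(p-1)} sech^{2/(p-1)}((p-1)/2 √ω x)`. -/
def soliton (p ω x : ℝ) : ℝ :=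
  ω ^ (1 / (p - 1)) * ((p + 1) / 2) ^ (1 / (p - 1)) *
    (1 / Real.cosh ((p - 1) / 2 * Real.sqrt ω * x)) ^ (2 / (p - 1))

/-- `ψ_ω = R_ω^{(p+1)/2} / ‖R_ω^{(p+1)/2} cos y‖_{L²(ℝ × 𝕋)}`. -/
def psi (p ω x : ℝ) : ℝ :=
  soliton p ω x ^ ((p + 1) / 2) /
    Real.sqrt (∫ z : Cyl, (soliton p ω z.1 ^ ((p + 1) / 2) * cosT z.2) ^ 2)

/-- `ψ_{ω_p} cos y`. -/
def psiCos (p : ℝ) (z : Cyl) : ℝ := psi p (omegaP p) z.1 * cosT z.2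

/-- `⟨f, ψ_{ω_p} cos y⟩`. -/
def pairing (p : ℝ) (f : Cyl → ℝ) : ℝ := ∫ z, f z * psiCos p z

/-- `P_⊥ f = f - ⟨f, ψ_{ω_p} cos y⟩ ψ_{ω_p} cos y`. -/
def projPerp (p : ℝ) (f : Cyl → ℝ) (z : Cyl) : ℝ := f z - pairing p f * psiCos p z

/-- The functions of `H²` that are even in `x` and in `y`. -/
def H2sym : Set H2 :=
  {u | (∀ᵐ z : Cyl, u.fn z = u.fn (-z.1, z.2)) ∧ ∀ᵐ z : Cyl, u.fn z = u.fn (z.1, -z.2)}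

/-- `X₂ = {u ∈ H²_sym : ⟨u, ψ_{ω_p} cos y⟩ = 0}`. -/
def X2 (p : ℝ) : Set H2 := {u | u ∈ H2sym ∧ pairing p u.fn = 0}

/-- `𝓕(ω, u) = -∂ₓ²u - ∂_y²u + ωu - |u|^{p-1}u` for `u ∈ H²`. -/
def nlsF (p ω : ℝ) (u : H2) (z : Cyl) : ℝ :=
  -u.dxx z - u.dyy z + ω * u.fn z - |u.fn z| ^ (p - 1) * u.fn z

/-- `R_{ω_p} + a ψ_{ω_p} cos y + h`. -/
def ansatz (p a : ℝ) (h : H2) (z : Cyl) : ℝ :=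
  soliton p (omegaP p) z.1 + a * psiCos p z + h.fn z

/-- The auxiliary equation `P_⊥ 𝓕(ω, R_{ω_p} + a ψ_{ω_p} cos y + h) = 0`; the element `u` of `H²`
is the argument of `𝓕`. -/
def AuxEq (p ω a : ℝ) (h : H2) : Prop :=
  ∃ u : H2, u.fn =ᵐ[volume] ansatz p a h ∧ projPerp p (nlsF p ω u) =ᵐ[volume] 0

end LineSoliton

end

open MeasureTheory Set

noncomputable section

namespace LineSoliton

open Filter Topology

/-! ### Exponentially decaying functions on the line -/

/-! The proof is a Lyapunov–Schmidt reduction at the line soliton, followed by a comparison argument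
for the resulting family.

Reduction. Write `s = (p+1)/(p-1)` and `κ = (p-1)/2 √ω_p`. On functions `g(x)cos(ny)` the
linearization `-Δ + ω_p - p R^{p-1}` acts as `N + n² - 1`, where `N = -∂² + s²κ² - s(s+1)κ²
sech²(κx)` is a Pöschl–Teller operator. It factors as `N = A*A` with `A = ∂ + sκ tanh(κx)`, and its
ground state is `sech^s(κx)`, a multiple of `ψ`. The value `ω_p` is the one for which `s²κ² = ω_p +
1`, so `ψ cos y` is in the kernel. On functions even in `x` and `y` nothing else is: for `n ≥ 2` the
shift `n² - 1` is positive; for `n = 1` there is a gap above the ground state (`ptOp_gap`); for `n =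
0` the kernel of `N - 1` is spanned by `R'`, which is odd, and `N - 1` is bounded below on even
functions (`exists_ptOp_sub_one_ge`). These spectral facts come from one Hardy-type inequality for
functions vanishing at the origin (`hardy`). Adding the rank-one term `⟨·, ψ cos y⟩ ψ cos y`
therefore gives an isomorphism from even `H²` onto even `L²` (`exists_linear_iso`), and the implicit
function theorem yields `η` with its uniqueness (`exists_eta`).

Multiplier. The function `φ(ω, a)` satisfies `𝓕(ω, φ) = λ(ω, a) ψ cos y` with a real `λ`. The shift
`y ↦ y + π` fixes `R` and changes the sign of `ψ cos y`, so by uniqueness `λ(ω, 0) = 0`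
(`multiplier_zero`). By compactness in `ω`, `λ` is then uniformly small for `|a| < a_ε`.

Decay. The source `λ ψ cos y` decays at rate `sκ = √(ω_p + 1)`, faster than `√ω + ε` in the range
considered, so for small `λ` it is dominated by the barriers. These are modified exponentials
depending on `x` only, and they are compared with `φ` by a weak maximum principle
(`embC_nonpos_of_subharmonic`). The lower bound comes first and gives positivity. The upper bound
takes two passes, because `δ₀` is fixed before `ε`: closeness to `R` only makes `|φ|^{p-1}` smaller
than a fixed fraction of `ω_p` far out. This gives a crude decay rate, hence `φ^{p-1}` as small as
`ε` requires still further out, hence the rate `√ω - ε` (`exists_decay_const`).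

The functional analysis rests on finite sums of `g(x)cos(ny)` with smooth decaying even `g`. They
are dense in even `H²` (`Hs_eq_modeClosure`), so coercivity, the Sobolev embedding and the
integrations by parts are proved for them and extended by closedness. -/

/-- `g = O(e^{-c|x|})` on `ℝ` for some `c > 0`. -/
def Dec (g : ℝ → ℝ) : Prop := ∃ C c : ℝ, 0 < c ∧ ∀ x, |g x| ≤ C * Real.exp (-c * |x|)

theorem Dec.exists_nonneg {g : ℝ → ℝ} (h : Dec g) :
    ∃ C c : ℝ, 0 ≤ C ∧ 0 < c ∧ ∀ x, |g x| ≤ C * Real.exp (-c * |x|) := by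
  obtain ⟨C, c, hc, h⟩ := h
  refine ⟨C, c, ?_, hc, h⟩
  have := (abs_nonneg _).trans (h 0)
  simpa using this

theorem Dec.mono {g h : ℝ → ℝ} (hg : Dec g) (M : ℝ) (hM : ∀ x, |h x| ≤ M * |g x|) : Dec h := by
  obtain ⟨C, c, hC, hc, hg⟩ := hg.exists_nonneg
  refine ⟨|M| * C, c, hc, fun x => (hM x).trans ?_⟩
  calc M * |g x| ≤ |M| * |g x| := by gcongr; exact le_abs_self M
    _ ≤ |M| * (C * Real.exp (-c * |x|)) := by gcongr; exact hg x
    _ = _ := by ring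

theorem Dec.add {g h : ℝ → ℝ} (hg : Dec g) (hh : Dec h) : Dec (fun x => g x + h x) := by
  obtain ⟨C, c, hC, hc, hg⟩ := hg.exists_nonneg
  obtain ⟨C', c', hC', hc', hh⟩ := hh.exists_nonneg
  refine ⟨C + C', min c c', lt_min hc hc', fun x => (abs_add_le _ _).trans ?_⟩
  have h1 : Real.exp (-c * |x|) ≤ Real.exp (-(min c c') * |x|) := by
    apply Real.exp_le_exp.2
    have := mul_le_mul_of_nonneg_right (min_le_left c c') (abs_nonneg x)
    linarith
  have h2 : Real.exp (-c' * |x|) ≤ Real.exp (-(min c c') * |x|) := by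
    apply Real.exp_le_exp.2
    have := mul_le_mul_of_nonneg_right (min_le_right c c') (abs_nonneg x)
    linarith
  calc |g x| + |h x| ≤ C * Real.exp (-c * |x|) + C' * Real.exp (-c' * |x|) :=
        add_le_add (hg x) (hh x)
    _ ≤ C * Real.exp (-(min c c') * |x|) + C' * Real.exp (-(min c c') * |x|) := by gcongr
    _ = _ := by ring

theorem Dec.mul_bdd {g b : ℝ → ℝ} (hg : Dec g) (M : ℝ) (hM : ∀ x, |b x| ≤ M) :
    Dec (fun x => b x * g x) :=
  hg.mono M fun x => by rw [abs_mul]; gcongr; exact hM x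

theorem Dec.const_mul {g : ℝ → ℝ} (hg : Dec g) (a : ℝ) : Dec (fun x => a * g x) :=
  hg.mul_bdd (b := fun _ => a) |a| fun _ => le_rfl

theorem Dec.neg {g : ℝ → ℝ} (hg : Dec g) : Dec (fun x => -g x) :=
  hg.mono 1 fun x => by simp

theorem Dec.sub {g h : ℝ → ℝ} (hg : Dec g) (hh : Dec h) : Dec (fun x => g x - h x) := by
  simpa [sub_eq_add_neg] using hg.add hh.neg

theorem Dec.exists_bound {g : ℝ → ℝ} (hg : Dec g) : ∃ M, 0 ≤ M ∧ ∀ x, |g x| ≤ M := by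
  obtain ⟨C, c, hC, hc, hg⟩ := hg.exists_nonneg
  refine ⟨C, hC, fun x => (hg x).trans ?_⟩
  have : Real.exp (-c * |x|) ≤ 1 := Real.exp_le_one_iff.2 (by nlinarith [abs_nonneg x])
  nlinarith

theorem Dec.mul {g h : ℝ → ℝ} (hg : Dec g) (hh : Dec h) : Dec (fun x => g x * h x) := by
  obtain ⟨M, -, hM⟩ := hg.exists_bound
  exact hh.mul_bdd M hM

theorem Dec.sq {g : ℝ → ℝ} (hg : Dec g) : Dec (fun x => g x ^ 2) := by
  simpa [pow_two] using hg.mul hg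

theorem Dec.comp_neg {g : ℝ → ℝ} (hg : Dec g) : Dec (fun x => g (-x)) := by
  obtain ⟨C, c, hc, hg⟩ := hg
  exact ⟨C, c, hc, fun x => by simpa using hg (-x)⟩

theorem integrable_exp_neg_mul_abs {c : ℝ} (hc : 0 < c) :
    Integrable (fun x : ℝ => Real.exp (-c * |x|)) := by
  rw [← integrableOn_univ, ← Iic_union_Ioi (a := (0 : ℝ)), integrableOn_union]
  constructor
  · refine (integrableOn_exp_mul_Iic hc 0).congr_fun (fun x hx => ?_) measurableSet_Iic
    simp only [abs_of_nonpos (mem_Iic.1 hx)]; ring_nf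
  · refine (integrableOn_exp_mul_Ioi (neg_lt_zero.2 hc) 0).congr_fun (fun x hx => ?_)
      measurableSet_Ioi
    simp only [abs_of_pos (mem_Ioi.1 hx)]

theorem Dec.integrable {g : ℝ → ℝ} (hg : Dec g) (hc : Continuous g) : Integrable g := by
  obtain ⟨C, c, hc', hg⟩ := hg
  exact ((integrable_exp_neg_mul_abs hc').const_mul C).mono' hc.aestronglyMeasurable
    (.of_forall hg)

theorem Dec.tendsto_cocompact {g : ℝ → ℝ} (hg : Dec g) : Tendsto g (cocompact ℝ) (𝓝 0) := by
  obtain ⟨C, c, hc, hg⟩ := hg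
  refine squeeze_zero_norm hg ?_
  have h1 : Tendsto (fun x : ℝ => -c * |x|) (cocompact ℝ) atBot := by
    have := (tendsto_norm_cocompact_atTop (E := ℝ)).const_mul_atTop_of_neg (neg_lt_zero.2 hc)
    simpa using this
  simpa using (Real.tendsto_exp_atBot.comp h1).const_mul C

theorem Dec.tendsto_atTop {g : ℝ → ℝ} (hg : Dec g) : Tendsto g atTop (𝓝 0) :=
  hg.tendsto_cocompact.mono_left atTop_le_cocompact

theorem Dec.tendsto_atBot {g : ℝ → ℝ} (hg : Dec g) : Tendsto g atBot (𝓝 0) :=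
  hg.tendsto_cocompact.mono_left atBot_le_cocompact

/-- On the compact part `|x| ≤ M` the function is bounded, and the factor `e^{c|M|}` absorbs the
exponential there. -/
theorem dec_of_outside {g : ℝ → ℝ} (hg : Continuous g) {C c M : ℝ} (hc : 0 < c)
    (h : ∀ x, M ≤ |x| → |g x| ≤ C * Real.exp (-c * |x|)) : Dec g := by
  obtain ⟨B, hB⟩ := (isCompact_Icc (a := -M) (b := M)).exists_bound_of_continuousOn hg.continuousOn
  refine ⟨|C| + |B| * Real.exp (c * |M|), c, hc, fun x => ?_⟩
  rcases le_total M |x| with hx | hx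
  · refine (h x hx).trans ?_
    have : C ≤ |C| + |B| * Real.exp (c * |M|) := by
      have h1 := le_abs_self C
      have h2 : 0 ≤ |B| * Real.exp (c * |M|) := by positivity
      linarith
    gcongr
  · have h1 : |g x| ≤ |B| := (hB x (abs_le.1 hx)).trans (le_abs_self B)
    have h2 : 1 ≤ Real.exp (c * |M|) * Real.exp (-c * |x|) := by
      rw [← Real.exp_add]
      apply Real.one_le_exp
      have := hx.trans (le_abs_self M)
      nlinarith
    have h3 : 0 ≤ |C| * Real.exp (-c * |x|) := by positivity
    calc |g x| ≤ |B| * 1 := by linarith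
      _ ≤ |B| * (Real.exp (c * |M|) * Real.exp (-c * |x|)) := by gcongr
      _ ≤ _ := by linarith

theorem dec_of_compactSupport {g : ℝ → ℝ} (hg : Continuous g) (hc : HasCompactSupport g) : Dec g := by
  obtain ⟨M, -, hM⟩ := hc.exists_pos_le_norm
  exact dec_of_outside hg (C := 0) (c := 1) (M := M) one_pos fun x hx => by simp [hM x hx]

/-! ### Profiles -/

/-- Smooth even functions that decay exponentially together with two derivatives. -/
structure IsProf (g : ℝ → ℝ) : Prop where
  smooth : ContDiff ℝ (⊤ : ℕ∞) g
  even : ∀ x, g (-x) = g x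
  dec : Dec g
  dec' : Dec (deriv g)
  dec'' : Dec (deriv (deriv g))

theorem IsProf.smooth' {g : ℝ → ℝ} (h : IsProf g) : ContDiff ℝ (⊤ : ℕ∞) (deriv g) :=
  (contDiff_infty_iff_deriv.1 h.smooth).2

theorem IsProf.smooth'' {g : ℝ → ℝ} (h : IsProf g) : ContDiff ℝ (⊤ : ℕ∞) (deriv (deriv g)) :=
  (contDiff_infty_iff_deriv.1 h.smooth').2

theorem IsProf.cont {g : ℝ → ℝ} (h : IsProf g) : Continuous g := h.smooth.continuous

theorem IsProf.cont' {g : ℝ → ℝ} (h : IsProf g) : Continuous (deriv g) := h.smooth'.continuous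

theorem IsProf.cont'' {g : ℝ → ℝ} (h : IsProf g) : Continuous (deriv (deriv g)) :=
  h.smooth''.continuous

theorem IsProf.hasDerivAt {g : ℝ → ℝ} (h : IsProf g) (x : ℝ) : HasDerivAt g (deriv g x) x :=
  ((contDiff_infty_iff_deriv.1 h.smooth).1 x).hasDerivAt

theorem IsProf.hasDerivAt' {g : ℝ → ℝ} (h : IsProf g) (x : ℝ) :
    HasDerivAt (deriv g) (deriv (deriv g) x) x :=
  ((contDiff_infty_iff_deriv.1 h.smooth').1 x).hasDerivAt

theorem IsProf.deriv_neg {g : ℝ → ℝ} (h : IsProf g) (x : ℝ) : deriv g (-x) = -deriv g x := by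
  have h1 : (fun x => g (-x)) = g := funext h.even
  have := deriv_comp_neg g x
  rw [h1] at this
  linarith

theorem IsProf.deriv_zero {g : ℝ → ℝ} (h : IsProf g) : deriv g 0 = 0 := by
  have := h.deriv_neg 0
  simp only [neg_zero] at this
  linarith

theorem IsProf.mk_of_hasDerivAt {g g' g'' : ℝ → ℝ} (hs : ContDiff ℝ (⊤ : ℕ∞) g)
    (he : ∀ x, g (-x) = g x) (h1 : ∀ x, HasDerivAt g (g' x) x)
    (h2 : ∀ x, HasDerivAt g' (g'' x) x) (d : Dec g) (d' : Dec g') (d'' : Dec g'') :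
    IsProf g ∧ deriv g = g' ∧ deriv (deriv g) = g'' := by
  have e1 : deriv g = g' := funext fun x => (h1 x).deriv
  have e2 : deriv (deriv g) = g'' := by rw [e1]; exact funext fun x => (h2 x).deriv
  exact ⟨⟨hs, he, d, e1 ▸ d', e2 ▸ d''⟩, e1, e2⟩

theorem IsProf.add {g h : ℝ → ℝ} (hg : IsProf g) (hh : IsProf h) : IsProf (g + h) :=
  (IsProf.mk_of_hasDerivAt (hg.smooth.add hh.smooth)
    (fun x => by simp only [hg.even, hh.even])
    (fun x => (hg.hasDerivAt x).add (hh.hasDerivAt x))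
    (fun x => (hg.hasDerivAt' x).add (hh.hasDerivAt' x))
    (hg.dec.add hh.dec) (hg.dec'.add hh.dec') (hg.dec''.add hh.dec'')).1

theorem IsProf.smul {g : ℝ → ℝ} (hg : IsProf g) (c : ℝ) : IsProf (c • g) :=
  (IsProf.mk_of_hasDerivAt (hg.smooth.const_smul c)
    (fun x => by simp only [hg.even])
    (fun x => (hg.hasDerivAt x).const_smul c)
    (fun x => (hg.hasDerivAt' x).const_smul c)
    (hg.dec.const_mul c) (hg.dec'.const_mul c) (hg.dec''.const_mul c)).1

theorem dec_zero : Dec (fun _ => 0) := ⟨0, 1, one_pos, fun x => by simp⟩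

theorem isProf_zero : IsProf 0 :=
  (IsProf.mk_of_hasDerivAt (g' := fun _ => 0) (g'' := fun _ => 0) contDiff_const
    (fun x => by simp) (fun x => hasDerivAt_const x 0) (fun x => hasDerivAt_const x 0)
    dec_zero dec_zero dec_zero).1

/-- The space of profiles. -/
def Prof : Submodule ℝ (ℝ → ℝ) where
  carrier := {g | IsProf g}
  add_mem' := IsProf.add
  zero_mem' := isProf_zero
  smul_mem' c _ h := IsProf.smul h c

/-- `e^{-θ}` is a profile when `θ` is even, grows at least linearly and has bounded
derivatives of order one and two. -/
theorem isProf_exp_neg {θ θ₁ θ₂ : ℝ → ℝ} (hθ : ContDiff ℝ (⊤ : ℕ∞) θ) (he : ∀ x, θ (-x) = θ x)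
    (h1 : ∀ x, HasDerivAt θ (θ₁ x) x) (h2 : ∀ x, HasDerivAt θ₁ (θ₂ x) x) {c M : ℝ} (hc : 0 < c)
    (hlow : ∀ x, c * |x| - M ≤ θ x) (b1 : ∀ x, |θ₁ x| ≤ M) (b2 : ∀ x, |θ₂ x| ≤ M) :
    IsProf (fun x => Real.exp (-θ x)) ∧
      deriv (fun x => Real.exp (-θ x)) = (fun x => -θ₁ x * Real.exp (-θ x)) ∧
      deriv (deriv (fun x => Real.exp (-θ x))) =
        fun x => (θ₁ x ^ 2 - θ₂ x) * Real.exp (-θ x) := by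
  have d0 : Dec (fun x => Real.exp (-θ x)) := by
    refine ⟨Real.exp M, c, hc, fun x => ?_⟩
    rw [abs_of_pos (Real.exp_pos _), ← Real.exp_add]
    exact Real.exp_le_exp.2 (by linarith [hlow x])
  have hd : ∀ x, HasDerivAt (fun x => Real.exp (-θ x)) (-θ₁ x * Real.exp (-θ x)) x := fun x => by
    have := (h1 x).neg.exp
    rwa [mul_comm] at this
  refine IsProf.mk_of_hasDerivAt (Real.contDiff_exp.comp hθ.neg) (fun x => by simp only [he]) hd
    (fun x => ?_) d0 (d0.mul_bdd M fun x => by simpa using b1 x)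
    (d0.mul_bdd (M ^ 2 + M) fun x => ?_)
  · exact ((h2 x).fun_neg.fun_mul (hd x)).congr_deriv (by ring)
  · refine (abs_sub _ _).trans (add_le_add ?_ (b2 x))
    rw [abs_pow]
    exact pow_le_pow_left₀ (abs_nonneg _) (b1 x) 2

/-! ### Integration by parts and one-dimensional inequalities -/

theorem integral_deriv_mul_eq {u v u' v' : ℝ → ℝ} (hu : ∀ x, HasDerivAt u (u' x) x)
    (hv : ∀ x, HasDerivAt v (v' x) x) (hu' : Continuous u') (hv' : Continuous v')
    (du : Dec u) (dv : Dec v) (du' : Dec u') (dv' : Dec v') :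
    ∫ x, u' x * v x = - ∫ x, u x * v' x := by
  have cu : Continuous u := continuous_iff_continuousAt.2 fun x => (hu x).continuousAt
  have cv : Continuous v := continuous_iff_continuousAt.2 fun x => (hv x).continuousAt
  have i1 := (du'.mul dv).integrable (hu'.mul cv)
  have i2 := (du.mul dv').integrable (cu.mul hv')
  have := integral_eq_zero_of_hasDerivAt_of_integrable (fun x => (hu x).mul (hv x)) (i1.add i2)
    ((du.mul dv).integrable (cu.mul cv))
  rw [integral_add i1 i2] at this
  linarith

/-- Integrate `(u²)' = 2uu' ≤ u² + u'²` from `-∞`. This one-dimensional Sobolev bound feeds the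
embedding into continuous functions. -/
theorem sq_le_integral_sq {u u' : ℝ → ℝ} (hu : ∀ x, HasDerivAt u (u' x) x) (hu' : Continuous u')
    (du : Dec u) (du' : Dec u') (x : ℝ) : u x ^ 2 ≤ (∫ t, u t ^ 2) + ∫ t, u' t ^ 2 := by
  have cu : Continuous u := continuous_iff_continuousAt.2 fun x => (hu x).continuousAt
  have i1 := du.sq.integrable (cu.pow 2)
  have i2 := du'.sq.integrable (hu'.pow 2)
  have i3 : Integrable (fun t => 2 * u t * u' t) :=
    ((du.const_mul 2).mul du').integrable ((continuous_const.mul cu).mul hu')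
  have h1 : ∫ t in Iic x, 2 * u t * u' t = u x ^ 2 - 0 := by
    refine integral_Iic_of_hasDerivAt_of_tendsto' (f := fun t => u t ^ 2) (fun t _ => ?_)
      i3.integrableOn du.sq.tendsto_atBot
    simpa using (hu t).fun_pow 2
  rw [← integral_add i1 i2, ← sub_zero (u x ^ 2), ← h1]
  calc ∫ t in Iic x, 2 * u t * u' t ≤ ∫ t in Iic x, (u t ^ 2 + u' t ^ 2) :=
        integral_mono i3.integrableOn (i1.fun_add i2).integrableOn fun t => by
          simp only; nlinarith [sq_nonneg (u t - u' t)]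
    _ ≤ ∫ t, (u t ^ 2 + u' t ^ 2) :=
        setIntegral_le_integral (i1.fun_add i2) (.of_forall fun t => by positivity)

theorem hasDerivAt_tanh_mul (κ x : ℝ) :
    HasDerivAt (fun x => Real.tanh (κ * x)) (κ * (1 - Real.tanh (κ * x) ^ 2)) x := by
  have h : HasDerivAt (fun x : ℝ => κ * x) κ x := by simpa using (hasDerivAt_id x).const_mul κ
  have e : (fun x => Real.tanh (κ * x)) = fun x => Real.sinh (κ * x) / Real.cosh (κ * x) :=
    funext fun x => Real.tanh_eq_sinh_div_cosh _
  rw [e, Real.tanh_eq_sinh_div_cosh]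
  have := (Real.cosh_pos (κ * x)).ne'
  refine (h.sinh.fun_div h.cosh this).congr_deriv ?_
  field_simp

theorem abs_tanh_le_one (x : ℝ) : |Real.tanh x| ≤ 1 := (Real.abs_tanh_lt_one x).le

theorem continuous_tanh_mul (κ : ℝ) : Continuous (fun x => Real.tanh (κ * x)) :=
  continuous_iff_continuousAt.2 fun x => (hasDerivAt_tanh_mul κ x).continuousAt

/-- Near `0` the numerator is quadratic and the denominator linear. This is the boundary term at the
origin in the Hardy inequality. -/
theorem tendsto_sq_div_tanh {f : ℝ → ℝ} {f' κ : ℝ} (hκ : κ ≠ 0) (hf : HasDerivAt f f' 0)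
    (h0 : f 0 = 0) : Tendsto (fun x => f x ^ 2 / Real.tanh (κ * x)) (𝓝[≠] 0) (𝓝 0) := by
  have h1 := hasDerivAt_iff_tendsto_slope_zero.1 hf
  have h2 := hasDerivAt_iff_tendsto_slope_zero.1 (hasDerivAt_tanh_mul κ 0)
  simp only [zero_add, h0, sub_zero, mul_zero, Real.tanh_zero, smul_eq_mul, ne_eq,
    OfNat.ofNat_ne_zero, not_false_eq_true, zero_pow, mul_one] at h1 h2
  have h3 : Tendsto f (𝓝[≠] 0) (𝓝 0) := by
    have := hf.continuousAt.tendsto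
    rw [h0] at this
    exact this.mono_left nhdsWithin_le_nhds
  have := (h3.mul h1).div h2 hκ
  simp only [zero_mul, zero_div] at this
  refine this.congr' ?_
  filter_upwards [self_mem_nhdsWithin] with x hx
  have hx : x ≠ 0 := hx
  simp only [Pi.div_apply]
  by_cases ht : Real.tanh (κ * x) = 0
  · simp [ht]
  · field_simp

/-- A ground state substitution on the half-line. The comparison function is `sinh(κx) cosh^m(κx)`,
which vanishes at `0` as `f` does; its logarithmic derivative is `κ(1/t + m t)` with `t = tanh(κx)`.
The integrand is a total derivative plus a square plus a term whose sign is that of `(m + σ)(m - σ -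
1)`. -/
theorem hardy_half {f f' : ℝ → ℝ} (hf : ∀ x, HasDerivAt f (f' x) x) (hf'c : Continuous f')
    (hd : Dec f) (hd' : Dec f') (h0 : f 0 = 0) {κ σ m : ℝ} (hκ : 0 < κ)
    (hm : 0 ≤ (m + σ) * (m - σ - 1)) :
    0 ≤ ∫ x in Ioi 0, ((f' x + σ * κ * Real.tanh (κ * x) * f x) ^ 2 -
      κ ^ 2 * (σ ^ 2 - (m + 1) ^ 2) * f x ^ 2) := by
  have cf : Continuous f := continuous_iff_continuousAt.2 fun x => (hf x).continuousAt
  have ct := continuous_tanh_mul κ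
  set q : ℝ → ℝ := fun x => (f' x + σ * κ * Real.tanh (κ * x) * f x) ^ 2 -
      κ ^ 2 * (σ ^ 2 - (m + 1) ^ 2) * f x ^ 2 with hq
  have cq : Continuous q := by fun_prop
  have dq : Dec q := by
    refine ((hd'.add ?_).sq).sub (hd.sq.const_mul _)
    refine hd.mul_bdd (|σ * κ|) fun x => ?_
    rw [abs_mul]
    exact mul_le_of_le_one_right (abs_nonneg _) (abs_tanh_le_one _)
  -- The primitive left over after completing the square. At `x = 0` the quotient is `0` by the
  -- convention on division by zero, which agrees with its limit because `f 0 = 0`.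
  set F : ℝ → ℝ := fun x => κ * (f x ^ 2 / Real.tanh (κ * x) +
    (m + σ) * Real.tanh (κ * x) * f x ^ 2) with hF
  have tpos : ∀ x, 0 < x → 0 < Real.tanh (κ * x) := fun x hx => by
    rw [Real.tanh_eq_sinh_div_cosh]
    exact div_pos (Real.sinh_pos_iff.2 (by positivity)) (Real.cosh_pos _)
  have hFd : ∀ x, 0 < x → HasDerivAt F (κ * ((2 * f x * f' x * Real.tanh (κ * x) -
      f x ^ 2 * (κ * (1 - Real.tanh (κ * x) ^ 2))) / Real.tanh (κ * x) ^ 2 +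
      ((m + σ) * (κ * (1 - Real.tanh (κ * x) ^ 2)) * f x ^ 2 +
        (m + σ) * Real.tanh (κ * x) * (2 * f x * f' x)))) x := fun x hx => by
    have hsq : HasDerivAt (fun x => f x ^ 2) (2 * f x * f' x) x := by simpa using (hf x).fun_pow 2
    exact (((hsq.div (hasDerivAt_tanh_mul κ x) (tpos x hx).ne').add
      (((hasDerivAt_tanh_mul κ x).const_mul (m + σ)).mul hsq)).const_mul κ)
  have hF0 : F 0 = 0 := by simp [hF]
  have hFc : ∀ R, ContinuousOn F (Icc 0 R) := fun R x hx => by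
    rcases hx.1.eq_or_lt with rfl | hx0
    · have h1 := tendsto_sq_div_tanh hκ.ne' (hf 0) h0
      have h2 : Tendsto (fun x => (m + σ) * Real.tanh (κ * x) * f x ^ 2) (𝓝[≠] 0) (𝓝 0) := by
        have : Continuous (fun x => (m + σ) * Real.tanh (κ * x) * f x ^ 2) := by fun_prop
        have := this.tendsto 0
        simp only [h0, ne_eq, OfNat.ofNat_ne_zero, not_false_eq_true, zero_pow, mul_zero] at this
        exact this.mono_left nhdsWithin_le_nhds
      have h3 : Tendsto F (𝓝[≠] 0) (𝓝 (F 0)) := by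
        rw [hF0]; simpa using (h1.add h2).const_mul κ
      have : ContinuousAt F 0 := continuousAt_iff_punctured_nhds.2 h3
      exact this.continuousWithinAt
    · exact (hFd x hx0).continuousAt.continuousWithinAt
  have key : ∀ R, 0 ≤ R → F R ≤ ∫ x in (0 : ℝ)..R, q x := fun R hR => by
    have := intervalIntegral.sub_le_integral_of_hasDeriv_right_of_le hR (hFc R)
      (fun x hx => (hFd x hx.1).hasDerivWithinAt) (cq.integrableOn_Icc) (fun x hx => ?_)
    · simpa [hF0] using this
    · have t0 := tpos x hx.1
      set t := Real.tanh (κ * x)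
      have t1 : t ^ 2 ≤ 1 := by
        rw [← sq_abs]; exact pow_le_one₀ (abs_nonneg _) (abs_tanh_le_one _)
      -- The completed square: the integrand minus `F'` is the square of `f' - κ(1/t + m t) f` plus
      -- a nonnegative remainder.
      have : q x - (κ * ((2 * f x * f' x * t - f x ^ 2 * (κ * (1 - t ^ 2))) / t ^ 2 +
          ((m + σ) * (κ * (1 - t ^ 2)) * f x ^ 2 + (m + σ) * t * (2 * f x * f' x)))) =
          (f' x - κ * (1 / t + m * t) * f x) ^ 2 +
            (κ * f x) ^ 2 * (1 - t ^ 2) * ((m + σ) * (m - σ - 1)) := by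
        have ht : t ≠ 0 := t0.ne'
        simp only [hq]
        change (f' x + σ * κ * t * f x) ^ 2 - _ - _ = _
        field_simp
        ring
      have h3 : 0 ≤ (κ * f x) ^ 2 * (1 - t ^ 2) * ((m + σ) * (m - σ - 1)) := by
        have : 0 ≤ 1 - t ^ 2 := by linarith
        positivity
      nlinarith [sq_nonneg (f' x - κ * (1 / t + m * t) * f x)]
  have lim1 : Tendsto F atTop (𝓝 0) := by
    have hbd : Tendsto (fun x => (κ * (1 / Real.tanh (κ * 1) + |m + σ|)) * f x ^ 2) atTop (𝓝 0) :=
      (hd.sq.const_mul _).tendsto_atTop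
    refine squeeze_zero_norm' ?_ hbd
    filter_upwards [eventually_ge_atTop 1] with x hx
    have tx := tpos x (by linarith)
    have t1 := tpos 1 one_pos
    have hmono : Real.tanh (κ * 1) ≤ Real.tanh (κ * x) := by
      have hm : MonotoneOn (fun x => Real.tanh (κ * x)) univ := by
        refine monotoneOn_of_deriv_nonneg convex_univ ct.continuousOn
          (fun x _ => (hasDerivAt_tanh_mul κ x).differentiableAt.differentiableWithinAt)
          (fun x _ => ?_)
        rw [(hasDerivAt_tanh_mul κ x).deriv]
        have : Real.tanh (κ * x) ^ 2 ≤ 1 := by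
          rw [← sq_abs]; exact pow_le_one₀ (abs_nonneg _) (abs_tanh_le_one _)
        have : 0 ≤ 1 - Real.tanh (κ * x) ^ 2 := by linarith
        positivity
      exact hm (mem_univ _) (mem_univ _) hx
    rw [Real.norm_eq_abs, hF, abs_mul, abs_of_pos hκ, mul_assoc κ]
    refine mul_le_mul_of_nonneg_left (le_trans (abs_add_le _ _) ?_) hκ.le
    rw [add_mul (1 / Real.tanh (κ * 1))]
    refine add_le_add ?_ ?_
    · rw [abs_of_nonneg (by positivity), div_eq_inv_mul, one_div]
      gcongr
    · rw [abs_mul, abs_mul, abs_of_nonneg (sq_nonneg (f x))]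
      gcongr
      exact mul_le_of_le_one_right (abs_nonneg _) (abs_tanh_le_one _)
  have lim2 := intervalIntegral_tendsto_integral_Ioi 0 (dq.integrable cq).integrableOn tendsto_id
  refine le_of_tendsto_of_tendsto lim1 lim2 ?_
  filter_upwards [eventually_ge_atTop 0] with R hR using key R hR

/-- A Hardy-type inequality for functions vanishing at the origin. -/
theorem hardy {f f' : ℝ → ℝ} (hf : ∀ x, HasDerivAt f (f' x) x) (hf'c : Continuous f')
    (hd : Dec f) (hd' : Dec f') (h0 : f 0 = 0) {κ σ m : ℝ} (hκ : 0 < κ)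
    (hm : 0 ≤ (m + σ) * (m - σ - 1)) :
    κ ^ 2 * (σ ^ 2 - (m + 1) ^ 2) * ∫ x, f x ^ 2 ≤
      ∫ x, (f' x + σ * κ * Real.tanh (κ * x) * f x) ^ 2 := by
  have cf : Continuous f := continuous_iff_continuousAt.2 fun x => (hf x).continuousAt
  have ct := continuous_tanh_mul κ
  have dG : Dec (fun x => f' x + σ * κ * Real.tanh (κ * x) * f x) := by
    refine hd'.add (hd.mul_bdd (|σ * κ|) fun x => ?_)
    rw [abs_mul]
    exact mul_le_of_le_one_right (abs_nonneg _) (abs_tanh_le_one _)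
  have i1 := dG.sq.integrable (by fun_prop)
  have i2 := (hd.sq.const_mul (κ ^ 2 * (σ ^ 2 - (m + 1) ^ 2))).integrable (by fun_prop)
  have h1 := hardy_half hf hf'c hd hd' h0 hκ hm
  -- The negative half-line is the half-line inequality for the reflected function; oddness of
  -- `tanh` makes the two integrands match.
  have h2 := hardy_half (f := fun x => f (-x)) (f' := fun x => -f' (-x))
    (fun x => by simpa [Function.comp_def] using (hf (-x)).comp x (hasDerivAt_neg x)) (by fun_prop)
    hd.comp_neg
    hd'.comp_neg.neg (by simpa using h0) hκ hm
  have e2 : ∀ x, (-f' (-x) + σ * κ * Real.tanh (κ * x) * f (-x)) ^ 2 -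
      κ ^ 2 * (σ ^ 2 - (m + 1) ^ 2) * f (-x) ^ 2 =
      (fun x => (f' x + σ * κ * Real.tanh (κ * x) * f x) ^ 2 -
      κ ^ 2 * (σ ^ 2 - (m + 1) ^ 2) * f x ^ 2) (-x) := fun x => by
    simp only [mul_neg, Real.tanh_neg]; ring
  rw [funext e2, integral_comp_neg_Ioi 0 fun x => (f' x + σ * κ * Real.tanh (κ * x) * f x) ^ 2 -
    κ ^ 2 * (σ ^ 2 - (m + 1) ^ 2) * f x ^ 2, neg_zero] at h2
  have h3 := intervalIntegral.integral_Iic_add_Ioi (b := (0 : ℝ)) (i1.sub i2).integrableOn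
    (i1.sub i2).integrableOn
  have h4 := integral_sub i1 i2
  rw [integral_const_mul] at h4
  simp only [Pi.sub_apply] at h3
  linarith

theorem integral_add_mul_add_mul {f g h : ℝ → ℝ} (hf : Integrable f) (hg : Integrable g)
    (hh : Integrable h) (b c : ℝ) :
    ∫ x, (f x + (b * g x + c * h x)) = (∫ x, f x) + (b * (∫ x, g x) + c * ∫ x, h x) := by
  rw [integral_add hf ((hg.const_mul b).fun_add (hh.const_mul c)),
    integral_add (hg.const_mul b) (hh.const_mul c), integral_const_mul, integral_const_mul]

/-! ### Powers of the hyperbolic secant -/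

/-- `sech^q(κx)`. -/
def sechPow (q κ x : ℝ) : ℝ := Real.exp (-(q * Real.log (Real.cosh (κ * x))))

theorem hasDerivAt_log_cosh (κ x : ℝ) :
    HasDerivAt (fun x => Real.log (Real.cosh (κ * x))) (κ * Real.tanh (κ * x)) x := by
  have h : HasDerivAt (fun x : ℝ => κ * x) κ x := by simpa using (hasDerivAt_id x).const_mul κ
  refine (h.cosh.log (Real.cosh_pos _).ne').congr_deriv ?_
  rw [Real.tanh_eq_sinh_div_cosh]; ring

theorem le_log_cosh (x : ℝ) : |x| - Real.log 2 ≤ Real.log (Real.cosh x) := by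
  rw [← Real.log_exp |x|, ← Real.log_div (Real.exp_pos _).ne' two_ne_zero]
  apply Real.log_le_log (by positivity)
  rw [← Real.cosh_abs, Real.cosh_eq]
  have := Real.exp_pos (-|x|)
  linarith

theorem isProf_sechPow {q κ : ℝ} (hq : 0 < q) (hκ : 0 < κ) :
    IsProf (sechPow q κ) ∧
      deriv (sechPow q κ) = (fun x => -(q * κ * Real.tanh (κ * x)) * sechPow q κ x) ∧
      deriv (deriv (sechPow q κ)) = fun x => ((q * κ * Real.tanh (κ * x)) ^ 2 -
        q * κ * (κ * (1 - Real.tanh (κ * x) ^ 2))) * sechPow q κ x := by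
  have hs : ContDiff ℝ (⊤ : ℕ∞) (fun x => q * Real.log (Real.cosh (κ * x))) := by
    refine contDiff_const.mul (ContDiff.log ?_ fun x => (Real.cosh_pos _).ne')
    exact Real.contDiff_cosh.comp (contDiff_const.mul contDiff_id)
  have l2 : 0 ≤ Real.log 2 := Real.log_nonneg one_le_two
  have t2 : ∀ x, |1 - Real.tanh (κ * x) ^ 2| ≤ 1 := fun x => by
    have : Real.tanh (κ * x) ^ 2 ≤ 1 := by
      rw [← sq_abs]; exact pow_le_one₀ (abs_nonneg _) (abs_tanh_le_one _)
    rw [abs_of_nonneg (by linarith)]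
    linarith [sq_nonneg (Real.tanh (κ * x))]
  refine isProf_exp_neg (c := q * κ) (M := q * Real.log 2 + q * κ + q * κ * κ) hs
    (fun x => by simp) (fun x => ?_) (fun x => (hasDerivAt_tanh_mul κ x).const_mul (q * κ))
    (by positivity) (fun x => ?_) (fun x => ?_) fun x => ?_
  · exact ((hasDerivAt_log_cosh κ x).const_mul q).congr_deriv (by ring)
  · have := mul_le_mul_of_nonneg_left (le_log_cosh (κ * x)) hq.le
    rw [abs_mul, abs_of_pos hκ] at this
    have : 0 ≤ q * κ + q * κ * κ := by positivity
    nlinarith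
  · rw [abs_mul, abs_of_pos (by positivity : 0 < q * κ)]
    have := mul_le_mul_of_nonneg_left (abs_tanh_le_one (κ * x)) (by positivity : 0 ≤ q * κ)
    have : 0 ≤ q * Real.log 2 + q * κ * κ := by positivity
    linarith
  · rw [abs_mul (q * κ), abs_mul κ, abs_of_pos (by positivity : 0 < q * κ), abs_of_pos hκ]
    have := mul_le_mul_of_nonneg_left (t2 x) (by positivity : 0 ≤ q * κ * κ)
    have : 0 ≤ q * Real.log 2 + q * κ := by positivity
    linarith

theorem sechPow_pos (q κ x : ℝ) : 0 < sechPow q κ x := Real.exp_pos _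

theorem sechPow_zero (q κ : ℝ) : sechPow q κ 0 = 1 := by simp [sechPow]

/-! ### The Pöschl–Teller operator -/

/-- `-∂²g + (s²κ² - s(s+1)κ² sech²(κx)) g`. -/
def ptOp (s κ : ℝ) (g : ℝ → ℝ) (x : ℝ) : ℝ :=
  -deriv (deriv g) x +
    (s ^ 2 * κ ^ 2 - s * (s + 1) * κ ^ 2 * (1 - Real.tanh (κ * x) ^ 2)) * g x

/-- `∂g + sκ tanh(κx) g`; it annihilates `sech^s(κx)`. -/
def ptLower (s κ : ℝ) (g : ℝ → ℝ) (x : ℝ) : ℝ := deriv g x + s * κ * Real.tanh (κ * x) * g x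

section

variable {s κ : ℝ} {g : ℝ → ℝ}

theorem IsProf.hasDerivAt_ptLower (hg : IsProf g) (x : ℝ) :
    HasDerivAt (ptLower s κ g) (deriv (deriv g) x + s * κ * (κ * (1 - Real.tanh (κ * x) ^ 2) * g x +
      Real.tanh (κ * x) * deriv g x)) x := by
  refine ((hg.hasDerivAt' x).fun_add (((hasDerivAt_tanh_mul κ x).const_mul (s * κ)).fun_mul
    (hg.hasDerivAt x))).congr_deriv ?_
  ring

theorem tanh_sq_bound (κ x : ℝ) : 0 ≤ 1 - Real.tanh (κ * x) ^ 2 := by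
  have : Real.tanh (κ * x) ^ 2 ≤ 1 := by
    rw [← sq_abs]; exact pow_le_one₀ (abs_nonneg _) (abs_tanh_le_one _)
  linarith

theorem Dec.tanh_mul {h : ℝ → ℝ} (hh : Dec h) (κ : ℝ) : Dec (fun x => Real.tanh (κ * x) * h x) :=
  hh.mul_bdd 1 fun _ => abs_tanh_le_one _

theorem Dec.sech_mul {h : ℝ → ℝ} (hh : Dec h) (κ : ℝ) :
    Dec (fun x => (1 - Real.tanh (κ * x) ^ 2) * h x) :=
  hh.mul_bdd 1 fun x => by
    rw [abs_of_nonneg (tanh_sq_bound κ x)]; linarith [sq_nonneg (Real.tanh (κ * x))]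

theorem IsProf.dec_ptLower (hg : IsProf g) : Dec (ptLower s κ g) := by
  have := hg.dec'.add ((hg.dec.tanh_mul κ).const_mul (s * κ))
  unfold ptLower
  simpa only [mul_assoc] using this

theorem IsProf.dec_ptLower' (hg : IsProf g) :
    Dec (fun x => deriv (deriv g) x + s * κ * (κ * (1 - Real.tanh (κ * x) ^ 2) * g x +
      Real.tanh (κ * x) * deriv g x)) := by
  have := hg.dec''.add ((((hg.dec.sech_mul κ).const_mul κ).add (hg.dec'.tanh_mul κ)).const_mul
    (s * κ))
  simpa only [mul_assoc] using this

theorem IsProf.continuous_ptLower' (hg : IsProf g) :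
    Continuous (fun x => deriv (deriv g) x + s * κ * (κ * (1 - Real.tanh (κ * x) ^ 2) * g x +
      Real.tanh (κ * x) * deriv g x)) := by
  have := hg.cont; have := hg.cont'; have := hg.cont''; have := continuous_tanh_mul κ
  fun_prop

theorem IsProf.continuous_ptLower (hg : IsProf g) : Continuous (ptLower s κ g) := by
  have := hg.cont; have := hg.cont'; have := continuous_tanh_mul κ
  unfold ptLower
  fun_prop

theorem IsProf.continuous_ptOp (hg : IsProf g) : Continuous (ptOp s κ g) := by
  have := hg.cont; have := hg.cont''; have := continuous_tanh_mul κ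
  unfold ptOp
  fun_prop

theorem ptOp_eq (s κ : ℝ) (g : ℝ → ℝ) (x : ℝ) :
    ptOp s κ g x = -(deriv (deriv g) x + s * κ * (κ * (1 - Real.tanh (κ * x) ^ 2) * g x +
      Real.tanh (κ * x) * deriv g x)) + s * κ * Real.tanh (κ * x) * ptLower s κ g x := by
  unfold ptOp ptLower; ring

theorem IsProf.dec_ptOp (hg : IsProf g) : Dec (ptOp s κ g) := by
  have := hg.dec_ptLower' (s := s) (κ := κ) |>.neg.add
    (((hg.dec_ptLower (s := s) (κ := κ)).tanh_mul κ).const_mul (s * κ))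
  simp only [← mul_assoc (s * κ)] at this
  refine this.mono 1 fun x => ?_
  rw [ptOp_eq, one_mul]

/-- `⟨Ng, h⟩ = ∫ (Ag)(Ah)`. -/
theorem integral_ptOp_mul {h : ℝ → ℝ} (hg : IsProf g) (hh : IsProf h) :
    ∫ x, ptOp s κ g x * h x = ∫ x, ptLower s κ g x * ptLower s κ h x := by
  have e := integral_deriv_mul_eq (hg.hasDerivAt_ptLower (s := s) (κ := κ)) hh.hasDerivAt
    hg.continuous_ptLower' hh.cont' hg.dec_ptLower hh.dec hg.dec_ptLower' hh.dec'
  have i1 := (hg.dec_ptLower.mul hh.dec').integrable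
    ((hg.continuous_ptLower (s := s) (κ := κ)).mul hh.cont')
  have i2 := ((hg.dec_ptLower' (s := s) (κ := κ)).mul hh.dec).integrable
    (hg.continuous_ptLower'.mul hh.cont)
  have i3 := (((hg.dec_ptLower (s := s) (κ := κ)).tanh_mul κ).mul hh.dec |>.const_mul
    (s * κ)).integrable (((((continuous_tanh_mul κ).mul hg.continuous_ptLower).mul hh.cont)).const_mul
      (s * κ))
  calc ∫ x, ptOp s κ g x * h x = ∫ x, (-((deriv (deriv g) x + s * κ * (κ *
        (1 - Real.tanh (κ * x) ^ 2) * g x + Real.tanh (κ * x) * deriv g x)) * h x) +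
          s * κ * (Real.tanh (κ * x) * ptLower s κ g x * h x)) := by
        congr 1; ext x; rw [ptOp_eq]; ring
    _ = (∫ x, ptLower s κ g x * deriv h x) +
        ∫ x, s * κ * (Real.tanh (κ * x) * ptLower s κ g x * h x) := by
        rw [integral_add i2.fun_neg i3, integral_neg, e, neg_neg]
    _ = _ := by
        rw [← integral_add i1 i3]
        congr 1; ext x; simp only [ptLower]; ring

theorem IsProf.integrable_mul {h : ℝ → ℝ} (hg : IsProf g) (hh : IsProf h) :
    Integrable (fun x => g x * h x) := (hg.dec.mul hh.dec).integrable (hg.cont.mul hh.cont)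

theorem IsProf.integrable_sq (hg : IsProf g) : Integrable (fun x => g x ^ 2) :=
  hg.dec.sq.integrable (hg.cont.pow 2)

/-- `‖Ng‖² ≥ q(2s - q)κ² ⟨Ng, g⟩` for even `g`. -/
theorem ptOp_sq_ge (hg : IsProf g) (hκ : 0 < κ) {q : ℝ} (hq2 : q ≤ 2) (hqs : q ≤ 2 * s + 1) :
    κ ^ 2 * (q * (2 * s - q)) * ∫ x, ptOp s κ g x * g x ≤ ∫ x, ptOp s κ g x ^ 2 := by
  -- The inequality is applied to `f = Ag`, which is odd and so vanishes at `0`. With `σ = -s` the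
  -- right side is `‖A*Ag‖²`, the constant is `κ²(s² - (q - s)²)`, and the sign condition becomes
  -- `(q - 1 - 2s)(q - 2) ≥ 0`.
  have h := hardy (σ := -s) (m := q - 1 - s) (hg.hasDerivAt_ptLower (s := s) (κ := κ))
    hg.continuous_ptLower' hg.dec_ptLower hg.dec_ptLower'
    (by simp [ptLower, hg.deriv_zero]) hκ (by nlinarith)
  rw [integral_ptOp_mul hg hg]
  simp only [← pow_two]
  convert h using 1
  · congr 1; ring
  · congr 1; ext x; rw [ptOp_eq]; ring

theorem ptOp_nonneg (hg : IsProf g) : 0 ≤ ∫ x, ptOp s κ g x * g x := by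
  rw [integral_ptOp_mul hg hg]
  exact integral_nonneg fun x => mul_self_nonneg _

theorem ptLower_sechPow (hs : 0 < s) (hκ : 0 < κ) (x : ℝ) : ptLower s κ (sechPow s κ) x = 0 := by
  rw [ptLower, (isProf_sechPow hs hκ).2.1]; ring

/-- `N sech^s = 0`, in integrated form. -/
theorem integral_ptOp_mul_sechPow (hg : IsProf g) (hs : 0 < s) (hκ : 0 < κ) :
    ∫ x, ptOp s κ g x * sechPow s κ x = 0 := by
  rw [integral_ptOp_mul hg (isProf_sechPow hs hκ).1]
  simp [ptLower_sechPow hs hκ]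

/-- The gap of `N` on even functions orthogonal to its kernel. -/
theorem ptOp_gap (hg : IsProf g) (hs : 0 < s) (hκ : 0 < κ) (hk : κ ^ 2 * (2 * s - 1) = 1)
    (h0 : ∫ x, g x * sechPow s κ x = 0) :
    ∫ x, g x ^ 2 ≤ ∫ x, ptOp s κ g x * g x := by
  obtain ⟨hS, hS', -⟩ := isProf_sechPow hs hκ
  -- Subtracting `g(0) sech^s` creates a zero at the origin without changing `Ag`. Since `g` is
  -- orthogonal to `sech^s`, this can only increase the `L²` norm.
  set w : ℝ → ℝ := g + (-g 0) • sechPow s κ with hw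
  have hwp : IsProf w := hg.add (hS.smul _)
  have hd : deriv w = deriv g + (-g 0) • deriv (sechPow s κ) := funext fun x =>
    ((hg.hasDerivAt x).add ((hS.hasDerivAt x).const_smul (-g 0))).deriv
  have h := hardy (σ := s) (m := -s) hwp.hasDerivAt hwp.cont' hwp.dec hwp.dec'
    (by simp [hw, sechPow_zero]) hκ (by simp)
  have e1 : κ ^ 2 * (s ^ 2 - (-s + 1) ^ 2) = 1 := by linear_combination hk
  have e2 : ∀ x, deriv w x + s * κ * Real.tanh (κ * x) * w x = ptLower s κ g x := fun x => by
    rw [hd, hS']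
    simp only [hw, Pi.add_apply, Pi.smul_apply, smul_eq_mul, ptLower]; ring
  rw [e1, one_mul] at h
  simp only [e2] at h
  rw [integral_ptOp_mul hg hg]
  simp only [← pow_two]
  refine le_trans ?_ h
  have e3 : ∫ x, w x ^ 2 = (∫ x, g x ^ 2) + ((-2 * g 0) * (∫ x, g x * sechPow s κ x) +
      g 0 ^ 2 * ∫ x, sechPow s κ x ^ 2) := by
    rw [← integral_add_mul_add_mul hg.integrable_sq (hg.integrable_mul hS) hS.integrable_sq]
    congr 1; ext x
    simp only [hw, Pi.add_apply, Pi.smul_apply, smul_eq_mul]; ring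
  rw [e3, h0]
  have : 0 ≤ g 0 ^ 2 * ∫ x, sechPow s κ x ^ 2 :=
    mul_nonneg (sq_nonneg _) (integral_nonneg fun x => sq_nonneg _)
  linarith

theorem integral_ptOp_sub_sq (hg : IsProf g) (μ : ℝ) :
    ∫ x, (ptOp s κ g x + μ * g x) ^ 2 = (∫ x, ptOp s κ g x ^ 2) +
      (2 * μ * (∫ x, ptOp s κ g x * g x) + μ ^ 2 * ∫ x, g x ^ 2) := by
  have i1 := (hg.dec_ptOp (s := s) (κ := κ)).sq.integrable (hg.continuous_ptOp.pow 2)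
  have i2 := ((hg.dec_ptOp (s := s) (κ := κ)).mul hg.dec).integrable
    (hg.continuous_ptOp.mul hg.cont)
  rw [← integral_add_mul_add_mul i1 i2 hg.integrable_sq]
  congr 1; ext x; ring

/-- `N - 1` is bounded below on even functions. -/
theorem exists_ptOp_sub_one_ge (hs : 1 < s) (hκ : 0 < κ) (hk : κ ^ 2 * (2 * s - 1) = 1) :
    ∃ c : ℝ, 0 < c ∧ ∀ g, IsProf g → c * ∫ x, g x ^ 2 ≤ ∫ x, (ptOp s κ g x + (-1) * g x) ^ 2 := by
  obtain ⟨l, l1, l2, hl⟩ : ∃ l : ℝ, 1 < l ∧ l ≤ 2 ∧ ∀ g, IsProf g →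
      l * ∫ x, ptOp s κ g x * g x ≤ ∫ x, ptOp s κ g x ^ 2 := by
    -- Any `q` with `1 < q ≤ s` satisfies `q(2s - q) > 2s - 1`, since the difference is `(q - 1)(2s
    -- - 1 - q)`; hence the constant exceeds `κ²(2s - 1) = 1`. The bound `q ≤ 2` is required by
    -- `ptOp_sq_ge`.
    set q := min s 2
    have q1 : 1 < q := lt_min hs one_lt_two
    have qs : q ≤ s := min_le_left _ _
    refine ⟨min (κ ^ 2 * (q * (2 * s - q))) 2, lt_min ?_ one_lt_two, min_le_right _ _,
      fun g hg => ?_⟩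
    · rw [← hk]
      have : 0 < κ ^ 2 := by positivity
      apply mul_lt_mul_of_pos_left _ this
      nlinarith
    · refine le_trans ?_ (ptOp_sq_ge hg hκ (min_le_right _ _) (by linarith : q ≤ 2 * s + 1))
      exact mul_le_mul_of_nonneg_right (min_le_left _ _) (ptOp_nonneg hg)
  refine ⟨(l - 1) ^ 2, by nlinarith, fun g hg => ?_⟩
  have h1 := hl g hg
  have h2 := integral_ptOp_sub_sq (s := s) (κ := κ) hg (-l)
  have h3 : 0 ≤ ∫ x, (ptOp s κ g x + -l * g x) ^ 2 := integral_nonneg fun x => sq_nonneg _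
  have h4 := integral_ptOp_sub_sq (s := s) (κ := κ) hg (-1)
  rw [h2] at h3
  rw [h4]
  set a := ∫ x, ptOp s κ g x ^ 2
  set b := ∫ x, ptOp s κ g x * g x
  set d := ∫ x, g x ^ 2
  -- Morally the even spectrum of `N` lies in `{0} ∪ [l, ∞)`, where `(λ - 1)² ≥ (l - 1)²` because `1
  -- < l ≤ 2`. The identity expresses this through `‖Ng‖² ≥ l⟨Ng, g⟩` and `‖(N - l)g‖² ≥ 0`.
  have key : l * (a + (2 * -1 * b + (-1) ^ 2 * d) - (l - 1) ^ 2 * d) =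
      (2 * l - 2) * (a - l * b) + (2 - l) * (a + (2 * -l * b + (-l) ^ 2 * d)) := by ring
  have : 0 ≤ l * (a + (2 * -1 * b + (-1) ^ 2 * d) - (l - 1) ^ 2 * d) := by
    rw [key]
    exact add_nonneg (mul_nonneg (by linarith) (by linarith)) (mul_nonneg (by linarith) h3)
  have := nonneg_of_mul_nonneg_right this (by linarith)
  linarith

/-- `‖(N + μ)g‖ ≥ μ‖g‖` for `μ ≥ 0`. -/
theorem ptOp_add_ge (hg : IsProf g) {μ : ℝ} (hμ : 0 ≤ μ) :
    μ ^ 2 * ∫ x, g x ^ 2 ≤ ∫ x, (ptOp s κ g x + μ * g x) ^ 2 := by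
  rw [integral_ptOp_sub_sq hg]
  have h1 := ptOp_nonneg (s := s) (κ := κ) hg
  have h2 : 0 ≤ ∫ x, ptOp s κ g x ^ 2 := integral_nonneg fun x => sq_nonneg _
  have := mul_nonneg (mul_nonneg zero_le_two hμ) h1
  linarith

/-- `‖-∂²g + μg‖² = ‖∂²g‖² + 2μ‖∂g‖² + μ²‖g‖²`. -/
theorem integral_neg_deriv2_add_sq (hg : IsProf g) (μ : ℝ) :
    ∫ x, (-deriv (deriv g) x + μ * g x) ^ 2 = (∫ x, deriv (deriv g) x ^ 2) +
      (2 * μ * (∫ x, deriv g x ^ 2) + μ ^ 2 * ∫ x, g x ^ 2) := by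
  have e := integral_deriv_mul_eq hg.hasDerivAt' hg.hasDerivAt hg.cont'' hg.cont' hg.dec' hg.dec
    hg.dec'' hg.dec'
  have i1 := hg.dec''.sq.integrable (hg.cont''.pow 2)
  have i2 := (hg.dec''.mul hg.dec).integrable (hg.cont''.mul hg.cont)
  simp only [pow_two (deriv g _)]
  have : ∫ x, (-deriv (deriv g) x + μ * g x) ^ 2 = (∫ x, deriv (deriv g) x ^ 2) +
      (-(2 * μ) * (∫ x, deriv (deriv g) x * g x) + μ ^ 2 * ∫ x, g x ^ 2) := by
    rw [← integral_add_mul_add_mul i1 i2 hg.integrable_sq]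
    congr 1; ext x; ring
  rw [this, e]; ring

end

/-! ### The resolvent of `-∂ₓ²` on compactly supported even data -/

/-- The solution is the convolution of `g` with `e^{-k|x|}/(2k)`, written by variation of constants
so that smoothness and the equation follow by differentiation. Beyond the support of `g` it is a
multiple of `e^{-k|x|}`. -/
theorem exists_isProf_resolvent {g : ℝ → ℝ} (hg : ContDiff ℝ (⊤ : ℕ∞) g) (hc : HasCompactSupport g)
    (he : ∀ x, g (-x) = g x) {k : ℝ} (hk : 0 < k) :
    ∃ v, IsProf v ∧ ∀ x, -deriv (deriv v) x + k ^ 2 * v x = g x := by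
  obtain ⟨M, M0, hM⟩ : ∃ M : ℝ, 0 < M ∧ ∀ x, M ≤ |x| → g x = 0 := by
    obtain ⟨M, M0, hM⟩ := hc.exists_pos_le_norm
    exact ⟨M, M0, fun x hx => hM x hx⟩
  have gc := hg.continuous
  set P : ℝ → ℝ := fun x => ∫ t in (0 : ℝ)..x, Real.exp (k * t) * g t with hP
  set Q : ℝ → ℝ := fun x => ∫ t in (0 : ℝ)..x, Real.exp (-(k * t)) * g t with hQ
  have cP : Continuous (fun t => Real.exp (k * t) * g t) := by fun_prop
  have cQ : Continuous (fun t => Real.exp (-(k * t)) * g t) := by fun_prop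
  have dP : ∀ x, HasDerivAt P (Real.exp (k * x) * g x) x := fun x =>
    intervalIntegral.integral_hasDerivAt_right (cP.intervalIntegrable _ _)
      cP.aestronglyMeasurable.stronglyMeasurableAtFilter cP.continuousAt
  have dQ : ∀ x, HasDerivAt Q (Real.exp (-(k * x)) * g x) x := fun x =>
    intervalIntegral.integral_hasDerivAt_right (cQ.intervalIntegrable _ _)
      cQ.aestronglyMeasurable.stronglyMeasurableAtFilter cQ.continuousAt
  have he1 : ContDiff ℝ (⊤ : ℕ∞) (fun t : ℝ => Real.exp (k * t)) :=
    Real.contDiff_exp.comp (contDiff_const.mul contDiff_id)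
  have he2 : ContDiff ℝ (⊤ : ℕ∞) (fun t : ℝ => Real.exp (-(k * t))) :=
    Real.contDiff_exp.comp (contDiff_const.mul contDiff_id).neg
  have sP : ContDiff ℝ (⊤ : ℕ∞) P := contDiff_infty_iff_deriv.2
    ⟨fun x => (dP x).differentiableAt, by rw [funext fun x => (dP x).deriv]; exact he1.mul hg⟩
  have sQ : ContDiff ℝ (⊤ : ℕ∞) Q := contDiff_infty_iff_deriv.2
    ⟨fun x => (dQ x).differentiableAt, by rw [funext fun x => (dQ x).deriv]; exact he2.mul hg⟩
  have hPQ : ∀ x, P (-x) = -Q x := fun x => by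
    have := intervalIntegral.integral_comp_neg (a := 0) (b := x) (fun t => Real.exp (k * t) * g t)
    simp only [he, neg_zero, mul_neg] at this
    simp only [hP, hQ, this]
    exact intervalIntegral.integral_symm _ _
  have hconst : ∀ {f : ℝ → ℝ}, Continuous f → (∀ t, M ≤ t → f t = 0) → ∀ x, M ≤ x →
      ∫ t in (0 : ℝ)..x, f t = ∫ t in (0 : ℝ)..M, f t := fun {f} cf f0 x hx => by
    have h := intervalIntegral.integral_add_adjacent_intervals (μ := volume)
      (cf.intervalIntegrable 0 M) (cf.intervalIntegrable M x)
    have h0 : ∫ t in M..x, f t = 0 := by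
      rw [intervalIntegral.integral_congr (g := fun _ => (0 : ℝ))]
      · simp
      · intro t ht
        rw [uIcc_of_le hx] at ht
        exact f0 t ht.1
    rw [h0, add_zero] at h
    exact h.symm
  have hQM : ∀ x, M ≤ x → Q x = Q M :=
    hconst cQ fun t ht => by simp [hM t (ht.trans (le_abs_self t))]
  have hPM : ∀ x, M ≤ x → P x = P M :=
    hconst cP fun t ht => by simp [hM t (ht.trans (le_abs_self t))]
  -- By evenness `I` is both `∫_0^∞ e^{-kt} g` and `∫_{-∞}^0 e^{kt} g`. Then `P x + I` and `I - Q x`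
  -- are the integrals over `(-∞, x]` and `[x, ∞)`, and the growing exponentials drop out at both
  -- ends.
  set I := Q M
  set v : ℝ → ℝ := fun x => (Real.exp (-(k * x)) * (P x + I) + Real.exp (k * x) * (I - Q x)) / (2 * k)
    with hv
  set v₁ : ℝ → ℝ := fun x => (-(Real.exp (-(k * x)) * (P x + I)) + Real.exp (k * x) * (I - Q x)) / 2
    with hv₁
  have d1 : ∀ x, HasDerivAt (fun t : ℝ => Real.exp (k * t)) (k * Real.exp (k * x)) x := fun x => by
    have : HasDerivAt (fun t : ℝ => k * t) k x := by simpa using (hasDerivAt_id x).const_mul k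
    simpa [mul_comm] using this.exp
  have d2 : ∀ x, HasDerivAt (fun t : ℝ => Real.exp (-(k * t))) (-k * Real.exp (-(k * x))) x :=
    fun x => by
    have : HasDerivAt (fun t : ℝ => -(k * t)) (-k) x := by
      simpa using ((hasDerivAt_id x).const_mul k).fun_neg
    simpa [mul_comm] using this.exp
  have hexp : ∀ x : ℝ, Real.exp (-(k * x)) * Real.exp (k * x) = 1 := fun x => by
    rw [← Real.exp_add]; simp
  have e1 : ∀ x, HasDerivAt v (v₁ x) x := fun x => by
    refine ((((d2 x).fun_mul ((dP x).add_const I)).fun_add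
      ((d1 x).fun_mul ((dQ x).const_sub I))).div_const (2 * k)).congr_deriv ?_
    simp only [hv₁]
    have := hk.ne'
    field_simp
    linear_combination 0 * hexp x
  have e2 : ∀ x, HasDerivAt v₁ (k ^ 2 * v x - g x) x := fun x => by
    refine (((((d2 x).fun_mul ((dP x).add_const I)).fun_neg).fun_add
      ((d1 x).fun_mul ((dQ x).const_sub I))).div_const 2).congr_deriv ?_
    simp only [hv]
    have := hk.ne'
    field_simp
    linear_combination (-2 * g x) * hexp x
  have ev : ∀ x, v (-x) = v x := fun x => by
    have h1 := hPQ x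
    have h2 : Q (-x) = -P x := by have := hPQ (-x); rw [neg_neg] at this; linarith
    simp only [hv, h1, h2, mul_neg, neg_neg]
    ring
  have sv : ContDiff ℝ (⊤ : ℕ∞) v :=
    ((he2.mul (sP.add contDiff_const)).add (he1.mul (contDiff_const.sub sQ))).div_const _
  have cv := sv.continuous
  have out : ∀ x, M ≤ x → v x = (P M + I) / (2 * k) * Real.exp (-(k * x)) := fun x hx => by
    simp only [hv, hQM x hx, hPM x hx]; ring
  have out1 : ∀ x, M ≤ x → v₁ x = -((P M + I) / 2) * Real.exp (-(k * x)) := fun x hx => by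
    simp only [hv₁, hQM x hx, hPM x hx]; ring
  have odd1 : ∀ x, v₁ (-x) = -v₁ x := fun x => by
    have h1 := hPQ x
    have h2 : Q (-x) = -P x := by have := hPQ (-x); rw [neg_neg] at this; linarith
    simp only [hv₁, h1, h2, mul_neg, neg_neg]
    ring
  have Dv : Dec v := by
    refine dec_of_outside cv (C := |(P M + I) / (2 * k)|) (c := k) (M := M) hk fun x hx => ?_
    have : v x = v |x| := by rcases abs_choice x with h | h <;> rw [h]; exact (ev x).symm
    rw [this, out _ hx, abs_mul, abs_of_pos (Real.exp_pos _), neg_mul]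
  have cv1 : Continuous v₁ := continuous_iff_continuousAt.2 fun x => (e2 x).continuousAt
  have Dv1 : Dec v₁ := by
    refine dec_of_outside cv1 (C := |-((P M + I) / 2)|) (c := k) (M := M) hk fun x hx => ?_
    have : |v₁ x| = |v₁ (|x|)| := by
      rcases abs_choice x with h | h <;> rw [h]
      rw [odd1, abs_neg]
    rw [this, out1 _ hx, abs_mul, abs_of_pos (Real.exp_pos _), neg_mul]
  have Dg : Dec g := dec_of_outside gc (C := 0) (c := k) (M := M) hk fun x hx => by simp [hM x hx]
  obtain ⟨hp, -, h2⟩ := IsProf.mk_of_hasDerivAt sv ev e1 e2 Dv Dv1 ((Dv.const_mul (k ^ 2)).sub Dg)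
  exact ⟨v, hp, fun x => by rw [h2]; ring⟩

/-! ### Trigonometric functions on the torus -/

/-- `cos(ny)`. -/
def cosN (n : ℕ) (y : Torus) : ℝ := (fourier (n : ℤ) y).re

/-- `sin(ny)`. -/
def sinN (n : ℕ) (y : Torus) : ℝ := (fourier (n : ℤ) y).im

theorem fourier_coe_eq (n : ℕ) (t : ℝ) :
    (fourier (n : ℤ) (t : Torus) : ℂ) = Complex.exp ((n * t : ℝ) * Complex.I) := by
  rw [fourier_coe_apply]
  congr 1
  have : (Real.pi : ℂ) ≠ 0 := by exact_mod_cast Real.pi_ne_zero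
  push_cast
  field_simp

theorem cosN_coe (n : ℕ) (t : ℝ) : cosN n t = Real.cos (n * t) := by
  rw [cosN, fourier_coe_eq, Complex.exp_ofReal_mul_I_re]

theorem sinN_coe (n : ℕ) (t : ℝ) : sinN n t = Real.sin (n * t) := by
  rw [sinN, fourier_coe_eq, Complex.exp_ofReal_mul_I_im]

theorem continuous_cosN (n : ℕ) : Continuous (cosN n) :=
  Complex.continuous_re.comp (fourier (n : ℤ)).continuous

theorem continuous_sinN (n : ℕ) : Continuous (sinN n) :=
  Complex.continuous_im.comp (fourier (n : ℤ)).continuous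

theorem cosT_eq : cosT = cosN 1 := by
  funext y
  induction y using QuotientAddGroup.induction_on with
  | H t =>
    rw [cosN_coe, Nat.cast_one, one_mul]
    rfl

theorem abs_cosN_le (n : ℕ) (y : Torus) : |cosN n y| ≤ 1 := by
  induction y using QuotientAddGroup.induction_on with
  | H t => exact (cosN_coe n t) ▸ Real.abs_cos_le_one _

theorem cosN_zero (y : Torus) : cosN 0 y = 1 := by simp [cosN]

theorem cosN_neg (n : ℕ) (y : Torus) : cosN n (-y) = cosN n y := by
  induction y using QuotientAddGroup.induction_on with
  | H t =>
    change cosN n (-(t : Torus)) = cosN n (t : Torus)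
    rw [← AddCircle.coe_neg, cosN_coe, cosN_coe, mul_neg, Real.cos_neg]

theorem sinN_neg (n : ℕ) (y : Torus) : sinN n (-y) = -sinN n y := by
  induction y using QuotientAddGroup.induction_on with
  | H t =>
    change sinN n (-(t : Torus)) = -sinN n (t : Torus)
    rw [← AddCircle.coe_neg, sinN_coe, sinN_coe, mul_neg, Real.sin_neg]

theorem integral_torus (f : Torus → ℝ) : ∫ y, f y = ∫ t in (0 : ℝ)..(2 * Real.pi), f (t : Torus) := by
  rw [← AddCircle.intervalIntegral_preimage (2 * Real.pi) 0, zero_add]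

theorem integral_cos_int_mul (k : ℤ) (hk : k ≠ 0) :
    ∫ t in (0 : ℝ)..(2 * Real.pi), Real.cos (k * t) = 0 := by
  have hk' : (k : ℝ) ≠ 0 := by exact_mod_cast hk
  rw [intervalIntegral.integral_comp_mul_left (fun t => Real.cos t) hk', integral_cos]
  have : Real.sin (k * (2 * Real.pi)) = 0 := by
    rw [show (k : ℝ) * (2 * Real.pi) = ((2 * k : ℤ) : ℝ) * Real.pi by push_cast; ring]
    exact Real.sin_int_mul_pi _
  rw [this]; simp

theorem integral_cosN_mul_cosN {m n : ℕ} (h : m ≠ n) : ∫ y, cosN m y * cosN n y = 0 := by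
  rw [integral_torus]
  have e : ∀ t : ℝ, cosN m t * cosN n t = (1 / 2) * (Real.cos (((m : ℤ) - n : ℤ) * t) +
      Real.cos (((m : ℤ) + n : ℤ) * t)) := fun t => by
    rw [cosN_coe, cosN_coe]
    push_cast
    rw [sub_mul, add_mul, Real.cos_sub, Real.cos_add]; ring
  simp only [e]
  rw [intervalIntegral.integral_const_mul, intervalIntegral.integral_add
    (Continuous.intervalIntegrable (by fun_prop) _ _)
    (Continuous.intervalIntegrable (by fun_prop) _ _),
    integral_cos_int_mul _ (by omega), integral_cos_int_mul _ (by omega)]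
  simp

theorem integral_sinN_mul_sinN {m n : ℕ} (h : m ≠ n) : ∫ y, sinN m y * sinN n y = 0 := by
  rw [integral_torus]
  have e : ∀ t : ℝ, sinN m t * sinN n t = (1 / 2) * (Real.cos (((m : ℤ) - n : ℤ) * t) -
      Real.cos (((m : ℤ) + n : ℤ) * t)) := fun t => by
    rw [sinN_coe, sinN_coe]
    push_cast
    rw [sub_mul, add_mul, Real.cos_sub, Real.cos_add]; ring
  simp only [e]
  rw [intervalIntegral.integral_const_mul, intervalIntegral.integral_sub
    (Continuous.intervalIntegrable (by fun_prop) _ _)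
    (Continuous.intervalIntegrable (by fun_prop) _ _),
    integral_cos_int_mul _ (by omega), integral_cos_int_mul _ (by omega)]
  simp

theorem integral_sinN_sq {n : ℕ} (hn : n ≠ 0) : ∫ y, sinN n y ^ 2 = Real.pi := by
  rw [integral_torus]
  have e : ∀ t : ℝ, sinN n t ^ 2 = (1 / 2) * (1 - Real.cos ((2 * n : ℤ) * t)) := fun t => by
    rw [sinN_coe]
    push_cast
    rw [show (2 * (n : ℝ)) * t = 2 * (n * t) by ring, Real.cos_two_mul, Real.sin_sq]; ring
  simp only [e]
  rw [intervalIntegral.integral_const_mul, intervalIntegral.integral_sub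
    (Continuous.intervalIntegrable (by fun_prop) _ _)
    (Continuous.intervalIntegrable (by fun_prop) _ _), integral_cos_int_mul _ (by omega)]
  simp

theorem integral_cosN_sq {n : ℕ} (hn : n ≠ 0) : ∫ y, cosN n y ^ 2 = Real.pi := by
  rw [integral_torus]
  have e : ∀ t : ℝ, cosN n t ^ 2 = (1 / 2) * (1 + Real.cos ((2 * n : ℤ) * t)) := fun t => by
    rw [cosN_coe]
    push_cast
    rw [show (2 * (n : ℝ)) * t = 2 * (n * t) by ring, Real.cos_two_mul]; ring
  simp only [e]
  rw [intervalIntegral.integral_const_mul, intervalIntegral.integral_add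
    (Continuous.intervalIntegrable (by fun_prop) _ _)
    (Continuous.intervalIntegrable (by fun_prop) _ _), integral_cos_int_mul _ (by omega)]
  simp

theorem integral_cosN_zero_sq : ∫ y, cosN 0 y ^ 2 = 2 * Real.pi := by
  rw [integral_torus]
  simp [cosN_zero]

theorem one_le_integral_cosN_sq (n : ℕ) : 1 ≤ ∫ y, cosN n y ^ 2 := by
  have := Real.pi_gt_three
  by_cases hn : n = 0
  · rw [hn, integral_cosN_zero_sq]; linarith
  · rw [integral_cosN_sq hn]; linarith

theorem integral_sinN_sq_le (n : ℕ) : ∫ y, sinN n y ^ 2 ≤ ∫ y, cosN n y ^ 2 := by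
  by_cases hn : n = 0
  · have : ∀ y, sinN n y = 0 := fun y => by simp [hn, sinN]
    simp only [this]
    simpa using integral_nonneg fun y => sq_nonneg (cosN n y)
  · rw [integral_sinN_sq hn, integral_cosN_sq hn]

/-- A square-integrable function on the torus with vanishing Fourier coefficients vanishes. -/
theorem ae_eq_zero_of_fourier {f : Torus → ℝ} (hf : MemLp f 2 volume)
    (hc : ∀ n, ∫ y, f y * cosN n y = 0) (hs : ∀ n, ∫ y, f y * sinN n y = 0) :
    f =ᵐ[volume] 0 := by
  set F : Torus → ℂ := fun y => (f y : ℂ) with hF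
  have hFm : MemLp F 2 volume := hf.ofReal
  have hFh : MemLp F 2 AddCircle.haarAddCircle := memLp_haarAddCircle_iff.2 hFm
  have hfi : Integrable f volume := hf.integrable one_le_two
  have hnat : ∀ n : ℕ, ∫ y, fourier (n : ℤ) y * F y = 0 := fun n => by
    have e : ∀ y, fourier (n : ℤ) y * F y =
        ((f y * cosN n y : ℝ) : ℂ) + ((f y * sinN n y : ℝ) : ℂ) * Complex.I := fun y => by
      rw [← Complex.re_add_im (fourier (n : ℤ) y)]
      simp only [hF, cosN, sinN]
      push_cast; ring
    have i1 : Integrable (fun y => f y * cosN n y) := hfi.mul_bdd (c := 1)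
      (continuous_cosN n).aestronglyMeasurable (.of_forall fun y => by simpa using abs_cosN_le n y)
    have i2 : Integrable (fun y => f y * sinN n y) := by
      obtain ⟨C, hC⟩ := isCompact_univ.exists_bound_of_continuousOn (continuous_sinN n).continuousOn
      exact hfi.mul_bdd (c := C) (continuous_sinN n).aestronglyMeasurable
        (.of_forall fun y => hC y trivial)
    simp only [e]
    rw [integral_add i1.ofReal (i2.ofReal.mul_const _), integral_mul_const,
      integral_complex_ofReal, integral_complex_ofReal, hc, hs]
    simp
  have hint : ∀ n : ℤ, ∫ y, fourier n y * F y = 0 := fun n => by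
    rcases Int.eq_nat_or_neg n with ⟨k, rfl | rfl⟩
    · exact hnat k
    · have e : ∀ y, fourier (-(k : ℤ)) y * F y =
          (starRingEnd ℂ) (fourier (k : ℤ) y * F y) := fun y => by
        rw [fourier_neg, map_mul]; simp [hF]
      simp only [e]
      rw [integral_conj, hnat, map_zero]
  have hcoef : ∀ n : ℤ, fourierCoeff (hFh.toLp F) n = 0 := fun n => by
    rw [fourierCoeff_congr_ae hFh.coeFn_toLp, fourierCoeff, AddCircle.integral_haarAddCircle]
    simp only [smul_eq_mul]
    rw [hint (-n), smul_zero]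
  have h0 : hFh.toLp F = 0 := by
    have : (fourierBasis (T := 2 * Real.pi)).repr (hFh.toLp F) = 0 := by
      ext i
      rw [fourierBasis_repr, hcoef]; rfl
    simpa using this
  have h1 : F =ᵐ[AddCircle.haarAddCircle] 0 := by
    have := hFh.coeFn_toLp
    rw [h0] at this
    exact this.symm.trans (Lp.coeFn_zero _ _ _)
  have h2 : F =ᵐ[volume] 0 := by
    rw [AddCircle.volume_eq_smul_haarAddCircle]
    exact Measure.ae_smul_measure h1 _
  filter_upwards [h2] with y hy
  simpa [hF] using hy

/-! ### Product functions on the cylinder -/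

theorem memLp_prod_fn {G : ℝ → ℝ} {E : Torus → ℝ} (hG : Continuous G) (dG : Dec G)
    (hE : Continuous E) : MemLp (fun z : Cyl => G z.1 * E z.2) 2 volume := by
  rw [memLp_two_iff_integrable_sq (Continuous.aestronglyMeasurable (by fun_prop))]
  have h1 := dG.sq.integrable (hG.pow 2)
  have h2 : Integrable (fun y => E y ^ 2) := (hE.pow 2).integrable_of_hasCompactSupport
    (HasCompactSupport.of_compactSpace _)
  simp only [mul_pow]
  exact h1.mul_prod h2

/-- If `f ∈ L²` is orthogonal to all `g(x)cos(ny)` and `g(x)sin(ny)` then `f = 0`. -/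
theorem L2_eq_zero_of_modes (f : L2)
    (hc : ∀ n, ∀ g : ℝ → ℝ, ContDiff ℝ (⊤ : ℕ∞) g → HasCompactSupport g →
      ∫ z, f z * (g z.1 * cosN n z.2) = 0)
    (hs : ∀ n, ∀ g : ℝ → ℝ, ContDiff ℝ (⊤ : ℕ∞) g → HasCompactSupport g →
      ∫ z, f z * (g z.1 * sinN n z.2) = 0) : f = 0 := by
  have hf := Lp.memLp f
  -- The Fourier coefficient of a slice, as a function of `x`, is locally integrable and orthogonal
  -- to every test function, hence zero for almost every `x`. Countably many modes share one null
  -- set, and Fourier completeness applies on almost every slice.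
  have aux : ∀ E : Torus → ℝ, Continuous E → (∀ g : ℝ → ℝ, ContDiff ℝ (⊤ : ℕ∞) g →
      HasCompactSupport g → ∫ z, f z * (g z.1 * E z.2) = 0) →
      ∀ᵐ x : ℝ, ∫ y, f (x, y) * E y = 0 := fun E hE h => by
    refine ae_eq_zero_of_integral_contDiff_smul_eq_zero ?_ fun g hg hgc => ?_
    · rw [locallyIntegrable_iff]
      intro K hK
      have hm : MemLp (fun z : Cyl => K.indicator 1 z.1 * E z.2) 2 volume := by
        have hmeas : AEStronglyMeasurable (fun z : Cyl => K.indicator (1 : ℝ → ℝ) z.1 * E z.2)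
            volume :=
          ((aestronglyMeasurable_one.indicator hK.measurableSet).comp_fst).mul
            (hE.aestronglyMeasurable.comp_snd)
        rw [memLp_two_iff_integrable_sq hmeas]
        have h1 : Integrable (fun x : ℝ => (K.indicator 1 x : ℝ) ^ 2) := by
          have : (fun x : ℝ => (K.indicator 1 x : ℝ) ^ 2) = K.indicator 1 := by
            funext x; by_cases hx : x ∈ K <;> simp [hx]
          rw [this, integrable_indicator_iff hK.measurableSet]
          exact integrableOn_const hK.measure_lt_top.ne
        have h2 : Integrable (fun y => E y ^ 2) := (hE.pow 2).integrable_of_hasCompactSupport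
          (HasCompactSupport.of_compactSpace _)
        simp only [mul_pow]
        exact h1.mul_prod h2
      have hi := (hf.integrable_mul (q := 2) hm).integral_prod_left
      rw [← integrable_indicator_iff hK.measurableSet]
      refine hi.congr (.of_forall fun x => ?_)
      by_cases hx : x ∈ K <;> simp [hx]
    · have hm := memLp_prod_fn hg.continuous (dec_of_compactSupport hg.continuous hgc) hE
      have := integral_prod _ (hf.integrable_mul (q := 2) hm)
      simp only [Pi.mul_apply] at this
      rw [← Measure.volume_eq_prod, h g hg hgc] at this
      rw [this]
      congr 1; ext x
      rw [smul_eq_mul, ← integral_const_mul]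
      congr 1; ext y; ring
  have h1 : ∀ᵐ x : ℝ, ∀ n, ∫ y, f (x, y) * cosN n y = 0 :=
    ae_all_iff.2 fun n => aux _ (continuous_cosN n) (hc n)
  have h2 : ∀ᵐ x : ℝ, ∀ n, ∫ y, f (x, y) * sinN n y = 0 :=
    ae_all_iff.2 fun n => aux _ (continuous_sinN n) (hs n)
  have hsq : Integrable (fun z : ℝ × Torus => f z ^ 2) (volume.prod volume) :=
    (memLp_two_iff_integrable_sq hf.aestronglyMeasurable).1 hf
  have h3 := hsq.prod_right_ae
  have h4 : ∀ᵐ x : ℝ, AEStronglyMeasurable (fun y => f (x, y)) volume :=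
    hf.aestronglyMeasurable.prodMk_left
  have h5 : ∀ᵐ x : ℝ, (fun y => f (x, y)) =ᵐ[volume] 0 := by
    filter_upwards [h1, h2, h3, h4] with x a b c d
    exact ae_eq_zero_of_fourier ((memLp_two_iff_integrable_sq d).2 c) a b
  have h6 : ∫ z, f z ^ 2 = 0 := by
    refine (integral_prod _ hsq).trans ?_
    refine integral_eq_zero_of_ae ?_
    filter_upwards [h5] with x hx
    refine integral_eq_zero_of_ae ?_
    filter_upwards [hx] with y hy
    simp [hy]
  have h7 : (fun z => f z ^ 2) =ᵐ[volume] 0 :=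
    (integral_eq_zero_iff_of_nonneg (fun z => sq_nonneg _) hsq).1 h6
  refine Lp.ext ?_
  filter_upwards [h7, Lp.coeFn_zero ℝ 2 (volume : Measure Cyl)] with z hz h0
  rw [h0]
  simpa using hz

/-! ### Calculus with test functions -/

/-- Smooth functions on the torus. -/
def SmoothT (E : Torus → ℝ) : Prop := ContDiff ℝ (⊤ : ℕ∞) (fun t : ℝ => E t)

theorem SmoothT.continuous {E : Torus → ℝ} (h : SmoothT E) : Continuous E :=
  (QuotientAddGroup.isOpenQuotientMap_mk (G := ℝ)
    (N := AddSubgroup.zmultiples (2 * Real.pi))).isQuotientMap.continuous_iff.2 (ContDiff.continuous h)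

theorem SmoothT.comp_snd {E : Torus → ℝ} (h : SmoothT E) :
    ContDiff ℝ (⊤ : ℕ∞) (fun z : ℝ × ℝ => E (z.2 : Torus)) :=
  ContDiff.comp (g := fun t : ℝ => E t) h contDiff_snd

theorem IsTest.hasDerivAt_dx {τ : Cyl → ℝ} (h : IsTest τ) (z : Cyl) :
    HasDerivAt (fun s : ℝ => τ (s, z.2)) (dx τ z) z.1 := by
  obtain ⟨x, y⟩ := z
  induction y using QuotientAddGroup.induction_on with
  | H t =>
    have hd : Differentiable ℝ (fun z : ℝ × ℝ => τ (z.1, (z.2 : Torus))) :=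
      h.smooth.differentiable (by simp)
    have : DifferentiableAt ℝ (fun s : ℝ => τ (s, (t : Torus))) x :=
      (hd (x, t)).comp x (f := fun s : ℝ => (s, t)) (by fun_prop)
    exact this.hasDerivAt

theorem IsTest.hasDerivAt_dy {τ : Cyl → ℝ} (h : IsTest τ) (x t : ℝ) :
    HasDerivAt (fun t : ℝ => τ (x, (t : Torus))) (dy τ (x, (t : Torus))) t := by
  have hd : Differentiable ℝ (fun z : ℝ × ℝ => τ (z.1, (z.2 : Torus))) :=
    h.smooth.differentiable (by simp)
  have h1 : DifferentiableAt ℝ (fun s : ℝ => τ (x, (s : Torus))) t :=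
    (hd (x, t)).comp t (f := fun s : ℝ => (x, s)) (by fun_prop)
  have h2 := h1.hasDerivAt
  have e : dy τ (x, (t : Torus)) = deriv (fun s : ℝ => τ (x, (s : Torus))) t := by
    have := deriv_comp_const_add (fun s : ℝ => τ (x, (s : Torus))) t 0
    rw [add_zero] at this
    rw [← this]
    rfl
  rwa [e]

theorem IsTest.integral_dx {τ : Cyl → ℝ} (h : IsTest τ) : ∫ z, dx τ z = 0 := by
  have i1 : Integrable τ (volume.prod volume) :=
    h.continuous.integrable_of_hasCompactSupport h.compact
  have i2 : Integrable (dx τ) (volume.prod volume) :=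
    h.continuous_dx.integrable_of_hasCompactSupport h.hasCompactSupport_dx
  refine (integral_prod_symm _ i2).trans (integral_eq_zero_of_ae ?_)
  filter_upwards [i1.prod_left_ae, i2.prod_left_ae] with y h1 h2
  exact integral_eq_zero_of_hasDerivAt_of_integrable (fun x => h.hasDerivAt_dx (x, y)) h2 h1

theorem IsTest.integral_dy {τ : Cyl → ℝ} (h : IsTest τ) : ∫ z, dy τ z = 0 := by
  have i2 : Integrable (dy τ) (volume.prod volume) :=
    h.continuous_dy.integrable_of_hasCompactSupport h.hasCompactSupport_dy
  refine (integral_prod _ i2).trans (integral_eq_zero_of_ae (.of_forall fun x => ?_))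
  have hc : Continuous (fun t : ℝ => dy τ (x, (t : Torus))) :=
    h.continuous_dy.comp (continuous_const.prodMk (AddCircle.continuous_mk' _))
  simp only [integral_torus, Pi.zero_apply]
  rw [intervalIntegral.integral_eq_sub_of_hasDerivAt (fun t _ => h.hasDerivAt_dy x t)
    (hc.intervalIntegrable _ _)]
  have : ((2 * Real.pi : ℝ) : Torus) = ((0 : ℝ) : Torus) := by
    rw [AddCircle.coe_period]; rfl
  rw [this, sub_self]

theorem IsTest.prod_mul {τ : Cyl → ℝ} (h : IsTest τ) {G : ℝ → ℝ} {E : Torus → ℝ}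
    (hG : ContDiff ℝ (⊤ : ℕ∞) G) (hE : SmoothT E) :
    IsTest (fun z => G z.1 * E z.2 * τ z) where
  smooth := ((hG.comp contDiff_fst).mul hE.comp_snd).mul h.smooth
  compact := h.compact.mul_left

theorem isTest_prod {G : ℝ → ℝ} {E : Torus → ℝ} (hG : ContDiff ℝ (⊤ : ℕ∞) G) (hE : SmoothT E)
    (hc : HasCompactSupport G) : IsTest (fun z => G z.1 * E z.2) where
  smooth := (hG.comp contDiff_fst).mul hE.comp_snd
  compact := by
    refine HasCompactSupport.intro (hc.prod isCompact_univ) fun z hz => ?_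
    have : z.1 ∉ tsupport G := fun h => hz ⟨h, mem_univ _⟩
    rw [image_eq_zero_of_notMem_tsupport this, zero_mul]

theorem dx_prod {G G' : ℝ → ℝ} (h : ∀ x, HasDerivAt G (G' x) x) (E : Torus → ℝ) (z : Cyl) :
    dx (fun z => G z.1 * E z.2) z = G' z.1 * E z.2 := ((h z.1).mul_const (E z.2)).deriv

theorem hasDerivAt_shift {E E' : Torus → ℝ} (h : ∀ t : ℝ, HasDerivAt (fun t : ℝ => E t) (E' t) t)
    (y : Torus) : HasDerivAt (fun t : ℝ => E (y + (t : Torus))) (E' y) 0 := by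
  induction y using QuotientAddGroup.induction_on with
  | H r =>
    have := HasDerivAt.comp_const_add (f := fun t : ℝ => E t) r 0 (by simpa using h r)
    exact this

theorem dy_prod {E E' : Torus → ℝ} (h : ∀ t : ℝ, HasDerivAt (fun t : ℝ => E t) (E' t) t)
    (G : ℝ → ℝ) (z : Cyl) : dy (fun z => G z.1 * E z.2) z = G z.1 * E' z.2 :=
  ((hasDerivAt_shift h z.2).const_mul (G z.1)).deriv

theorem integral_toLp_mul {f : Cyl → ℝ} (hf : MemLp f 2 volume) (τ : Cyl → ℝ) :
    ∫ z, (hf.toLp f) z * τ z = ∫ z, f z * τ z := by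
  refine integral_congr_ae ?_
  filter_upwards [hf.coeFn_toLp] with z hz
  rw [hz]

theorem isWeakDx_prod {G G' : ℝ → ℝ} {E : Torus → ℝ} (hG : ContDiff ℝ (⊤ : ℕ∞) G)
    (h : ∀ x, HasDerivAt G (G' x) x) (hE : SmoothT E)
    (m : MemLp (fun z : Cyl => G z.1 * E z.2) 2 volume)
    (m' : MemLp (fun z : Cyl => G' z.1 * E z.2) 2 volume) :
    IsWeakDx (m.toLp _) (m'.toLp _) := fun τ hτ => by
  rw [integral_toLp_mul, integral_toLp_mul]
  have h0 := (hτ.prod_mul hG hE).integral_dx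
  have e : ∀ z, dx (fun z => G z.1 * E z.2 * τ z) z =
      G' z.1 * E z.2 * τ z + G z.1 * E z.2 * dx τ z := fun z =>
    (((h z.1).mul_const (E z.2)).mul (hτ.hasDerivAt_dx z)).deriv
  simp only [e] at h0
  have i1 : Integrable (fun z => G' z.1 * E z.2 * τ z) :=
    m'.integrable_mul (q := 2) (hτ.continuous.memLp_of_hasCompactSupport hτ.compact)
  have i2 : Integrable (fun z => G z.1 * E z.2 * dx τ z) :=
    m.integrable_mul (q := 2) (hτ.continuous_dx.memLp_of_hasCompactSupport hτ.hasCompactSupport_dx)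
  rw [integral_add i1 i2] at h0
  linarith

theorem IsTest.hasDerivAt_dy_shift {τ : Cyl → ℝ} (h : IsTest τ) (z : Cyl) :
    HasDerivAt (fun t : ℝ => τ (z.1, z.2 + (t : Torus))) (dy τ z) 0 :=
  hasDerivAt_shift (E := fun y => τ (z.1, y)) (E' := fun y => dy τ (z.1, y))
    (fun t => h.hasDerivAt_dy z.1 t) z.2

theorem isWeakDy_prod {G : ℝ → ℝ} {E E' : Torus → ℝ} (hG : ContDiff ℝ (⊤ : ℕ∞) G)
    (hE : SmoothT E) (h : ∀ t : ℝ, HasDerivAt (fun t : ℝ => E t) (E' t) t)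
    (m : MemLp (fun z : Cyl => G z.1 * E z.2) 2 volume)
    (m' : MemLp (fun z : Cyl => G z.1 * E' z.2) 2 volume) :
    IsWeakDy (m.toLp _) (m'.toLp _) := fun τ hτ => by
  rw [integral_toLp_mul, integral_toLp_mul]
  have h0 := (hτ.prod_mul hG hE).integral_dy
  have e : ∀ z, dy (fun z => G z.1 * E z.2 * τ z) z =
      G z.1 * E' z.2 * τ z + G z.1 * E z.2 * dy τ z := fun z => by
    have := (((hasDerivAt_shift h z.2).const_mul (G z.1)).mul (hτ.hasDerivAt_dy_shift z)).deriv
    simpa [dy] using! this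
  simp only [e] at h0
  have i1 : Integrable (fun z => G z.1 * E' z.2 * τ z) :=
    m'.integrable_mul (q := 2) (hτ.continuous.memLp_of_hasCompactSupport hτ.compact)
  have i2 : Integrable (fun z => G z.1 * E z.2 * dy τ z) :=
    m.integrable_mul (q := 2) (hτ.continuous_dy.memLp_of_hasCompactSupport hτ.hasCompactSupport_dy)
  rw [integral_add i1 i2] at h0
  linarith

/-! ### Weak derivatives against decaying product functions -/

/-- A smooth cut-off, equal to `1` on `[-1, 1]`. -/
def cut (x : ℝ) : ℝ := Real.smoothTransition (2 - x ^ 2)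

theorem contDiff_cut : ContDiff ℝ (⊤ : ℕ∞) cut :=
  Real.smoothTransition.contDiff.comp (contDiff_const.sub (contDiff_id.pow 2))

theorem cut_eq_one {x : ℝ} (h : |x| ≤ 1) : cut x = 1 := by
  apply Real.smoothTransition.one_of_one_le
  have : x ^ 2 ≤ 1 := by rw [← sq_abs]; exact pow_le_one₀ (abs_nonneg _) h
  linarith

theorem cut_eq_zero {x : ℝ} (h : 2 ≤ |x|) : cut x = 0 := by
  apply Real.smoothTransition.zero_of_nonpos
  have : 2 ^ 2 ≤ x ^ 2 := by rw [← sq_abs x]; exact pow_le_pow_left₀ (by norm_num) h 2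
  linarith

theorem abs_cut_le (x : ℝ) : |cut x| ≤ 1 := by
  rw [cut, abs_of_nonneg (Real.smoothTransition.nonneg _)]
  exact Real.smoothTransition.le_one _

theorem hasCompactSupport_cut : HasCompactSupport cut :=
  HasCompactSupport.intro (isCompact_Icc (a := (-2 : ℝ)) (b := 2)) fun x hx => by
    apply cut_eq_zero
    by_contra h
    exact hx (abs_le.1 (not_le.1 h).le)

theorem exists_bound_deriv_cut : ∃ M, ∀ x, |deriv cut x| ≤ M := by
  have := hasCompactSupport_cut.deriv.exists_bound_of_continuous
    (contDiff_infty_iff_deriv.1 contDiff_cut).2.continuous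
  simpa using this

theorem hasDerivAt_cut_div (r x : ℝ) :
    HasDerivAt (fun x => cut (x / r)) (deriv cut (x / r) / r) x := by
  have h1 : HasDerivAt cut (deriv cut (x / r)) (x / r) :=
    ((contDiff_infty_iff_deriv.1 contDiff_cut).1 _).hasDerivAt
  have h2 : HasDerivAt (fun x : ℝ => x / r) (1 / r) x := (hasDerivAt_id x).div_const r
  exact (h1.comp x h2).congr_deriv (mul_one_div _ _)

theorem contDiff_cut_div (r : ℝ) : ContDiff ℝ (⊤ : ℕ∞) (fun x => cut (x / r)) :=
  contDiff_cut.comp (contDiff_id.div_const r)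

theorem hasCompactSupport_cut_div {r : ℝ} (hr : 0 < r) : HasCompactSupport (fun x => cut (x / r)) :=
  HasCompactSupport.intro (isCompact_Icc (a := -(2 * r)) (b := 2 * r)) fun x hx => by
    apply cut_eq_zero
    by_contra h
    refine hx (abs_le.1 ?_)
    rw [not_le, abs_div, abs_of_pos hr, div_lt_iff₀ hr] at h
    exact h.le

theorem eventually_cut_eq (x : ℝ) : ∀ᶠ n : ℕ in atTop, cut (x / ((n : ℝ) + 1)) = 1 := by
  filter_upwards [eventually_ge_atTop ⌈|x|⌉₊] with n hn
  apply cut_eq_one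
  have hp : (0 : ℝ) < (n : ℝ) + 1 := by positivity
  rw [abs_div, abs_of_pos hp, div_le_one hp]
  have : |x| ≤ n := (Nat.le_ceil _).trans (by exact_mod_cast hn)
  linarith

theorem L2.integrable_mul_prod (u : L2) {G : ℝ → ℝ} {E : Torus → ℝ} (hG : Continuous G)
    (dG : Dec G) (hE : Continuous E) : Integrable (fun z => u z * (G z.1 * E z.2)) :=
  (Lp.memLp u).integrable_mul (q := 2) (memLp_prod_fn hG dG hE)

theorem tendsto_integral_cut_mul (u : L2) {G : ℝ → ℝ} {E : Torus → ℝ} (hG : Continuous G)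
    (dG : Dec G) (hE : Continuous E) :
    Tendsto (fun n : ℕ => ∫ z, u z * (cut (z.1 / ((n : ℝ) + 1)) * G z.1 * E z.2)) atTop
      (𝓝 (∫ z, u z * (G z.1 * E z.2))) := by
  refine tendsto_integral_of_dominated_convergence (fun z => ‖u z * (G z.1 * E z.2)‖)
    (fun n => ?_) (u.integrable_mul_prod hG dG hE).norm (fun n => .of_forall fun z => ?_)
    (.of_forall fun z => ?_)
  · have h1 : AEStronglyMeasurable (fun z : Cyl => cut (z.1 / ((n : ℝ) + 1)) * G z.1 * E z.2)
        volume := by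
      have := contDiff_cut.continuous
      exact Continuous.aestronglyMeasurable (by fun_prop)
    exact (Lp.aestronglyMeasurable u).mul h1
  · have : u z * (cut (z.1 / ((n : ℝ) + 1)) * G z.1 * E z.2) =
        cut (z.1 / ((n : ℝ) + 1)) * (u z * (G z.1 * E z.2)) := by ring
    rw [this, norm_mul]
    exact mul_le_of_le_one_left (norm_nonneg _) (abs_cut_le _)
  · refine tendsto_const_nhds.congr' ?_
    filter_upwards [eventually_cut_eq z.1] with n hn
    rw [hn, one_mul]

/-- Profiles are not compactly supported, so `G` is truncated by `cut(x/(n+1))`. The derivative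
falling on the cut-off contributes `O(1/n)`, and the other terms converge by dominated convergence.
-/
theorem IsWeakDx.integral_prod {u v : L2} (h : IsWeakDx u v) {G G' : ℝ → ℝ} {E : Torus → ℝ}
    (hG : ContDiff ℝ (⊤ : ℕ∞) G) (hd : ∀ x, HasDerivAt G (G' x) x) (dG : Dec G) (dG' : Dec G')
    (hE : SmoothT E) :
    ∫ z, u z * (G' z.1 * E z.2) = - ∫ z, v z * (G z.1 * E z.2) := by
  have cG' : Continuous G' := by
    have := (contDiff_infty_iff_deriv.1 hG).2.continuous
    rwa [funext fun x => (hd x).deriv] at this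
  obtain ⟨M, hM⟩ := exists_bound_deriv_cut
  have lim1 := tendsto_integral_cut_mul v hG.continuous dG hE.continuous
  have lim2 := tendsto_integral_cut_mul u cG' dG' hE.continuous
  have lim3 : Tendsto (fun n : ℕ => ∫ z, u z * (deriv cut (z.1 / ((n : ℝ) + 1)) / ((n : ℝ) + 1) *
      G z.1 * E z.2)) atTop (𝓝 0) := by
    have hb : Tendsto (fun n : ℕ => (M * ∫ z, ‖u z * (G z.1 * E z.2)‖) * (1 / ((n : ℝ) + 1)))
        atTop (𝓝 0) := by
      simpa using (tendsto_one_div_add_atTop_nhds_zero_nat (𝕜 := ℝ)).const_mul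
        (M * ∫ z, ‖u z * (G z.1 * E z.2)‖)
    refine squeeze_zero_norm (fun n => ?_) hb
    have hp : (0 : ℝ) < (n : ℝ) + 1 := by positivity
    have : (M * ∫ z, ‖u z * (G z.1 * E z.2)‖) * (1 / ((n : ℝ) + 1)) =
        ∫ z, M / ((n : ℝ) + 1) * ‖u z * (G z.1 * E z.2)‖ := by
      rw [integral_const_mul]; ring
    rw [this]
    refine norm_integral_le_of_norm_le
      ((u.integrable_mul_prod hG.continuous dG hE.continuous).norm.const_mul _)
      (.of_forall fun z => ?_)
    have e : u z * (deriv cut (z.1 / ((n : ℝ) + 1)) / ((n : ℝ) + 1) * G z.1 * E z.2) =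
      (deriv cut (z.1 / ((n : ℝ) + 1)) / ((n : ℝ) + 1)) * (u z * (G z.1 * E z.2)) := by ring
    rw [e, norm_mul, Real.norm_eq_abs (_ / _), abs_div, abs_of_pos hp]
    gcongr
    exact hM _
  have key : ∀ n : ℕ, (∫ z, u z * (deriv cut (z.1 / ((n : ℝ) + 1)) / ((n : ℝ) + 1) *
      G z.1 * E z.2)) + (∫ z, u z * (cut (z.1 / ((n : ℝ) + 1)) * G' z.1 * E z.2)) =
      - ∫ z, v z * (cut (z.1 / ((n : ℝ) + 1)) * G z.1 * E z.2) := fun n => by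
    have hp : (0 : ℝ) < (n : ℝ) + 1 := by positivity
    have ht := isTest_prod ((contDiff_cut_div ((n : ℝ) + 1)).mul hG) hE
      (hasCompactSupport_cut_div hp).mul_right
    rw [← h _ ht]
    have c1 := contDiff_cut.continuous
    have c2 := (contDiff_infty_iff_deriv.1 contDiff_cut).2.continuous
    have cG := hG.continuous
    have b1 : ∀ x : ℝ, |cut (x / ((n : ℝ) + 1))| ≤ 1 := fun x => abs_cut_le _
    have b2 : ∀ x : ℝ, |deriv cut (x / ((n : ℝ) + 1)) / ((n : ℝ) + 1)| ≤ M / ((n : ℝ) + 1) :=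
      fun x => by
        rw [abs_div, abs_of_pos hp]; gcongr; exact hM _
    rw [← integral_add
      (u.integrable_mul_prod (by fun_prop) (dG.mul_bdd _ b2) hE.continuous)
      (u.integrable_mul_prod (by fun_prop) (dG'.mul_bdd _ b1) hE.continuous)]
    congr 1; ext z
    have := dx_prod (fun x => (hasDerivAt_cut_div ((n : ℝ) + 1) x).mul (hd x)) E z
    simp only [Pi.mul_apply] at this ⊢
    rw [this]; ring
  have lim := lim3.add lim2
  simp only [key, zero_add] at lim
  exact tendsto_nhds_unique lim lim1.neg

/-- The same truncation, without an error term because the cut-off depends on `x` only. -/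
theorem IsWeakDy.integral_prod {u v : L2} (h : IsWeakDy u v) {G : ℝ → ℝ} {E E' : Torus → ℝ}
    (hG : ContDiff ℝ (⊤ : ℕ∞) G) (dG : Dec G) (hE : SmoothT E)
    (hd : ∀ t : ℝ, HasDerivAt (fun t : ℝ => E t) (E' t) t) (hE' : Continuous E') :
    ∫ z, u z * (G z.1 * E' z.2) = - ∫ z, v z * (G z.1 * E z.2) := by
  have lim1 := tendsto_integral_cut_mul v hG.continuous dG hE.continuous
  have lim2 := tendsto_integral_cut_mul u hG.continuous dG hE'
  refine tendsto_nhds_unique lim2 (lim1.neg.congr fun n => ?_)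
  have hp : (0 : ℝ) < (n : ℝ) + 1 := by positivity
  have ht := isTest_prod ((contDiff_cut_div ((n : ℝ) + 1)).mul hG) hE
    (hasCompactSupport_cut_div hp).mul_right
  have e : ∀ z : Cyl, dy (fun z => cut (z.1 / ((n : ℝ) + 1)) * G z.1 * E z.2) z =
      cut (z.1 / ((n : ℝ) + 1)) * G z.1 * E' z.2 :=
    dy_prod hd fun x => cut (x / ((n : ℝ) + 1)) * G x
  have := h _ ht
  simp only [e] at this
  exact this.symm

/-! ### Trigonometric derivatives -/

theorem hasDerivAt_cosN (n : ℕ) (t : ℝ) :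
    HasDerivAt (fun t : ℝ => cosN n t) (-(n : ℝ) * sinN n t) t := by
  simp only [cosN_coe, sinN_coe]
  have : HasDerivAt (fun t : ℝ => (n : ℝ) * t) n t := by
    simpa using (hasDerivAt_id t).const_mul (n : ℝ)
  exact this.cos.congr_deriv (by ring)

theorem hasDerivAt_sinN (n : ℕ) (t : ℝ) :
    HasDerivAt (fun t : ℝ => -(n : ℝ) * sinN n t) (-(n : ℝ) ^ 2 * cosN n t) t := by
  simp only [cosN_coe, sinN_coe]
  have : HasDerivAt (fun t : ℝ => (n : ℝ) * t) n t := by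
    simpa using (hasDerivAt_id t).const_mul (n : ℝ)
  exact (this.sin.const_mul (-(n : ℝ))).congr_deriv (by ring)

theorem smoothT_cosN (n : ℕ) : SmoothT (cosN n) := by
  unfold SmoothT
  simp only [cosN_coe]
  exact Real.contDiff_cos.comp (contDiff_const.mul contDiff_id)

theorem smoothT_sinN (n : ℕ) : SmoothT (sinN n) := by
  unfold SmoothT
  simp only [sinN_coe]
  exact Real.contDiff_sin.comp (contDiff_const.mul contDiff_id)

theorem SmoothT.const_mul {E : Torus → ℝ} (h : SmoothT E) (c : ℝ) : SmoothT (fun y => c * E y) :=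
  contDiff_const.mul h

/-- The weak derivatives are determined by the function. -/
theorem eq_zero_of_weakDx {v : L2} (h : IsWeakDx 0 v) : v = 0 := by
  refine L2_eq_zero_of_modes v (fun n g hg hc => ?_) fun n g hg hc => ?_
  · simpa using h _ (isTest_prod hg (smoothT_cosN n) hc)
  · simpa using h _ (isTest_prod hg (smoothT_sinN n) hc)

theorem eq_zero_of_weakDy {v : L2} (h : IsWeakDy 0 v) : v = 0 := by
  refine L2_eq_zero_of_modes v (fun n g hg hc => ?_) fun n g hg hc => ?_
  · simpa using h _ (isTest_prod hg (smoothT_cosN n) hc)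
  · simpa using h _ (isTest_prod hg (smoothT_sinN n) hc)

/-- If the function vanishes then so do its first weak derivatives, and then the second ones. Hence
elements of `H²` are determined by their functions, although the type records all six components. -/
theorem H2.eq_zero_of_fn {u : H2} (h : u.fn = 0) : u = 0 := by
  obtain ⟨U, h1, h2, h3, h4, h5⟩ := u
  have h : U 0 = 0 := h
  rw [h] at h1 h2
  have e1 := eq_zero_of_weakDx h1
  have e2 := eq_zero_of_weakDy h2
  rw [e1] at h3 h4
  rw [e2] at h5
  have e3 := eq_zero_of_weakDx h3
  have e4 := eq_zero_of_weakDy h4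
  have e5 := eq_zero_of_weakDy h5
  refine Subtype.ext (PiLp.ext fun i => ?_)
  fin_cases i
  exacts [h, e1, e2, e3, e4, e5]

open scoped InnerProductSpace

/-! ### Fourier modes as elements of `H²` -/

/-- Continuous exponentially decaying functions. -/
def DecC : Submodule ℝ (ℝ → ℝ) where
  carrier := {g | Continuous g ∧ Dec g}
  add_mem' h h' := ⟨h.1.add h'.1, h.2.add h'.2⟩
  zero_mem' := ⟨continuous_const, dec_zero⟩
  smul_mem' c _ h := ⟨h.1.const_smul c, h.2.const_mul c⟩

theorem memLp_decC (G : DecC) (E : C(Torus, ℝ)) :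
    MemLp (fun z : Cyl => (G : ℝ → ℝ) z.1 * E z.2) 2 volume :=
  memLp_prod_fn G.2.1 G.2.2 E.continuous

/-- `G ↦ G(x)E(y)`, from decaying functions to `L²`. -/
def prodL (E : C(Torus, ℝ)) : DecC →ₗ[ℝ] L2 where
  toFun G := (memLp_decC G E).toLp _
  map_add' G H := by
    rw [← MemLp.toLp_add]
    refine MemLp.toLp_congr _ _ (.of_forall fun z => ?_)
    simp [add_mul]
  map_smul' c G := by
    rw [RingHom.id_apply, ← MemLp.toLp_const_smul]
    refine MemLp.toLp_congr _ _ (.of_forall fun z => ?_)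
    simp [mul_assoc]

theorem coeFn_prodL (E : C(Torus, ℝ)) (G : DecC) :
    prodL E G =ᵐ[volume] fun z => (G : ℝ → ℝ) z.1 * E z.2 := (memLp_decC G E).coeFn_toLp

/-- `cos(ny)` as a continuous map. -/
def cosC (n : ℕ) : C(Torus, ℝ) := ⟨cosN n, continuous_cosN n⟩

/-- `sin(ny)` as a continuous map. -/
def sinC (n : ℕ) : C(Torus, ℝ) := ⟨sinN n, continuous_sinN n⟩

theorem prodL_smul (c : ℝ) (E : C(Torus, ℝ)) (G : DecC) : prodL (c • E) G = c • prodL E G := by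
  refine Lp.ext ?_
  filter_upwards [coeFn_prodL (c • E) G, coeFn_prodL E G, Lp.coeFn_smul c (prodL E G)]
    with z h1 h2 h3
  rw [h1, h3, Pi.smul_apply, h2]
  simp only [ContinuousMap.coe_smul, Pi.smul_apply, smul_eq_mul]; ring

theorem inner_prodL (E F : C(Torus, ℝ)) (G H : DecC) :
    ⟪prodL E G, prodL F H⟫_ℝ =
      (∫ x, (G : ℝ → ℝ) x * (H : ℝ → ℝ) x) * ∫ y, E y * F y := by
  rw [L2.inner_def, ← integral_prod_mul]
  refine integral_congr_ae ?_
  filter_upwards [coeFn_prodL E G, coeFn_prodL F H] with z h1 h2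
  rw [h1, h2]
  simp only [RCLike.inner_apply, conj_trivial]
  ring

theorem norm_prodL_sq (E : C(Torus, ℝ)) (G : DecC) :
    ‖prodL E G‖ ^ 2 = (∫ x, (G : ℝ → ℝ) x ^ 2) * ∫ y, E y ^ 2 := by
  rw [← real_inner_self_eq_norm_sq, inner_prodL]
  simp only [pow_two]

/-- A profile as a decaying function. -/
def prof0 : Prof →ₗ[ℝ] DecC where
  toFun g := ⟨g, g.2.cont, g.2.dec⟩
  map_add' _ _ := rfl
  map_smul' _ _ := rfl

/-- The derivative of a profile. -/
def prof1 : Prof →ₗ[ℝ] DecC where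
  toFun g := ⟨deriv g, g.2.cont', g.2.dec'⟩
  map_add' g h := Subtype.ext <| funext fun x =>
    ((g.2.hasDerivAt x).add (h.2.hasDerivAt x)).deriv
  map_smul' c g := Subtype.ext <| funext fun x => ((g.2.hasDerivAt x).const_smul c).deriv

/-- The second derivative of a profile. -/
def prof2 : Prof →ₗ[ℝ] DecC where
  toFun g := ⟨deriv (deriv g), g.2.cont'', g.2.dec''⟩
  map_add' g h := Subtype.ext <| funext fun x => by
    have : deriv ((g + h : Prof) : ℝ → ℝ) = deriv (g : ℝ → ℝ) + deriv (h : ℝ → ℝ) :=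
      congrArg Subtype.val (prof1.map_add g h)
    simp only [this]
    exact ((g.2.hasDerivAt' x).add (h.2.hasDerivAt' x)).deriv
  map_smul' c g := Subtype.ext <| funext fun x => by
    have : deriv ((c • g : Prof) : ℝ → ℝ) = c • deriv (g : ℝ → ℝ) :=
      congrArg Subtype.val (prof1.map_smul c g)
    simp only [this]
    exact ((g.2.hasDerivAt' x).const_smul c).deriv

/-- The six components of `g(x)cos(ny)`. -/
def modeTuple (n : ℕ) : Prof →ₗ[ℝ] PiLp 2 (fun _ : Fin 6 => L2) :=
  (WithLp.linearEquiv 2 ℝ (Fin 6 → L2)).symm.toLinearMap ∘ₗ LinearMap.pi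
    ![prodL (cosC n) ∘ₗ prof0, prodL (cosC n) ∘ₗ prof1, (-(n : ℝ)) • (prodL (sinC n) ∘ₗ prof0),
      prodL (cosC n) ∘ₗ prof2, (-(n : ℝ)) • (prodL (sinC n) ∘ₗ prof1),
      (-(n : ℝ) ^ 2) • (prodL (cosC n) ∘ₗ prof0)]

theorem isWeakDx_prodL {G G' : DecC} (hG : ContDiff ℝ (⊤ : ℕ∞) (G : ℝ → ℝ))
    (h : ∀ x, HasDerivAt (G : ℝ → ℝ) ((G' : ℝ → ℝ) x) x) {E : C(Torus, ℝ)} (hE : SmoothT E) :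
    IsWeakDx (prodL E G) (prodL E G') :=
  isWeakDx_prod hG h hE (memLp_decC G E) (memLp_decC G' E)

theorem isWeakDy_prodL {G : DecC} (hG : ContDiff ℝ (⊤ : ℕ∞) (G : ℝ → ℝ))
    {E E' : C(Torus, ℝ)} (hE : SmoothT E) (h : ∀ t : ℝ, HasDerivAt (fun t : ℝ => E t) (E' t) t) :
    IsWeakDy (prodL E G) (prodL E' G) :=
  isWeakDy_prod hG hE h (memLp_decC G E) (memLp_decC G E')

theorem isWeakDy_cos (n : ℕ) {G : DecC} (hG : ContDiff ℝ (⊤ : ℕ∞) (G : ℝ → ℝ)) :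
    IsWeakDy (prodL (cosC n) G) ((-(n : ℝ)) • prodL (sinC n) G) := by
  rw [← prodL_smul]
  exact isWeakDy_prodL hG (smoothT_cosN n) (hasDerivAt_cosN n)

theorem isWeakDy_sin (n : ℕ) {G : DecC} (hG : ContDiff ℝ (⊤ : ℕ∞) (G : ℝ → ℝ)) :
    IsWeakDy ((-(n : ℝ)) • prodL (sinC n) G) ((-(n : ℝ) ^ 2) • prodL (cosC n) G) := by
  rw [← prodL_smul, ← prodL_smul]
  exact isWeakDy_prodL hG ((smoothT_sinN n).const_mul _) (hasDerivAt_sinN n)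

/-- `g(x)cos(ny)` as an element of `H²`. -/
def mode (n : ℕ) : Prof →ₗ[ℝ] H2 :=
  LinearMap.codRestrict H2space (modeTuple n) fun g =>
    ⟨isWeakDx_prodL (G := prof0 g) (G' := prof1 g) g.2.smooth g.2.hasDerivAt (smoothT_cosN n),
      isWeakDy_cos n (G := prof0 g) g.2.smooth,
      isWeakDx_prodL (G := prof1 g) (G' := prof2 g) g.2.smooth' g.2.hasDerivAt' (smoothT_cosN n),
      isWeakDy_cos n (G := prof1 g) g.2.smooth', isWeakDy_sin n (G := prof0 g) g.2.smooth⟩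

/-- The components of an element of `H²`. -/
def compL (i : Fin 6) : H2 →L[ℝ] L2 := (PiLp.proj 2 (fun _ : Fin 6 => L2) i).comp H2space.subtypeL

theorem compL_zero (u : H2) : compL 0 u = u.fn := rfl

theorem compL_three (u : H2) : compL 3 u = u.dxx := rfl

theorem compL_five (u : H2) : compL 5 u = u.dyy := rfl

theorem H2.norm_sq (u : H2) : ‖u‖ ^ 2 = ∑ i, ‖compL i u‖ ^ 2 := PiLp.norm_sq_eq_of_L2 _ _

theorem H2.inner_eq (u v : H2) : ⟪u, v⟫_ℝ = ∑ i, ⟪compL i u, compL i v⟫_ℝ := PiLp.inner_apply _ _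

theorem norm_compL_le (i : Fin 6) (u : H2) : ‖compL i u‖ ≤ ‖u‖ := PiLp.norm_apply_le _ i

theorem H2.norm_fn_le (u : H2) : ‖u.fn‖ ≤ ‖u‖ := norm_compL_le 0 u

theorem compL_mode_zero (n : ℕ) (g : Prof) : compL 0 (mode n g) = prodL (cosC n) (prof0 g) := rfl

theorem compL_mode_one (n : ℕ) (g : Prof) : compL 1 (mode n g) = prodL (cosC n) (prof1 g) := rfl

theorem compL_mode_two (n : ℕ) (g : Prof) :
    compL 2 (mode n g) = (-(n : ℝ)) • prodL (sinC n) (prof0 g) := rfl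

theorem compL_mode_three (n : ℕ) (g : Prof) : compL 3 (mode n g) = prodL (cosC n) (prof2 g) := rfl

theorem compL_mode_four (n : ℕ) (g : Prof) :
    compL 4 (mode n g) = (-(n : ℝ)) • prodL (sinC n) (prof1 g) := rfl

theorem compL_mode_five (n : ℕ) (g : Prof) :
    compL 5 (mode n g) = (-(n : ℝ) ^ 2) • prodL (cosC n) (prof0 g) := rfl

theorem inner_cos_cos {m n : ℕ} (h : m ≠ n) (G H : DecC) :
    ⟪prodL (cosC m) G, prodL (cosC n) H⟫_ℝ = 0 := by
  rw [inner_prodL]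
  exact mul_eq_zero_of_right _ (integral_cosN_mul_cosN h)

theorem inner_sin_sin {m n : ℕ} (h : m ≠ n) (G H : DecC) :
    ⟪prodL (sinC m) G, prodL (sinC n) H⟫_ℝ = 0 := by
  rw [inner_prodL]
  exact mul_eq_zero_of_right _ (integral_sinN_mul_sinN h)

theorem inner_mode_mode {m n : ℕ} (h : m ≠ n) (g k : Prof) : ⟪mode m g, mode n k⟫_ℝ = 0 := by
  rw [H2.inner_eq, Fin.sum_univ_six]
  simp only [compL_mode_zero, compL_mode_one, compL_mode_two, compL_mode_three, compL_mode_four,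
    compL_mode_five, inner_smul_left, inner_smul_right, inner_cos_cos h, inner_sin_sin h]
  simp

theorem norm_sum_sq_of_orthogonal {F ι : Type*} [NormedAddCommGroup F] [InnerProductSpace ℝ F]
    (s : Finset ι) (v : ι → F) (h : ∀ i ∈ s, ∀ j ∈ s, i ≠ j → ⟪v i, v j⟫_ℝ = 0) :
    ‖∑ i ∈ s, v i‖ ^ 2 = ∑ i ∈ s, ‖v i‖ ^ 2 := by
  rw [← real_inner_self_eq_norm_sq, sum_inner]
  refine Finset.sum_congr rfl fun i hi => ?_
  rw [inner_sum, Finset.sum_eq_single i (fun j hj hji => h i hi j hj hji.symm)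
    (fun h => absurd hi h), real_inner_self_eq_norm_sq]

/-- Finite sums `∑ gₙ(x)cos(ny)`. -/
def sumMode : (ℕ →₀ Prof) →ₗ[ℝ] H2 := Finsupp.lsum ℝ mode

theorem sumMode_apply (f : ℕ →₀ Prof) : sumMode f = ∑ n ∈ f.support, mode n (f n) := rfl

theorem sumMode_single (n : ℕ) (g : Prof) : sumMode (Finsupp.single n g) = mode n g := by
  simp [sumMode]

theorem norm_sumMode_sq (f : ℕ →₀ Prof) :
    ‖sumMode f‖ ^ 2 = ∑ n ∈ f.support, ‖mode n (f n)‖ ^ 2 := by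
  rw [sumMode_apply]
  exact norm_sum_sq_of_orthogonal _ _ fun i _ j _ h => inner_mode_mode h _ _

theorem norm_mode_sq (n : ℕ) (g : Prof) : ‖mode n g‖ ^ 2 =
    ((∫ x, (g : ℝ → ℝ) x ^ 2) + (∫ x, deriv (g : ℝ → ℝ) x ^ 2) +
      (∫ x, deriv (deriv (g : ℝ → ℝ)) x ^ 2) + (n : ℝ) ^ 4 * ∫ x, (g : ℝ → ℝ) x ^ 2) *
      (∫ y, cosN n y ^ 2) +
    (n : ℝ) ^ 2 * ((∫ x, (g : ℝ → ℝ) x ^ 2) + ∫ x, deriv (g : ℝ → ℝ) x ^ 2) *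
      ∫ y, sinN n y ^ 2 := by
  rw [H2.norm_sq, Fin.sum_univ_six]
  simp only [compL_mode_zero, compL_mode_one, compL_mode_two, compL_mode_three, compL_mode_four,
    compL_mode_five, norm_smul, mul_pow, norm_prodL_sq]
  simp only [Real.norm_eq_abs, sq_abs]
  change (∫ x, (g : ℝ → ℝ) x ^ 2) * (∫ y, cosN n y ^ 2) +
    (∫ x, deriv (g : ℝ → ℝ) x ^ 2) * (∫ y, cosN n y ^ 2) +
    (-(n : ℝ)) ^ 2 * ((∫ x, (g : ℝ → ℝ) x ^ 2) * (∫ y, sinN n y ^ 2)) +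
    (∫ x, deriv (deriv (g : ℝ → ℝ)) x ^ 2) * (∫ y, cosN n y ^ 2) +
    (-(n : ℝ)) ^ 2 * ((∫ x, deriv (g : ℝ → ℝ) x ^ 2) * (∫ y, sinN n y ^ 2)) +
    (-(n : ℝ) ^ 2) ^ 2 * ((∫ x, (g : ℝ → ℝ) x ^ 2) * (∫ y, cosN n y ^ 2)) = _
  ring

/-! ### The operator `-Δ + μ` -/

/-- `-∂ₓ² - ∂_y² + μ`. -/
def helm (μ : ℝ) : H2 →L[ℝ] L2 := -compL 3 - compL 5 + μ • compL 0

theorem helm_apply (μ : ℝ) (u : H2) : helm μ u = -u.dxx - u.dyy + μ • u.fn := rfl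

theorem helm_mode (μ : ℝ) (n : ℕ) (g : Prof) :
    helm μ (mode n g) = prodL (cosC n) (-prof2 g + ((n : ℝ) ^ 2 + μ) • prof0 g) := by
  rw [helm_apply, ← compL_three, ← compL_five, ← compL_zero, compL_mode_zero, compL_mode_three,
    compL_mode_five, map_add, map_neg, map_smul]
  module

theorem norm_helm_mode_sq (μ : ℝ) (n : ℕ) (g : Prof) : ‖helm μ (mode n g)‖ ^ 2 =
    ((∫ x, deriv (deriv (g : ℝ → ℝ)) x ^ 2) + (2 * ((n : ℝ) ^ 2 + μ) *
      (∫ x, deriv (g : ℝ → ℝ) x ^ 2) + ((n : ℝ) ^ 2 + μ) ^ 2 * ∫ x, (g : ℝ → ℝ) x ^ 2)) *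
      ∫ y, cosN n y ^ 2 := by
  rw [helm_mode, norm_prodL_sq, ← integral_neg_deriv2_add_sq g.2]
  rfl

/-- Elliptic regularity for one Fourier mode, with a constant independent of `n`. It reduces to
comparing `1 + n²` with `n² + μ`, for which `m = min 1 μ` gives `m(1 + n²) ≤ n² + μ`. -/
theorem exists_norm_mode_le {μ : ℝ} (hμ : 0 < μ) :
    ∃ C : ℝ, 0 < C ∧ ∀ n g, ‖mode n g‖ ^ 2 ≤ C * ‖helm μ (mode n g)‖ ^ 2 := by
  set m := min 1 μ
  have m0 : 0 < m := lt_min one_pos hμ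
  have m1 : m ≤ 1 := min_le_left _ _
  have m2 : m ≤ μ := min_le_right _ _
  refine ⟨2 / m ^ 2, by positivity, fun n g => ?_⟩
  rw [norm_mode_sq, norm_helm_mode_sq]
  set a := ∫ x, (g : ℝ → ℝ) x ^ 2
  set b := ∫ x, deriv (g : ℝ → ℝ) x ^ 2
  set d := ∫ x, deriv (deriv (g : ℝ → ℝ)) x ^ 2
  set S := ∫ y, sinN n y ^ 2
  set K := ∫ y, cosN n y ^ 2
  have ha : 0 ≤ a := integral_nonneg fun x => sq_nonneg _
  have hb : 0 ≤ b := integral_nonneg fun x => sq_nonneg _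
  have hd : 0 ≤ d := integral_nonneg fun x => sq_nonneg _
  have hSK : S ≤ K := integral_sinN_sq_le n
  have hK : 1 ≤ K := one_le_integral_cosN_sq n
  set N := (n : ℝ) ^ 2 with hN
  have N0 : 0 ≤ N := sq_nonneg _
  have N4 : (n : ℝ) ^ 4 = N ^ 2 := by rw [hN]; ring
  have hk : m * (1 + N) ≤ N + μ := by nlinarith
  have hk2 : m ^ 2 * (1 + N) ^ 2 ≤ (N + μ) ^ 2 := by
    rw [← mul_pow]; exact pow_le_pow_left₀ (by positivity) hk 2
  have hk1 : m ^ 2 * (1 + N) ≤ N + μ := by nlinarith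
  have key : m ^ 2 * ((a + b + d + N ^ 2 * a) + N * (a + b)) ≤
      2 * (d + (2 * (N + μ) * b + (N + μ) ^ 2 * a)) := by
    have h1 := mul_le_mul_of_nonneg_right hk2 ha
    have h2 := mul_le_mul_of_nonneg_right hk1 hb
    have h3 : m ^ 2 * d ≤ 1 * d := mul_le_mul_of_nonneg_right (by nlinarith) hd
    have h4 : 0 ≤ m ^ 2 * (N * a) := by positivity
    have h5 : 0 ≤ (N + μ) * b := by positivity
    have h6 : 0 ≤ (N + μ) ^ 2 * a := by positivity
    nlinarith
  rw [N4]
  calc (a + b + d + N ^ 2 * a) * K + N * (a + b) * S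
      ≤ (a + b + d + N ^ 2 * a) * K + N * (a + b) * K := by gcongr
    _ = ((a + b + d + N ^ 2 * a) + N * (a + b)) * K := by ring
    _ ≤ (2 / m ^ 2 * (d + (2 * (N + μ) * b + (N + μ) ^ 2 * a))) * K := by
        gcongr
        rw [div_mul_eq_mul_div, le_div_iff₀ (by positivity), mul_comm]
        exact key
    _ = _ := by ring

/-- Distinct modes are orthogonal in `H²`, and so are their images in `L²`, so the bounds for single
modes add up by Pythagoras. -/
theorem exists_norm_sumMode_le {μ : ℝ} (hμ : 0 < μ) :
    ∃ C : ℝ, 0 < C ∧ ∀ f, ‖sumMode f‖ ≤ C * ‖helm μ (sumMode f)‖ := by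
  obtain ⟨C, C0, hC⟩ := exists_norm_mode_le hμ
  refine ⟨Real.sqrt C, Real.sqrt_pos.2 C0, fun f => ?_⟩
  refine le_of_sq_le_sq ?_ (by positivity)
  rw [mul_pow, Real.sq_sqrt C0.le, norm_sumMode_sq, sumMode_apply, map_sum,
    norm_sum_sq_of_orthogonal, Finset.mul_sum]
  · exact Finset.sum_le_sum fun n _ => hC n _
  · intro i _ j _ h
    rw [helm_mode, helm_mode, inner_cos_cos h]

/-! ### Completeness and symmetry -/

theorem integral_mul_eq_inner {φ : Cyl → ℝ} (hφ : MemLp φ 2 volume) (u : L2) :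
    ∫ z, u z * φ z = ⟪u, hφ.toLp φ⟫_ℝ := by
  rw [L2.inner_def]
  refine integral_congr_ae ?_
  filter_upwards [hφ.coeFn_toLp] with z hz
  rw [hz]
  simp [mul_comm]

theorem continuous_integral_mul {φ : Cyl → ℝ} (hφ : MemLp φ 2 volume) :
    Continuous (fun u : L2 => ∫ z, u z * φ z) := by
  simp only [integral_mul_eq_inner hφ]
  exact continuous_id.inner continuous_const

theorem isClosed_isWeakDx : IsClosed {q : L2 × L2 | IsWeakDx q.1 q.2} := by
  simp only [IsWeakDx, ofPred_forall]
  refine isClosed_iInter fun τ => isClosed_iInter fun hτ => isClosed_eq ?_ ?_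
  · exact (continuous_integral_mul (hτ.continuous_dx.memLp_of_hasCompactSupport
      hτ.hasCompactSupport_dx)).comp continuous_fst
  · exact ((continuous_integral_mul (hτ.continuous.memLp_of_hasCompactSupport
      hτ.compact)).comp continuous_snd).neg

theorem isClosed_isWeakDy : IsClosed {q : L2 × L2 | IsWeakDy q.1 q.2} := by
  simp only [IsWeakDy, ofPred_forall]
  refine isClosed_iInter fun τ => isClosed_iInter fun hτ => isClosed_eq ?_ ?_
  · exact (continuous_integral_mul (hτ.continuous_dy.memLp_of_hasCompactSupport
      hτ.hasCompactSupport_dy)).comp continuous_fst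
  · exact ((continuous_integral_mul (hτ.continuous.memLp_of_hasCompactSupport
      hτ.compact)).comp continuous_snd).neg

theorem isClosed_H2space : IsClosed (H2space : Set (PiLp 2 (fun _ : Fin 6 => L2))) := by
  have c : ∀ i j : Fin 6, Continuous fun U : PiLp 2 (fun _ : Fin 6 => L2) => (U i, U j) :=
    fun i j => (PiLp.continuous_apply 2 _ i).prodMk (PiLp.continuous_apply 2 _ j)
  exact (isClosed_isWeakDx.preimage (c 0 1)).inter <| (isClosed_isWeakDy.preimage (c 0 2)).inter <|
    (isClosed_isWeakDx.preimage (c 1 3)).inter <| (isClosed_isWeakDy.preimage (c 1 4)).inter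
      (isClosed_isWeakDy.preimage (c 2 5))

instance : CompleteSpace H2 := isClosed_H2space.completeSpace_coe

theorem measurePreserving_reflX : MeasurePreserving (fun z : Cyl => ((-z.1, z.2) : Cyl)) :=
  (Measure.measurePreserving_neg (volume : Measure ℝ)).prod (MeasurePreserving.id _)

theorem measurePreserving_reflY : MeasurePreserving (fun z : Cyl => ((z.1, -z.2) : Cyl)) :=
  (MeasurePreserving.id (volume : Measure ℝ)).prod (Measure.measurePreserving_neg _)

/-- `f(-x, y)`. -/
def reflX : L2 →ₗᵢ[ℝ] L2 := Lp.compMeasurePreservingₗᵢ ℝ _ measurePreserving_reflX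

/-- `f(x, -y)`. -/
def reflY : L2 →ₗᵢ[ℝ] L2 := Lp.compMeasurePreservingₗᵢ ℝ _ measurePreserving_reflY

theorem coeFn_reflX (f : L2) : reflX f =ᵐ[volume] fun z => f (-z.1, z.2) :=
  Lp.coeFn_compMeasurePreserving f measurePreserving_reflX

theorem coeFn_reflY (f : L2) : reflY f =ᵐ[volume] fun z => f (z.1, -z.2) :=
  Lp.coeFn_compMeasurePreserving f measurePreserving_reflY

/-- The functions of `L²` that are even in `x` and in `y`. -/
def Ls : Submodule ℝ L2 where
  carrier := {f | reflX f = f ∧ reflY f = f}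
  add_mem' h h' := ⟨by rw [map_add, h.1, h'.1], by rw [map_add, h.2, h'.2]⟩
  zero_mem' := ⟨map_zero _, map_zero _⟩
  smul_mem' c _ h := ⟨by rw [map_smul, h.1], by rw [map_smul, h.2]⟩

theorem mem_Ls_iff {f : L2} : f ∈ Ls ↔
    (∀ᵐ z : Cyl, f z = f (-z.1, z.2)) ∧ ∀ᵐ z : Cyl, f z = f (z.1, -z.2) := by
  refine and_congr ?_ ?_
  · constructor
    · intro h
      have h1 := coeFn_reflX f
      rw [h] at h1
      exact h1
    · intro h
      exact Lp.ext ((coeFn_reflX f).trans (h.mono fun z hz => hz.symm))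
  · constructor
    · intro h
      have h1 := coeFn_reflY f
      rw [h] at h1
      exact h1
    · intro h
      exact Lp.ext ((coeFn_reflY f).trans (h.mono fun z hz => hz.symm))

theorem isClosed_Ls : IsClosed (Ls : Set L2) :=
  (isClosed_eq reflX.continuous continuous_id).inter (isClosed_eq reflY.continuous continuous_id)

instance : CompleteSpace Ls := isClosed_Ls.completeSpace_coe

/-- The functions of `H²` that are even in `x` and in `y`. -/
def Hs : Submodule ℝ H2 := Ls.comap (compL 0).toLinearMap

theorem mem_Hs_iff {u : H2} : u ∈ Hs ↔ u.fn ∈ Ls := Iff.rfl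

theorem mem_Hs_iff_mem_H2sym {u : H2} : u ∈ Hs ↔ u ∈ H2sym := mem_Ls_iff

theorem isClosed_Hs : IsClosed (Hs : Set H2) := isClosed_Ls.preimage (compL 0).continuous

instance : CompleteSpace Hs := isClosed_Hs.completeSpace_coe

theorem prodL_mem_Ls {E : C(Torus, ℝ)} {G : DecC} (hE : ∀ y, E (-y) = E y)
    (hG : ∀ x, (G : ℝ → ℝ) (-x) = (G : ℝ → ℝ) x) : prodL E G ∈ Ls := by
  rw [mem_Ls_iff]
  have h0 := coeFn_prodL E G
  constructor
  · filter_upwards [h0, measurePreserving_reflX.quasiMeasurePreserving.ae h0] with z h1 h2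
    rw [h1, h2, hG]
  · filter_upwards [h0, measurePreserving_reflY.quasiMeasurePreserving.ae h0] with z h1 h2
    rw [h1, h2, hE]

theorem mode_mem_Hs (n : ℕ) (g : Prof) : mode n g ∈ Hs :=
  prodL_mem_Ls (E := cosC n) (G := prof0 g) (cosN_neg n) g.2.even

theorem sumMode_mem_Hs (f : ℕ →₀ Prof) : sumMode f ∈ Hs := by
  rw [sumMode_apply]
  exact Submodule.sum_mem _ fun n _ => mode_mem_Hs n _

theorem IsProf.deriv2_even {g : ℝ → ℝ} (h : IsProf g) (x : ℝ) :
    deriv (deriv g) (-x) = deriv (deriv g) x := by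
  have h1 : (fun x => deriv g (-x)) = fun x => -deriv g x := funext h.deriv_neg
  have h2 := deriv_comp_neg (deriv g) x
  rw [h1, deriv.fun_neg] at h2
  linarith

theorem helm_mode_mem_Ls (μ : ℝ) (n : ℕ) (g : Prof) : helm μ (mode n g) ∈ Ls := by
  rw [helm_mode]
  refine prodL_mem_Ls (cosN_neg n) fun x => ?_
  change -deriv (deriv (g : ℝ → ℝ)) (-x) + ((n : ℝ) ^ 2 + μ) * (g : ℝ → ℝ) (-x) =
    -deriv (deriv (g : ℝ → ℝ)) x + ((n : ℝ) ^ 2 + μ) * (g : ℝ → ℝ) x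
  rw [g.2.even, g.2.deriv2_even]

theorem helm_sumMode_mem_Ls (μ : ℝ) (f : ℕ →₀ Prof) : helm μ (sumMode f) ∈ Ls := by
  rw [sumMode_apply, map_sum]
  exact Submodule.sum_mem _ fun n _ => helm_mode_mem_Ls μ n _

theorem inner_prodL_right (u : L2) (E : C(Torus, ℝ)) (G : DecC) :
    ⟪u, prodL E G⟫_ℝ = ∫ z, u z * ((G : ℝ → ℝ) z.1 * E z.2) :=
  (integral_mul_eq_inner (memLp_decC G E) u).symm

/-- The functions `(-Δ + μ)(g(x)cos(ny))` are total in the even functions. -/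
theorem eq_zero_of_inner_helm_mode {μ : ℝ} (hμ : 0 < μ) {f : L2} (hf : f ∈ Ls)
    (h : ∀ n g, ⟪f, helm μ (mode n g)⟫_ℝ = 0) : f = 0 := by
  have hf' := mem_Ls_iff.1 hf
  refine L2_eq_zero_of_modes f (fun n g hg hc => ?_) fun n g hg hc => ?_
  · set k := Real.sqrt ((n : ℝ) ^ 2 + μ)
    have k2 : k ^ 2 = (n : ℝ) ^ 2 + μ := Real.sq_sqrt (by positivity)
    have sneg : ContDiff ℝ (⊤ : ℕ∞) (fun x => g (-x)) := hg.comp contDiff_neg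
    have cneg : HasCompactSupport (fun x => g (-x)) :=
      hc.comp_homeomorph (Homeomorph.neg ℝ)
    -- Profiles are even, so the data is symmetrized before applying the resolvent; evenness of `f`
    -- in `x` recovers the pairing with `g` itself.
    obtain ⟨v, hv, hve⟩ := exists_isProf_resolvent (g := fun x => g x + g (-x)) (k := k)
      (hg.add sneg) (hc.add cneg) (fun x => by simp only [neg_neg]; ring)
      (Real.sqrt_pos.2 (by positivity))
    have h1 := h n ⟨v, hv⟩
    rw [helm_mode, inner_prodL_right] at h1
    have e : ∀ z : Cyl, f z * (((-prof2 ⟨v, hv⟩ + ((n : ℝ) ^ 2 + μ) • prof0 ⟨v, hv⟩ : DecC) :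
        ℝ → ℝ) z.1 * cosC n z.2) = f z * (g z.1 * cosN n z.2) + f z * (g (-z.1) * cosN n z.2) :=
      fun z => by
        have := hve z.1
        rw [k2] at this
        change f z * ((-deriv (deriv v) z.1 + ((n : ℝ) ^ 2 + μ) * v z.1) * cosN n z.2) = _
        rw [this]; ring
    simp only [e] at h1
    have i1 := f.integrable_mul_prod hg.continuous (dec_of_compactSupport hg.continuous hc)
      (continuous_cosN n)
    have i2 := f.integrable_mul_prod sneg.continuous (dec_of_compactSupport sneg.continuous cneg)
      (continuous_cosN n)
    rw [integral_add i1 i2] at h1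
    have h2 : ∫ z, f z * (g (-z.1) * cosN n z.2) = ∫ z, f z * (g z.1 * cosN n z.2) := by
      rw [← measurePreserving_reflX.integral_comp
        ((Homeomorph.neg ℝ).prodCongr (Homeomorph.refl Torus)).measurableEmbedding
        (fun z => f z * (g z.1 * cosN n z.2))]
      refine integral_congr_ae ?_
      filter_upwards [hf'.1] with z hz
      simp only [← hz]
    linarith
  -- The sine coefficients vanish because `f` is even in `y`.
  · have h2 : ∫ z, f z * (g z.1 * sinN n z.2) = ∫ z, -(f z * (g z.1 * sinN n z.2)) := by
      rw [← measurePreserving_reflY.integral_comp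
        ((Homeomorph.refl ℝ).prodCongr (Homeomorph.neg Torus)).measurableEmbedding
        (fun z => f z * (g z.1 * sinN n z.2))]
      refine integral_congr_ae ?_
      filter_upwards [hf'.2] with z hz
      simp only [← hz, sinN_neg]; ring
    rw [integral_neg] at h2
    linarith

/-- `-Δ + μ` is symmetric against modes. -/
theorem inner_helm_mode (μ : ℝ) (u : H2) (n : ℕ) (g : Prof) :
    ⟪helm μ u, (mode n g).fn⟫_ℝ = ⟪u.fn, helm μ (mode n g)⟫_ℝ := by
  obtain ⟨h1, h2, h3, -, h5⟩ := u.2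
  have e1 : ⟪u.dxx, prodL (cosC n) (prof0 g)⟫_ℝ = ⟪u.fn, prodL (cosC n) (prof2 g)⟫_ℝ := by
    have a := h3.integral_prod g.2.smooth g.2.hasDerivAt g.2.dec g.2.dec' (smoothT_cosN n)
    have b := h1.integral_prod g.2.smooth' g.2.hasDerivAt' g.2.dec' g.2.dec'' (smoothT_cosN n)
    rw [inner_prodL_right, inner_prodL_right]
    change ∫ z, u.1 3 z * ((g : ℝ → ℝ) z.1 * cosN n z.2) =
      ∫ z, u.1 0 z * (deriv (deriv (g : ℝ → ℝ)) z.1 * cosN n z.2)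
    linarith
  have e2 : ⟪u.dyy, prodL (cosC n) (prof0 g)⟫_ℝ =
      ⟪u.fn, (-(n : ℝ) ^ 2) • prodL (cosC n) (prof0 g)⟫_ℝ := by
    have a := h5.integral_prod (E' := fun y => -(n : ℝ) * sinN n y) g.2.smooth g.2.dec
      (smoothT_cosN n) (hasDerivAt_cosN n)
      (continuous_const.mul (continuous_sinN n))
    have b := h2.integral_prod (E' := fun y => -(n : ℝ) ^ 2 * cosN n y) g.2.smooth g.2.dec
      ((smoothT_sinN n).const_mul _)
      (hasDerivAt_sinN n)
      (continuous_const.mul (continuous_cosN n))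
    rw [← prodL_smul, inner_prodL_right, inner_prodL_right]
    change ∫ z, u.1 5 z * ((g : ℝ → ℝ) z.1 * cosN n z.2) =
      ∫ z, u.1 0 z * ((g : ℝ → ℝ) z.1 * (-(n : ℝ) ^ 2 * cosN n z.2))
    linarith
  rw [helm_apply, helm_apply, ← compL_three (mode n g), ← compL_five (mode n g),
    ← compL_zero (mode n g), compL_mode_zero, compL_mode_three, compL_mode_five,
    inner_add_left, inner_sub_left, inner_neg_left, inner_smul_left, e1, e2, inner_add_right,
    inner_sub_right, inner_neg_right, inner_smul_right, inner_smul_right]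
  simp

theorem inner_helm_sumMode (μ : ℝ) (u : H2) (f : ℕ →₀ Prof) :
    ⟪helm μ u, (sumMode f).fn⟫_ℝ = ⟪u.fn, helm μ (sumMode f)⟫_ℝ := by
  rw [← compL_zero (sumMode f), sumMode_apply, map_sum, map_sum, inner_sum, inner_sum]
  exact Finset.sum_congr rfl fun n _ => inner_helm_mode μ u n _

/-! ### Solvability of `-Δ + μ` and density of the modes -/

/-- The closure of the finite sums of modes. -/
def modeClosure : Submodule ℝ H2 := (LinearMap.range sumMode).topologicalClosure

theorem modeClosure_induction {P : H2 → Prop} (hP : IsClosed {u | P u}) (h : ∀ f, P (sumMode f))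
    {u : H2} (hu : u ∈ modeClosure) : P u := by
  have : closure (LinearMap.range sumMode : Set H2) ⊆ {u | P u} :=
    hP.closure_subset_iff.2 (by rintro _ ⟨f, rfl⟩; exact h f)
  exact this hu

theorem sumMode_mem_modeClosure (f : ℕ →₀ Prof) : sumMode f ∈ modeClosure :=
  subset_closure ⟨f, rfl⟩

theorem exists_norm_le_of_modeClosure {μ : ℝ} (hμ : 0 < μ) :
    ∃ C : ℝ, 0 < C ∧ ∀ u ∈ modeClosure, ‖u‖ ≤ C * ‖helm μ u‖ := by
  obtain ⟨C, C0, hC⟩ := exists_norm_sumMode_le hμ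
  exact ⟨C, C0, fun u hu => modeClosure_induction (P := fun u => ‖u‖ ≤ C * ‖helm μ u‖)
    (isClosed_le (by fun_prop) (by fun_prop)) hC hu⟩

theorem helm_mem_Ls_of_modeClosure (μ : ℝ) {u : H2} (hu : u ∈ modeClosure) : helm μ u ∈ Ls :=
  modeClosure_induction (P := fun u => helm μ u ∈ Ls) (isClosed_Ls.preimage (helm μ).continuous)
    (helm_sumMode_mem_Ls μ) hu

/-- An operator that is bounded below on a complete subspace and whose range there is total in a
subspace `L` maps onto `L`. -/
theorem surjOn_of_bound {E F : Type*} [NormedAddCommGroup E] [NormedSpace ℝ E]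
    [NormedAddCommGroup F] [InnerProductSpace ℝ F] [CompleteSpace F] (S : Submodule ℝ E)
    [CompleteSpace S] (T : E →L[ℝ] F)
    (L : Submodule ℝ F) (hTL : ∀ u ∈ S, T u ∈ L) {C : ℝ} (hC : ∀ u ∈ S, ‖u‖ ≤ C * ‖T u‖)
    (h : ∀ f ∈ L, (∀ u ∈ S, ⟪f, T u⟫_ℝ = 0) → f = 0) {f : F} (hf : f ∈ L) :
    ∃ u ∈ S, T u = f := by
  let T' : S →L[ℝ] F := T.comp S.subtypeL
  -- The lower bound makes the range closed, so `f` can be projected onto it; the remainder is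
  -- orthogonal to the range and vanishes by totality.
  have hcl : IsClosed (LinearMap.range T'.toLinearMap : Set F) := by
    have hanti : AntilipschitzWith C.toNNReal T' :=
      T'.antilipschitz_of_bound fun x =>
        (hC x x.2).trans (mul_le_mul_of_nonneg_right (Real.le_coe_toNNReal C) (norm_nonneg _))
    have := hanti.isClosed_range T'.uniformContinuous
    rwa [← T'.coe_coe, ← LinearMap.coe_range] at this
  have : CompleteSpace (LinearMap.range T'.toLinearMap) := hcl.completeSpace_coe
  set K := LinearMap.range T'.toLinearMap
  have hp : K.starProjection f ∈ K := K.starProjection_apply_mem f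
  have hKL : K ≤ L := by rintro _ ⟨u, rfl⟩; exact hTL u u.2
  have h0 : f - K.starProjection f = 0 := by
    refine h _ (L.sub_mem hf (hKL hp)) fun u hu => ?_
    rw [real_inner_comm]
    exact K.sub_starProjection_mem_orthogonal f (T u) ⟨⟨u, hu⟩, rfl⟩
  rw [← sub_eq_zero.1 h0] at hp
  obtain ⟨u, hu⟩ := hp
  exact ⟨u, u.2, hu⟩

theorem exists_helm_eq {μ : ℝ} (hμ : 0 < μ) {f : L2} (hf : f ∈ Ls) :
    ∃ u ∈ modeClosure, helm μ u = f := by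
  obtain ⟨C, -, hC⟩ := exists_norm_le_of_modeClosure hμ
  have : CompleteSpace modeClosure :=
    (Submodule.isClosed_topologicalClosure _).completeSpace_coe
  exact surjOn_of_bound modeClosure (helm μ) Ls
    (fun u hu => helm_mem_Ls_of_modeClosure μ hu) hC
    (fun f hf h => eq_zero_of_inner_helm_mode hμ hf fun n g =>
      h _ (sumMode_single n g ▸ sumMode_mem_modeClosure _)) hf

/-- Uniqueness for `-Δ + 1` gives density without mollification. For even `u`, solve `(1 - Δ)v` =
the even projection of `(1 - Δ)u` inside the closure of the modes; then `u - v` is orthogonal to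
every `(1 - Δ)(g(x)cos(ny))`, and these are total. -/
theorem Hs_eq_modeClosure : Hs = modeClosure := by
  refine le_antisymm (fun u hu => ?_) fun u hu =>
    modeClosure_induction (P := fun u => u ∈ Hs) isClosed_Hs sumMode_mem_Hs hu
  obtain ⟨v, hv, hve⟩ := exists_helm_eq one_pos (Ls.starProjection_apply_mem (helm 1 u))
  have hvs : v ∈ Hs := modeClosure_induction (P := fun u => u ∈ Hs) isClosed_Hs sumMode_mem_Hs hv
  have h0 : (u - v).fn = 0 := by
    refine eq_zero_of_inner_helm_mode one_pos (Hs.sub_mem hu hvs) fun n g => ?_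
    rw [← inner_helm_mode, map_sub, hve, real_inner_comm]
    exact Ls.sub_starProjection_mem_orthogonal _ _ (mode_mem_Hs n g)
  rw [sub_eq_zero.1 (H2.eq_zero_of_fn h0)]
  exact hv

theorem Hs_induction {P : H2 → Prop} (hP : IsClosed {u | P u}) (h : ∀ f, P (sumMode f))
    {u : H2} (hu : u ∈ Hs) : P u := modeClosure_induction hP h (Hs_eq_modeClosure ▸ hu)

theorem helm_mem_Ls (μ : ℝ) {u : H2} (hu : u ∈ Hs) : helm μ u ∈ Ls :=
  helm_mem_Ls_of_modeClosure μ (Hs_eq_modeClosure ▸ hu)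

theorem inner_helm_comm (μ : ℝ) (u : H2) {v : H2} (hv : v ∈ Hs) :
    ⟪helm μ u, v.fn⟫_ℝ = ⟪u.fn, helm μ v⟫_ℝ := by
  refine Hs_induction (P := fun v => ⟪helm μ u, compL 0 v⟫_ℝ = ⟪u.fn, helm μ v⟫_ℝ)
    (isClosed_eq ?_ ?_) (inner_helm_sumMode μ u) hv
  · exact continuous_const.inner (compL 0).continuous
  · exact continuous_const.inner (helm μ).continuous

/-- Perturbations of `-Δ + μ` by bounded symmetric operators that are bounded below are onto. -/
theorem exists_helm_sub_eq {μ : ℝ} (hμ : 0 < μ) (B : L2 →L[ℝ] L2) (hB : ∀ f ∈ Ls, B f ∈ Ls)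
    (hsymm : ∀ f g, ⟪B f, g⟫_ℝ = ⟪f, B g⟫_ℝ) {c : ℝ} (hc : 0 < c)
    (hbd : ∀ u ∈ Hs, c * ‖u.fn‖ ≤ ‖helm μ u - B u.fn‖) :
    (∃ C : ℝ, ∀ u ∈ Hs, ‖u‖ ≤ C * ‖helm μ u - B u.fn‖) ∧
      ∀ f ∈ Ls, ∃ u ∈ Hs, helm μ u - B u.fn = f := by
  obtain ⟨C, C0, hC⟩ := exists_norm_le_of_modeClosure hμ
  rw [← Hs_eq_modeClosure] at hC
  have hb : ∀ u ∈ Hs, ‖u‖ ≤ C * (1 + ‖B‖ / c) * ‖helm μ u - B u.fn‖ := fun u hu => by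
    have h1 : ‖u.fn‖ ≤ ‖helm μ u - B u.fn‖ / c := by
      rw [le_div_iff₀ hc, mul_comm]; exact hbd u hu
    have h2 : ‖helm μ u‖ ≤ ‖helm μ u - B u.fn‖ + ‖B u.fn‖ := by
      simpa using norm_add_le (helm μ u - B u.fn) (B u.fn)
    have h3 : ‖B u.fn‖ ≤ ‖B‖ * (‖helm μ u - B u.fn‖ / c) := (B.le_opNorm _).trans (by gcongr)
    calc ‖u‖ ≤ C * ‖helm μ u‖ := hC u hu
      _ ≤ C * (‖helm μ u - B u.fn‖ + ‖B‖ * (‖helm μ u - B u.fn‖ / c)) := by gcongr; linarith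
      _ = _ := by ring
  refine ⟨⟨_, hb⟩, fun f hf => ?_⟩
  refine surjOn_of_bound Hs (helm μ - B.comp (compL 0)) Ls
    (fun u hu => Ls.sub_mem (helm_mem_Ls μ hu) (hB _ hu)) (fun u hu => hb u hu) (fun f hf h => ?_) hf
  -- An element `f` orthogonal to the range is only a weak solution of `(-Δ + μ)f = Bf`. Solving for
  -- `v` with right side `Bf` and comparing shows `f = v`, so `f` lies in the domain and the lower
  -- bound forces `f = 0`.
  · obtain ⟨v, hv, hve⟩ := exists_helm_eq hμ (hB f hf)
    rw [← Hs_eq_modeClosure] at hv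
    have hfv : f - v.fn = 0 := by
      refine eq_zero_of_inner_helm_mode hμ (Ls.sub_mem hf hv) fun n g => ?_
      have h1 : ⟪f, helm μ (mode n g) - B (mode n g).fn⟫_ℝ = 0 := h _ (mode_mem_Hs n g)
      rw [inner_sub_right, ← hsymm, ← hve, inner_helm_mode] at h1
      rw [inner_sub_left, h1]
    have hfv : f = v.fn := sub_eq_zero.1 hfv
    have h2 := hbd v hv
    rw [hve, ← hfv, sub_self, norm_zero] at h2
    have : ‖f‖ ≤ 0 := by nlinarith [norm_nonneg f]
    exact norm_le_zero_iff.1 this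

open scoped ZeroAtInfty

/-! ### The Sobolev embedding -/

/-- The Banach space of the functions of `H²` that are even in `x` and in `y`. -/
def HS : Type := Hs

instance : NormedAddCommGroup HS := inferInstanceAs (NormedAddCommGroup Hs)
instance : NormedSpace ℝ HS := inferInstanceAs (NormedSpace ℝ Hs)
instance : CompleteSpace HS := inferInstanceAs (CompleteSpace Hs)

/-- The Banach space of the functions of `L²` that are even in `x` and in `y`. -/
def LS : Type := Ls

instance : NormedAddCommGroup LS := inferInstanceAs (NormedAddCommGroup Ls)
instance : NormedSpace ℝ LS := inferInstanceAs (NormedSpace ℝ Ls)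
instance : CompleteSpace LS := inferInstanceAs (CompleteSpace Ls)

/-- The inclusion of the symmetric functions in `H²`. -/
def HS.val : HS →L[ℝ] H2 :=
  LinearMap.mkContinuous (Hs.subtype : HS →ₗ[ℝ] H2) 1 fun u => (one_mul ‖u‖).ge

/-- The inclusion of the symmetric functions in `L²`. -/
def LS.val : LS →L[ℝ] L2 :=
  LinearMap.mkContinuous (Ls.subtype : LS →ₗ[ℝ] L2) 1 fun u => (one_mul ‖u‖).ge

/-- A symmetric function of `H²` as an element of `HS`. -/
def HS.mk (u : H2) (hu : u ∈ Hs) : HS := (⟨u, hu⟩ : Hs)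

theorem HS.val_mk (u : H2) (hu : u ∈ Hs) : HS.val (HS.mk u hu) = u := rfl

theorem HS.val_mem (u : HS) : HS.val u ∈ Hs := Subtype.property (show Hs from u)

theorem LS.val_mem (u : LS) : LS.val u ∈ Ls := Subtype.property (show Ls from u)

theorem HS.norm_val (u : HS) : ‖HS.val u‖ = ‖u‖ := rfl

theorem HS.val_injective : Function.Injective HS.val := Subtype.val_injective

theorem LS.val_injective : Function.Injective LS.val := Subtype.val_injective

/-- The underlying function of a symmetric element of `H²`. -/
def HS.fn : HS →L[ℝ] L2 := (compL 0).comp HS.val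

theorem tendsto_fst_cocompact : Tendsto (fun z : Cyl => z.1) (cocompact Cyl) (cocompact ℝ) := by
  rw [← Filter.coprod_cocompact, show cocompact Torus = ⊥ from cocompact_eq_bot]
  simp [Filter.coprod, tendsto_comap]

/-- `g(x)cos(ny)` as a continuous function vanishing at infinity. -/
def modeC (n : ℕ) : Prof →ₗ[ℝ] C₀(Cyl, ℝ) where
  toFun g := ⟨⟨fun z => (g : ℝ → ℝ) z.1 * cosN n z.2,
    (g.2.cont.comp continuous_fst).mul ((continuous_cosN n).comp continuous_snd)⟩, by
      refine squeeze_zero_norm (fun z => ?_)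
        (tendsto_norm_zero.comp (g.2.dec.tendsto_cocompact.comp tendsto_fst_cocompact))
      change |(g : ℝ → ℝ) z.1 * cosN n z.2| ≤ |(g : ℝ → ℝ) z.1|
      rw [abs_mul]
      exact mul_le_of_le_one_right (abs_nonneg _) (abs_cosN_le n z.2)⟩
  map_add' g h := ZeroAtInftyContinuousMap.ext fun z => add_mul _ _ _
  map_smul' c g := ZeroAtInftyContinuousMap.ext fun z => mul_assoc _ _ _

theorem modeC_apply (n : ℕ) (g : Prof) (z : Cyl) :
    modeC n g z = (g : ℝ → ℝ) z.1 * cosN n z.2 := rfl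

theorem C0_norm_le {w : C₀(Cyl, ℝ)} {M : ℝ} (hM : 0 ≤ M) (h : ∀ z, |w z| ≤ M) : ‖w‖ ≤ M := by
  rw [← ZeroAtInftyContinuousMap.norm_toBCF_eq_norm]
  exact (BoundedContinuousFunction.norm_le hM).2 h

theorem C0_abs_le (w : C₀(Cyl, ℝ)) (z : Cyl) : |w z| ≤ ‖w‖ := by
  rw [← ZeroAtInftyContinuousMap.norm_toBCF_eq_norm]
  exact w.toBCF.norm_coe_le_norm z

/-- The gain `(1 + n²)^{-1/2}` comes from the mixed derivative and the first derivative in `y`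
contained in the `H²` norm; it is square summable in `n`. -/
theorem norm_modeC_le (n : ℕ) (g : Prof) :
    ‖modeC n g‖ ≤ (Real.sqrt (1 + (n : ℝ) ^ 2))⁻¹ * ‖mode n g‖ := by
  refine C0_norm_le (by positivity) fun z => ?_
  have n0 : 0 < 1 + (n : ℝ) ^ 2 := by positivity
  refine le_of_sq_le_sq ?_ (by positivity)
  rw [mul_pow, inv_pow, Real.sq_sqrt n0.le, inv_mul_eq_div, le_div_iff₀ n0, norm_mode_sq,
    modeC_apply, sq_abs, mul_pow]
  have h1 := sq_le_integral_sq g.2.hasDerivAt g.2.cont' g.2.dec g.2.dec' z.1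
  have h2 : cosN n z.2 ^ 2 ≤ 1 := by
    rw [← sq_abs]; exact pow_le_one₀ (abs_nonneg _) (abs_cosN_le n z.2)
  have ha : 0 ≤ ∫ x, (g : ℝ → ℝ) x ^ 2 := integral_nonneg fun x => sq_nonneg _
  have hb : 0 ≤ ∫ x, deriv (g : ℝ → ℝ) x ^ 2 := integral_nonneg fun x => sq_nonneg _
  have hd : 0 ≤ ∫ x, deriv (deriv (g : ℝ → ℝ)) x ^ 2 := integral_nonneg fun x => sq_nonneg _
  have hK := one_le_integral_cosN_sq n
  have hS : (n : ℝ) ^ 2 ≤ (n : ℝ) ^ 2 * ∫ y, sinN n y ^ 2 := by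
    rcases eq_or_ne n 0 with rfl | hn
    · simp
    · rw [integral_sinN_sq hn]
      nlinarith [Real.pi_gt_three, sq_nonneg (n : ℝ)]
  set a := ∫ x, (g : ℝ → ℝ) x ^ 2
  set b := ∫ x, deriv (g : ℝ → ℝ) x ^ 2
  set d := ∫ x, deriv (deriv (g : ℝ → ℝ)) x ^ 2
  calc (g : ℝ → ℝ) z.1 ^ 2 * cosN n z.2 ^ 2 * (1 + (n : ℝ) ^ 2)
      ≤ (g : ℝ → ℝ) z.1 ^ 2 * 1 * (1 + (n : ℝ) ^ 2) := by gcongr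
    _ ≤ (a + b) * (1 + (n : ℝ) ^ 2) := by rw [mul_one]; gcongr
    _ = (a + b) * 1 + (a + b) * (n : ℝ) ^ 2 := by ring
    _ ≤ (a + b + d + (n : ℝ) ^ 4 * a) * (∫ y, cosN n y ^ 2) +
        (a + b) * ((n : ℝ) ^ 2 * ∫ y, sinN n y ^ 2) := by
      have : 0 ≤ (n : ℝ) ^ 4 * a := by positivity
      have : a + b ≤ a + b + d + (n : ℝ) ^ 4 * a := by linarith
      gcongr
    _ = _ := by ring

theorem summable_inv_one_add_sq : Summable fun n : ℕ => (1 + (n : ℝ) ^ 2)⁻¹ := by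
  have h := ((summable_nat_add_iff 1).2
    (Real.summable_one_div_nat_pow.2 (one_lt_two))).mul_left 2
  refine Summable.of_nonneg_of_le (fun n => by positivity) (fun n => ?_) h
  rw [mul_one_div, inv_eq_one_div, div_le_div_iff₀ (by positivity) (by positivity)]
  push_cast
  nlinarith [sq_nonneg ((n : ℝ) - 1)]

/-- Finite sums `∑ gₙ(x)cos(ny)` as continuous functions. -/
def sumC : (ℕ →₀ Prof) →ₗ[ℝ] C₀(Cyl, ℝ) := Finsupp.lsum ℝ modeC

theorem sumC_eq (f : ℕ →₀ Prof) : sumC f = ∑ n ∈ f.support, modeC n (f n) := rfl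

theorem sumC_apply (f : ℕ →₀ Prof) (z : Cyl) :
    sumC f z = ∑ n ∈ f.support, (f n : ℝ → ℝ) z.1 * cosN n z.2 := by
  rw [sumC_eq]
  have h : ∀ s : Finset ℕ, (∑ n ∈ s, modeC n (f n)) z =
      ∑ n ∈ s, (f n : ℝ → ℝ) z.1 * cosN n z.2 := fun s => by
    induction s using Finset.induction_on with
    | empty => simp
    | insert n s hn ih =>
      rw [Finset.sum_insert hn, Finset.sum_insert hn, ZeroAtInftyContinuousMap.add_apply, ih,
        modeC_apply]
  exact h _

/-- The triangle inequality and Cauchy–Schwarz over `n`, using summability of `1/(1 + n²)`. -/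
theorem exists_norm_sumC_le : ∃ C : ℝ, 0 ≤ C ∧ ∀ f, ‖sumC f‖ ≤ C * ‖sumMode f‖ := by
  refine ⟨Real.sqrt (∑' n : ℕ, (1 + (n : ℝ) ^ 2)⁻¹), Real.sqrt_nonneg _, fun f => ?_⟩
  have t0 : 0 ≤ ∑' n : ℕ, (1 + (n : ℝ) ^ 2)⁻¹ := tsum_nonneg fun n => by positivity
  have h1 : ‖sumC f‖ ≤ ∑ n ∈ f.support, (Real.sqrt (1 + (n : ℝ) ^ 2))⁻¹ * ‖mode n (f n)‖ :=
    (norm_sum_le _ _).trans (Finset.sum_le_sum fun n _ => norm_modeC_le n _)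
  refine h1.trans (le_of_sq_le_sq ?_ (by positivity))
  rw [mul_pow, Real.sq_sqrt t0, norm_sumMode_sq]
  refine (Finset.sum_mul_sq_le_sq_mul_sq _ _ _).trans ?_
  gcongr
  refine le_trans (le_of_eq (Finset.sum_congr rfl fun n _ => ?_))
    (summable_inv_one_add_sq.sum_le_tsum f.support fun n _ => by positivity)
  rw [inv_pow, Real.sq_sqrt (by positivity)]

/-- Finite sums of modes as elements of the symmetric space. -/
def sumModeS : (ℕ →₀ Prof) →ₗ[ℝ] HS where
  toFun f := HS.mk (sumMode f) (sumMode_mem_Hs f)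
  map_add' f g := HS.val_injective (sumMode.map_add f g)
  map_smul' c f := HS.val_injective (sumMode.map_smul c f)

theorem val_sumModeS (f : ℕ →₀ Prof) : HS.val (sumModeS f) = sumMode f := rfl

/-- This restates `Hs_eq_modeClosure` for the Banach space `HS`; extensions by continuity and
inductions over `HS` rely on it. -/
theorem denseRange_sumModeS : DenseRange sumModeS := fun u => by
  rw [Metric.mem_closure_iff]
  intro ε hε
  have h : HS.val u ∈ closure (LinearMap.range sumMode : Set H2) :=
    (Hs_eq_modeClosure ▸ HS.val_mem u : HS.val u ∈ modeClosure)
  obtain ⟨_, ⟨f, rfl⟩, hf⟩ := Metric.mem_closure_iff.1 h ε hε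
  refine ⟨sumModeS f, ⟨f, rfl⟩, ?_⟩
  rw [dist_eq_norm, ← HS.norm_val, map_sub, val_sumModeS, ← dist_eq_norm]
  exact hf

theorem exists_extension {E H F : Type*} [AddCommGroup E] [Module ℝ E] [NormedAddCommGroup H]
    [NormedSpace ℝ H] [NormedAddCommGroup F] [NormedSpace ℝ F] [CompleteSpace F]
    (f : E →ₗ[ℝ] F) (e : E →ₗ[ℝ] H) (he : DenseRange e) {C : ℝ} (h : ∀ x, ‖f x‖ ≤ C * ‖e x‖) :
    ∃ T : H →L[ℝ] F, ∀ x, T (e x) = f x :=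
  ⟨f.extendOfNorm e, LinearMap.extendOfNorm_eq he ⟨C, h⟩⟩

/-- The space of finite families of profiles. -/
def FinModes : Type := ℕ →₀ Prof

instance : AddCommGroup FinModes := inferInstanceAs (AddCommGroup (ℕ →₀ Prof))
instance : Module ℝ FinModes := inferInstanceAs (Module ℝ (ℕ →₀ Prof))

theorem exists_embC : ∃ T : HS →L[ℝ] C₀(Cyl, ℝ), ∀ f, T (sumModeS f) = sumC f := by
  obtain ⟨C, -, hC⟩ := exists_norm_sumC_le
  let e : FinModes →ₗ[ℝ] HS := sumModeS
  let c : FinModes →ₗ[ℝ] C₀(Cyl, ℝ) := sumC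
  have he : DenseRange e := denseRange_sumModeS
  exact exists_extension c e he hC

/-- The Sobolev embedding: the continuous representative. -/
def embC : HS →L[ℝ] C₀(Cyl, ℝ) := exists_embC.choose

theorem embC_sumModeS (f : ℕ →₀ Prof) : embC (sumModeS f) = sumC f := exists_embC.choose_spec f

/-- `g(x)cos(ny)` as an element of `HS`. -/
def modeS (n : ℕ) (g : Prof) : HS := HS.mk (mode n g) (mode_mem_Hs n g)

theorem sumModeS_single (n : ℕ) (g : Prof) : sumModeS (Finsupp.single n g) = modeS n g :=
  HS.val_injective (sumMode_single n g)

theorem embC_modeS (n : ℕ) (g : Prof) : embC (modeS n g) = modeC n g := by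
  rw [← sumModeS_single, embC_sumModeS]
  simp [sumC]

theorem coeFn_finset_sum {ι : Type*} (s : Finset ι) (f : ι → L2) :
    (∑ i ∈ s, f i : L2) =ᵐ[volume] fun z => ∑ i ∈ s, f i z := by
  classical
  induction s using Finset.induction_on with
  | empty => exact Lp.coeFn_zero ℝ 2 (volume : Measure Cyl)
  | insert i s hi ih =>
    rw [Finset.sum_insert hi]
    filter_upwards [Lp.coeFn_add (f i) (∑ j ∈ s, f j), ih] with z h1 h2
    rw [h1, Pi.add_apply, h2, Finset.sum_insert hi]

theorem sumMode_fn_ae (f : ℕ →₀ Prof) : (sumMode f).fn =ᵐ[volume] sumC f := by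
  rw [← compL_zero, sumMode_apply, map_sum]
  refine (coeFn_finset_sum _ _).trans ?_
  have h : ∀ᵐ z : Cyl, ∀ n ∈ f.support,
      compL 0 (mode n (f n)) z = (f n : ℝ → ℝ) z.1 * cosN n z.2 := by
    rw [Filter.eventually_all_finset]
    exact fun n _ => coeFn_prodL (cosC n) (prof0 (f n))
  filter_upwards [h] with z hz
  rw [sumC_apply]
  exact Finset.sum_congr rfl hz

theorem exists_subseq_ae {f : ℕ → L2} {g : L2} (h : Tendsto f atTop (𝓝 g)) :
    ∃ ns : ℕ → ℕ, StrictMono ns ∧ ∀ᵐ z : Cyl, Tendsto (fun k => f (ns k) z) atTop (𝓝 (g z)) :=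
  (tendstoInMeasure_of_tendsto_Lp h).exists_seq_tendsto_ae

theorem tendsto_C0_apply {w : ℕ → C₀(Cyl, ℝ)} {v : C₀(Cyl, ℝ)} (h : Tendsto w atTop (𝓝 v))
    (z : Cyl) : Tendsto (fun k => w k z) atTop (𝓝 (v z)) := by
  rw [tendsto_iff_norm_sub_tendsto_zero] at h ⊢
  exact squeeze_zero (fun k => norm_nonneg _) (fun k => C0_abs_le (w k - v) z) h

theorem HS_induction {P : HS → Prop} (hP : IsClosed {u | P u}) (h : ∀ f, P (sumModeS f))
    (u : HS) : P u := denseRange_sumModeS.induction_on u hP h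

/-- The two sides agree on finite sums. In a limit, `L²` convergence gives almost everywhere
convergence along a subsequence, while the continuous representatives converge uniformly. -/
theorem embC_ae (u : HS) : HS.fn u =ᵐ[volume] embC u := by
  refine HS_induction (P := fun u : HS => HS.fn u =ᵐ[volume] embC u) ?_
    (fun f => by rw [embC_sumModeS]; exact sumMode_fn_ae f) u
  refine IsSeqClosed.isClosed fun v u hv hvu => ?_
  have h1 : Tendsto (fun k => HS.fn (v k)) atTop (𝓝 (HS.fn u)) :=
    HS.fn.continuous.continuousAt.tendsto.comp hvu
  obtain ⟨ns, hns, h2⟩ := exists_subseq_ae h1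
  have h3 : Tendsto (fun k => embC (v (ns k))) atTop (𝓝 (embC u)) :=
    embC.continuous.continuousAt.tendsto.comp (hvu.comp hns.tendsto_atTop)
  filter_upwards [h2, ae_all_iff.2 fun k => hv (ns k)] with z hz hk
  refine tendsto_nhds_unique hz ?_
  simp only [hk]
  exact tendsto_C0_apply h3 z

theorem continuous_eq_of_ae {f g : Cyl → ℝ} (hf : Continuous f) (hg : Continuous g)
    (h : f =ᵐ[volume] g) : f = g := Continuous.ae_eq_iff_eq volume hf hg |>.1 h

open scoped ZeroAtInfty BoundedContinuousFunction

/-! ### The soliton and the kernel function -/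

/-- The scale `κ = (p-1)/2 √ω_p`. -/
def kap (p : ℝ) : ℝ := (p - 1) / 2 * Real.sqrt (omegaP p)

/-- The exponent `s = (p+1)/(p-1)`. -/
def sidx (p : ℝ) : ℝ := (p + 1) / (p - 1)

theorem omegaP_pos {p : ℝ} (hp : 1 < p) : 0 < omegaP p := by
  have : 0 < p - 1 := by linarith
  have : 0 < p + 3 := by linarith
  unfold omegaP; positivity

theorem kap_pos {p : ℝ} (hp : 1 < p) : 0 < kap p := by
  have : 0 < p - 1 := by linarith
  have := Real.sqrt_pos.2 (omegaP_pos hp)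
  unfold kap; positivity

theorem kap_sq {p : ℝ} (hp : 1 < p) : kap p ^ 2 = (p - 1) / (p + 3) := by
  have h1 : p - 1 ≠ 0 := by linarith
  have h2 : p + 3 ≠ 0 := by linarith
  rw [kap, mul_pow, Real.sq_sqrt (omegaP_pos hp).le, omegaP]
  field_simp
  ring

theorem one_lt_sidx {p : ℝ} (hp : 1 < p) : 1 < sidx p := by
  rw [sidx, lt_div_iff₀ (by linarith)]; linarith

theorem sidx_pos {p : ℝ} (hp : 1 < p) : 0 < sidx p := one_pos.trans (one_lt_sidx hp)

/-- The criticality of `ω_p`: the ground state `sech^s(κx)` has eigenvalue `ω_p - s²κ² = -1` for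
`-∂² + ω_p - pR^{p-1}`, which cancels against `-∂_y² = 1` on `cos y`. -/
theorem sidx_sq_mul {p : ℝ} (hp : 1 < p) : sidx p ^ 2 * kap p ^ 2 = omegaP p + 1 := by
  have h1 : p - 1 ≠ 0 := by linarith
  have h2 : p + 3 ≠ 0 := by linarith
  rw [kap_sq hp, sidx, omegaP]
  field_simp
  ring

/-- The first eigenvalue of `N` above its ground state, `κ²(s² - (s-1)²)`, is exactly `1`. It
belongs to `R'`, in accordance with translation invariance. -/
theorem kap_gap {p : ℝ} (hp : 1 < p) : kap p ^ 2 * (2 * sidx p - 1) = 1 := by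
  have h1 : p - 1 ≠ 0 := by linarith
  have h2 : p + 3 ≠ 0 := by linarith
  rw [kap_sq hp, sidx]
  field_simp
  ring

theorem exponent_sq_mul {p : ℝ} (hp : 1 < p) : (2 / (p - 1)) ^ 2 * kap p ^ 2 = omegaP p := by
  have h1 : p - 1 ≠ 0 := by linarith
  have h2 : p + 3 ≠ 0 := by linarith
  rw [kap_sq hp, omegaP]
  field_simp
  ring

/-- The amplitude of the soliton. -/
def ampl (p : ℝ) : ℝ := omegaP p ^ (1 / (p - 1)) * ((p + 1) / 2) ^ (1 / (p - 1))

theorem ampl_pos {p : ℝ} (hp : 1 < p) : 0 < ampl p :=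
  mul_pos (Real.rpow_pos_of_pos (omegaP_pos hp) _) (Real.rpow_pos_of_pos (by linarith) _)

theorem soliton_eq (p x : ℝ) :
    soliton p (omegaP p) x = ampl p * sechPow (2 / (p - 1)) (kap p) x := by
  have h : 0 < Real.cosh (kap p * x) := Real.cosh_pos _
  rw [soliton, ampl, sechPow]
  congr 1
  change (1 / Real.cosh (kap p * x)) ^ (2 / (p - 1)) = _
  rw [Real.rpow_def_of_pos (by positivity), one_div, Real.log_inv]
  congr 1; ring

theorem soliton_pos {p : ℝ} (hp : 1 < p) (x : ℝ) : 0 < soliton p (omegaP p) x := by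
  rw [soliton_eq]; exact mul_pos (ampl_pos hp) (sechPow_pos _ _ _)

theorem one_sub_tanh_sq (x : ℝ) : 1 - Real.tanh x ^ 2 = (Real.cosh x ^ 2)⁻¹ := by
  have h : Real.cosh x ≠ 0 := (Real.cosh_pos _).ne'
  rw [Real.tanh_eq_sinh_div_cosh]
  field_simp
  linarith [Real.cosh_sq x]

theorem soliton_rpow {p : ℝ} (hp : 1 < p) (x : ℝ) :
    soliton p (omegaP p) x ^ (p - 1) =
      omegaP p * ((p + 1) / 2) * (1 - Real.tanh (kap p * x) ^ 2) := by
  have h1 : p - 1 ≠ 0 := by linarith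
  have hc : 0 < Real.cosh (kap p * x) := Real.cosh_pos _
  rw [soliton_eq, Real.mul_rpow (ampl_pos hp).le (sechPow_pos _ _ _).le, ampl,
    Real.mul_rpow (Real.rpow_nonneg (omegaP_pos hp).le _) (Real.rpow_nonneg (by linarith) _),
    ← Real.rpow_mul (omegaP_pos hp).le, ← Real.rpow_mul (by linarith), one_div_mul_cancel h1,
    Real.rpow_one, Real.rpow_one, one_sub_tanh_sq]
  congr 1
  rw [sechPow, ← Real.exp_mul]
  have : -(2 / (p - 1) * Real.log (Real.cosh (kap p * x))) * (p - 1) =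
      Real.log ((Real.cosh (kap p * x) ^ 2)⁻¹) := by
    rw [Real.log_inv, Real.log_pow]
    field_simp
    push_cast
    ring
  rw [this, Real.exp_log (by positivity)]

/-- The potential `p R^{p-1}`. -/
def potl (p x : ℝ) : ℝ :=
  sidx p * (sidx p + 1) * kap p ^ 2 * (1 - Real.tanh (kap p * x) ^ 2)

theorem potl_eq {p : ℝ} (hp : 1 < p) (x : ℝ) : potl p x = p * soliton p (omegaP p) x ^ (p - 1) := by
  have h1 : p - 1 ≠ 0 := by linarith
  have h2 : p + 3 ≠ 0 := by linarith
  rw [potl, soliton_rpow hp, kap_sq hp, sidx, omegaP]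
  field_simp
  ring

theorem isProf_soliton {p : ℝ} (hp : 1 < p) : IsProf (soliton p (omegaP p)) := by
  have : soliton p (omegaP p) = ampl p • sechPow (2 / (p - 1)) (kap p) := funext (soliton_eq p)
  rw [this]
  exact (isProf_sechPow (div_pos two_pos (by linarith)) (kap_pos hp)).1.smul _

/-- The soliton solves `-∂²R + ω_p R - R^p = 0`. -/
theorem soliton_ode {p : ℝ} (hp : 1 < p) (x : ℝ) :
    deriv (deriv (soliton p (omegaP p))) x = omegaP p * soliton p (omegaP p) x -
      soliton p (omegaP p) x ^ (p - 1) * soliton p (omegaP p) x := by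
  have h1 : p - 1 ≠ 0 := by linarith
  have h2 : p + 3 ≠ 0 := by linarith
  obtain ⟨hP, h3, h4⟩ := isProf_sechPow (q := 2 / (p - 1)) (div_pos two_pos (by linarith))
    (kap_pos hp)
  have e : soliton p (omegaP p) = fun x => ampl p * sechPow (2 / (p - 1)) (kap p) x :=
    funext (soliton_eq p)
  have e1 : deriv (soliton p (omegaP p)) =
      fun x => ampl p * deriv (sechPow (2 / (p - 1)) (kap p)) x := by
    rw [e]; exact funext fun x => ((hP.hasDerivAt x).const_mul _).deriv
  have e2 : deriv (deriv (soliton p (omegaP p))) x =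
      ampl p * deriv (deriv (sechPow (2 / (p - 1)) (kap p))) x := by
    rw [e1]; exact ((hP.hasDerivAt' x).const_mul _).deriv
  rw [e2, h4, soliton_rpow hp, soliton_eq]
  have k1 := exponent_sq_mul hp
  have k2 : 2 / (p - 1) * kap p ^ 2 = omegaP p * ((p - 1) / 2) := by
    rw [← k1]; field_simp
  beta_reduce
  linear_combination (ampl p * sechPow (2 / (p - 1)) (kap p) x) *
    (Real.tanh (kap p * x) ^ 2 * k1 - (1 - Real.tanh (kap p * x) ^ 2) * k2)

/-- The normalization constant of `ψ`. -/
def psiAmpl (p : ℝ) : ℝ := ampl p ^ ((p + 1) / 2) /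
    Real.sqrt (∫ z : Cyl, (soliton p (omegaP p) z.1 ^ ((p + 1) / 2) * cosT z.2) ^ 2)

theorem soliton_rpow_half {p : ℝ} (hp : 1 < p) (x : ℝ) :
    soliton p (omegaP p) x ^ ((p + 1) / 2) =
      ampl p ^ ((p + 1) / 2) * sechPow (sidx p) (kap p) x := by
  have h1 : p - 1 ≠ 0 := by linarith
  rw [soliton_eq, Real.mul_rpow (ampl_pos hp).le (sechPow_pos _ _ _).le]
  congr 1
  rw [sechPow, sechPow, ← Real.exp_mul, sidx]
  congr 1
  field_simp

theorem psi_eq {p : ℝ} (hp : 1 < p) (x : ℝ) :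
    psi p (omegaP p) x = psiAmpl p * sechPow (sidx p) (kap p) x := by
  rw [psi, soliton_rpow_half hp, psiAmpl]; ring

theorem isProf_psi {p : ℝ} (hp : 1 < p) : IsProf (psi p (omegaP p)) := by
  have : psi p (omegaP p) = psiAmpl p • sechPow (sidx p) (kap p) := funext (psi_eq hp)
  rw [this]
  exact (isProf_sechPow (sidx_pos hp) (kap_pos hp)).1.smul _

theorem integral_sechPow_sq_pos {q κ : ℝ} (hq : 0 < q) (hκ : 0 < κ) :
    0 < ∫ x, sechPow q κ x ^ 2 := by
  rw [integral_pos_iff_support_of_nonneg (fun x => sq_nonneg _)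
    (isProf_sechPow hq hκ).1.integrable_sq]
  have : Function.support (fun x => sechPow q κ x ^ 2) = univ :=
    eq_univ_of_forall fun x => (pow_pos (sechPow_pos q κ x) 2).ne'
  simp [this]

theorem psiAmpl_sq {p : ℝ} (hp : 1 < p) :
    psiAmpl p ^ 2 * (∫ x, sechPow (sidx p) (kap p) x ^ 2) * Real.pi = 1 := by
  have hI := integral_sechPow_sq_pos (sidx_pos hp) (kap_pos hp)
  have hA : 0 < ampl p ^ ((p + 1) / 2) := Real.rpow_pos_of_pos (ampl_pos hp) _
  have h1 : ∫ z : Cyl, (soliton p (omegaP p) z.1 ^ ((p + 1) / 2) * cosT z.2) ^ 2 =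
      (ampl p ^ ((p + 1) / 2)) ^ 2 * (∫ x, sechPow (sidx p) (kap p) x ^ 2) * Real.pi := by
    have e : ∀ z : Cyl, (soliton p (omegaP p) z.1 ^ ((p + 1) / 2) * cosT z.2) ^ 2 =
        ((ampl p ^ ((p + 1) / 2)) ^ 2 * sechPow (sidx p) (kap p) z.1 ^ 2) * cosN 1 z.2 ^ 2 :=
      fun z => by rw [soliton_rpow_half hp, cosT_eq]; ring
    simp only [e]
    refine (integral_prod_mul (fun x => (ampl p ^ ((p + 1) / 2)) ^ 2 *
      sechPow (sidx p) (kap p) x ^ 2) (fun y => cosN 1 y ^ 2)).trans ?_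
    rw [integral_const_mul, integral_cosN_sq one_ne_zero]
  have h2 : 0 < (ampl p ^ ((p + 1) / 2)) ^ 2 * (∫ x, sechPow (sidx p) (kap p) x ^ 2) * Real.pi := by
    have := Real.pi_pos
    positivity
  rw [psiAmpl, div_pow, Real.sq_sqrt (h1 ▸ h2.le), h1, div_mul_eq_mul_div, div_mul_eq_mul_div,
    div_self h2.ne']

theorem psiAmpl_ne_zero {p : ℝ} (hp : 1 < p) : psiAmpl p ≠ 0 := fun h => by
  have := psiAmpl_sq hp
  simp [h] at this

/-- The soliton as a profile. -/
def solP {p : ℝ} (hp : 1 < p) : Prof := ⟨soliton p (omegaP p), isProf_soliton hp⟩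

/-- `ψ` as a profile. -/
def psiP {p : ℝ} (hp : 1 < p) : Prof := ⟨psi p (omegaP p), isProf_psi hp⟩

/-- `ψ cos y` in `L²`. -/
def psiL {p : ℝ} (hp : 1 < p) : L2 := prodL (cosC 1) (prof0 (psiP hp))

theorem coeFn_psiL {p : ℝ} (hp : 1 < p) : psiL hp =ᵐ[volume] psiCos p := by
  refine (coeFn_prodL _ _).trans (.of_forall fun z => ?_)
  rw [psiCos, cosT_eq]; rfl

theorem integral_psi_sq {p : ℝ} (hp : 1 < p) :
    (∫ x, psi p (omegaP p) x ^ 2) * Real.pi = 1 := by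
  rw [← psiAmpl_sq hp, ← integral_const_mul]
  simp only [psi_eq hp, mul_pow]

theorem norm_psiL {p : ℝ} (hp : 1 < p) : ‖psiL hp‖ = 1 := by
  have h : ‖psiL hp‖ ^ 2 = 1 := by
    rw [psiL, norm_prodL_sq]
    change (∫ x, psi p (omegaP p) x ^ 2) * (∫ y, cosN 1 y ^ 2) = 1
    rw [integral_cosN_sq one_ne_zero, integral_psi_sq hp]
  nlinarith [norm_nonneg (psiL hp)]

theorem psiL_mem_Ls {p : ℝ} (hp : 1 < p) : psiL hp ∈ Ls := mode_mem_Hs 1 (psiP hp)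

theorem pairing_eq {p : ℝ} (hp : 1 < p) {f : L2} {g : Cyl → ℝ} (h : g =ᵐ[volume] f) :
    pairing p g = ⟪f, psiL hp⟫_ℝ := by
  rw [pairing, L2.inner_def]
  refine integral_congr_ae ?_
  filter_upwards [h, coeFn_psiL hp] with z h1 h2
  rw [h1, h2]
  simp [mul_comm]

/-! ### Multiplication operators -/

theorem memLp_mul_bcf (w : Cyl →ᵇ ℝ) (f : L2) : MemLp (fun z => w z * f z) 2 volume := by
  refine MemLp.of_le_mul (Lp.memLp f)
    (w.continuous.aestronglyMeasurable.mul (Lp.aestronglyMeasurable f)) (c := ‖w‖)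
    (.of_forall fun z => ?_)
  rw [norm_mul]
  gcongr
  exact w.norm_coe_le_norm z

/-- Multiplication of `L²` functions by bounded continuous functions. -/
def mulL : (Cyl →ᵇ ℝ) →L[ℝ] L2 →L[ℝ] L2 :=
  LinearMap.mkContinuous₂
    (LinearMap.mk₂ ℝ (fun w f => (memLp_mul_bcf w f).toLp _)
      (fun w v f => by
        rw [← MemLp.toLp_add]
        exact MemLp.toLp_congr _ _ (.of_forall fun z => add_mul _ _ _))
      (fun c w f => by
        rw [← MemLp.toLp_const_smul]
        exact MemLp.toLp_congr _ _ (.of_forall fun z => mul_assoc _ _ _))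
      (fun w f g => by
        rw [← MemLp.toLp_add]
        refine MemLp.toLp_congr _ _ ?_
        filter_upwards [Lp.coeFn_add f g] with z hz
        rw [hz]; exact mul_add _ _ _)
      (fun c w f => by
        rw [← MemLp.toLp_const_smul]
        refine MemLp.toLp_congr _ _ ?_
        filter_upwards [Lp.coeFn_smul c f] with z hz
        rw [hz]; exact mul_left_comm _ _ _)) 1 fun w f => by
    rw [one_mul]
    refine Lp.norm_le_mul_norm_of_ae_le_mul ?_
    filter_upwards [(memLp_mul_bcf w f).coeFn_toLp] with z hz
    rw [LinearMap.mk₂_apply, hz, norm_mul]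
    gcongr
    exact w.norm_coe_le_norm z

theorem coeFn_mulL (w : Cyl →ᵇ ℝ) (f : L2) : mulL w f =ᵐ[volume] fun z => w z * f z :=
  (memLp_mul_bcf w f).coeFn_toLp

theorem inner_mulL (w : Cyl →ᵇ ℝ) (f g : L2) : ⟪mulL w f, g⟫_ℝ = ⟪f, mulL w g⟫_ℝ := by
  rw [L2.inner_def, L2.inner_def]
  refine integral_congr_ae ?_
  filter_upwards [coeFn_mulL w f, coeFn_mulL w g] with z h1 h2
  rw [h1, h2]
  simp only [RCLike.inner_apply, conj_trivial]
  ring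

theorem mulL_mem_Ls {w : Cyl →ᵇ ℝ} (hx : ∀ᵐ z : Cyl, w z = w (-z.1, z.2))
    (hy : ∀ᵐ z : Cyl, w z = w (z.1, -z.2)) {f : L2} (hf : f ∈ Ls) : mulL w f ∈ Ls := by
  rw [mem_Ls_iff] at hf ⊢
  have h0 := coeFn_mulL w f
  constructor
  · filter_upwards [h0, measurePreserving_reflX.quasiMeasurePreserving.ae h0, hf.1, hx]
      with z h1 h2 h3 h4
    rw [h1, h2, ← h3, ← h4]
  · filter_upwards [h0, measurePreserving_reflY.quasiMeasurePreserving.ae h0, hf.2, hy]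
      with z h1 h2 h3 h4
    rw [h1, h2, ← h3, ← h4]

/-! ### The linearized operator -/

theorem continuous_potl (p : ℝ) : Continuous (potl p) :=
  continuous_const.mul (continuous_const.sub ((continuous_tanh_mul (kap p)).pow 2))

/-- The potential as a bounded continuous function. -/
def potB (p : ℝ) : Cyl →ᵇ ℝ :=
  BoundedContinuousFunction.ofNormedAddCommGroup (fun z => potl p z.1)
    ((continuous_potl p).comp continuous_fst) |sidx p * (sidx p + 1) * kap p ^ 2| fun z => by
      rw [potl, norm_mul, Real.norm_eq_abs, Real.norm_eq_abs]
      refine mul_le_of_le_one_right (abs_nonneg _) ?_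
      rw [abs_of_nonneg (tanh_sq_bound _ _)]
      linarith [sq_nonneg (Real.tanh (kap p * z.1))]

theorem potB_apply (p : ℝ) (z : Cyl) : potB p z = potl p z.1 := rfl

theorem potl_neg (p x : ℝ) : potl p (-x) = potl p x := by
  simp [potl, Real.tanh_neg]

/-- `f ↦ V f - ⟨f, ψ cos y⟩ ψ cos y`. -/
def linB {p : ℝ} (hp : 1 < p) : L2 →L[ℝ] L2 :=
  mulL (potB p) - (innerSL ℝ (psiL hp)).smulRight (psiL hp)

theorem linB_apply {p : ℝ} (hp : 1 < p) (f : L2) :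
    linB hp f = mulL (potB p) f - ⟪psiL hp, f⟫_ℝ • psiL hp := rfl

theorem linB_mem_Ls {p : ℝ} (hp : 1 < p) {f : L2} (hf : f ∈ Ls) : linB hp f ∈ Ls := by
  rw [linB_apply]
  exact Ls.sub_mem (mulL_mem_Ls (.of_forall fun z => by simp [potB_apply, potl_neg])
    (.of_forall fun z => by simp [potB_apply]) hf) (Ls.smul_mem _ (psiL_mem_Ls hp))

theorem inner_linB {p : ℝ} (hp : 1 < p) (f g : L2) : ⟪linB hp f, g⟫_ℝ = ⟪f, linB hp g⟫_ℝ := by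
  rw [linB_apply, linB_apply, inner_sub_left, inner_sub_right, inner_mulL, inner_smul_left,
    inner_smul_right, real_inner_comm f]
  simp only [conj_trivial]
  ring

/-- The Pöschl–Teller operator on profiles. -/
def ptD (p : ℝ) (g : Prof) : DecC :=
  ⟨ptOp (sidx p) (kap p) g, g.2.continuous_ptOp, g.2.dec_ptOp⟩

theorem helm_sub_mulL_mode {p : ℝ} (hp : 1 < p) (n : ℕ) (g : Prof) :
    helm (omegaP p) (mode n g) - mulL (potB p) (mode n g).fn =
      prodL (cosC n) (ptD p g + ((n : ℝ) ^ 2 - 1) • prof0 g) := by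
  rw [helm_mode]
  refine Lp.ext ?_
  filter_upwards [Lp.coeFn_sub (prodL (cosC n) (-prof2 g + ((n : ℝ) ^ 2 + omegaP p) • prof0 g))
    (mulL (potB p) (mode n g).fn), coeFn_prodL (cosC n)
    (-prof2 g + ((n : ℝ) ^ 2 + omegaP p) • prof0 g), coeFn_mulL (potB p) (mode n g).fn,
    coeFn_prodL (cosC n) (prof0 g), coeFn_prodL (cosC n) (ptD p g + ((n : ℝ) ^ 2 - 1) • prof0 g)]
    with z h1 h2 h3 h4 h5
  rw [h1, Pi.sub_apply, h2, h3, h5]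
  change _ - potl p z.1 * (prodL (cosC n) (prof0 g)) z = _
  rw [h4]
  change (-deriv (deriv (g : ℝ → ℝ)) z.1 + ((n : ℝ) ^ 2 + omegaP p) * (g : ℝ → ℝ) z.1) * cosN n z.2
    - potl p z.1 * ((g : ℝ → ℝ) z.1 * cosN n z.2) =
    (ptOp (sidx p) (kap p) g z.1 + ((n : ℝ) ^ 2 - 1) * (g : ℝ → ℝ) z.1) * cosN n z.2
  rw [ptOp, sidx_sq_mul hp, potl]
  ring

theorem ptOp_psi {p : ℝ} (hp : 1 < p) (x : ℝ) :
    ptOp (sidx p) (kap p) (psi p (omegaP p)) x = 0 := by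
  obtain ⟨hP, -, h4⟩ := isProf_sechPow (sidx_pos hp) (kap_pos hp)
  have e : psi p (omegaP p) = fun x => psiAmpl p * sechPow (sidx p) (kap p) x := funext (psi_eq hp)
  have e1 : deriv (psi p (omegaP p)) =
      fun x => psiAmpl p * deriv (sechPow (sidx p) (kap p)) x := by
    rw [e]; exact funext fun x => ((hP.hasDerivAt x).const_mul _).deriv
  have e2 : deriv (deriv (psi p (omegaP p))) x =
      psiAmpl p * deriv (deriv (sechPow (sidx p) (kap p))) x := by
    rw [e1]; exact ((hP.hasDerivAt' x).const_mul _).deriv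
  rw [ptOp, e2, h4, psi_eq hp]
  ring

/-- In the first mode the operator `N + ψ ⊗ ψ` is bounded below by one. -/
theorem ptOp_add_proj_ge {p : ℝ} (hp : 1 < p) {g : ℝ → ℝ} (hg : IsProf g) :
    ∫ x, g x ^ 2 ≤ ∫ x, (ptOp (sidx p) (kap p) g x +
      (Real.pi * ∫ t, g t * psi p (omegaP p) t) * psi p (omegaP p) x) ^ 2 := by
  set N := ptOp (sidx p) (kap p) with hN
  set ψ := psi p (omegaP p) with hψ
  have Hψ : IsProf ψ := isProf_psi hp
  set α := Real.pi * ∫ t, g t * ψ t with hα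
  -- Split off the component along `ψ`: `N` has a gap on `h`, and the rank-one term acts as the
  -- identity on `ψ` because `π∫ψ² = 1`. The cross terms vanish, so the two bounds add.
  set h : ℝ → ℝ := g + (-α) • ψ with hh
  have Hh : IsProf h := hg.add (Hψ.smul _)
  have hh' : ∀ x, h x = g x - α * ψ x := fun x => by simp [hh]; ring
  have eψ : ∀ x, ψ x = psiAmpl p * sechPow (sidx p) (kap p) x := psi_eq hp
  have Iψ : (∫ x, ψ x ^ 2) * Real.pi = 1 := integral_psi_sq hp
  have igψ : Integrable (fun x => g x * ψ x) := hg.integrable_mul Hψ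
  have hort : ∫ x, h x * ψ x = 0 := by
    have : ∀ x, h x * ψ x = g x * ψ x - α * ψ x ^ 2 := fun x => by rw [hh']; ring
    simp only [this]
    rw [integral_sub igψ (Hψ.integrable_sq.const_mul _), integral_const_mul, hα]
    linear_combination (-(∫ t, g t * ψ t)) * Iψ
  have hort' : ∫ x, h x * sechPow (sidx p) (kap p) x = 0 := by
    have : ∀ x, h x * ψ x = psiAmpl p * (h x * sechPow (sidx p) (kap p) x) := fun x => by
      rw [eψ]; ring
    simp only [this] at hort
    rw [integral_const_mul] at hort
    exact (mul_eq_zero.1 hort).resolve_left (psiAmpl_ne_zero hp)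
  have Nort : ∀ {k : ℝ → ℝ}, IsProf k → ∫ x, N k x * ψ x = 0 := fun {k} hk => by
    have : ∀ x, N k x * ψ x = psiAmpl p * (N k x * sechPow (sidx p) (kap p) x) := fun x => by
      rw [eψ]; ring
    simp only [this]
    rw [integral_const_mul, integral_ptOp_mul_sechPow hk (sidx_pos hp) (kap_pos hp), mul_zero]
  have Nψ : ∀ x, N ψ x = 0 := ptOp_psi hp
  have Nh : ∀ x, N h x = N g x := fun x => by
    have e2 : deriv (deriv h) x = deriv (deriv g) x - α * deriv (deriv ψ) x := by
      have e1 : deriv h = fun x => deriv g x - α * deriv ψ x := by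
        have : h = fun x => g x - α * ψ x := funext hh'
        rw [this]
        exact funext fun x => ((hg.hasDerivAt x).sub ((Hψ.hasDerivAt x).const_mul _)).deriv
      rw [e1]; exact ((hg.hasDerivAt' x).sub ((Hψ.hasDerivAt' x).const_mul _)).deriv
    have := Nψ x
    rw [hN, ptOp] at this
    rw [hN, ptOp, ptOp, e2, hh']
    linear_combination -α * this
  have gap : ∫ x, h x ^ 2 ≤ ∫ x, N h x * h x :=
    ptOp_gap Hh (sidx_pos hp) (kap_pos hp) (kap_gap hp) hort'
  have iN : Integrable (fun x => N h x ^ 2) := Hh.dec_ptOp.sq.integrable (Hh.continuous_ptOp.pow 2)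
  have iNh : Integrable (fun x => N h x * h x) :=
    (Hh.dec_ptOp.mul Hh.dec).integrable (Hh.continuous_ptOp.mul Hh.cont)
  have iNψ : Integrable (fun x => N g x * ψ x) :=
    (hg.dec_ptOp.mul Hψ.dec).integrable (hg.continuous_ptOp.mul Hψ.cont)
  have gap2 : ∫ x, h x ^ 2 ≤ ∫ x, N h x ^ 2 := by
    have h1 : 0 ≤ ∫ x, (N h x - h x) ^ 2 := integral_nonneg fun x => sq_nonneg _
    have h2 : ∫ x, (N h x - h x) ^ 2 =
        (∫ x, N h x ^ 2) + ((-2) * (∫ x, N h x * h x) + 1 * ∫ x, h x ^ 2) := by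
      rw [← integral_add_mul_add_mul iN iNh Hh.integrable_sq]
      exact integral_congr_ae (.of_forall fun x => by ring)
    linarith
  have e1 : ∫ x, g x ^ 2 = (∫ x, h x ^ 2) + (2 * α * (∫ x, h x * ψ x) + α ^ 2 * ∫ x, ψ x ^ 2) := by
    rw [← integral_add_mul_add_mul Hh.integrable_sq (Hh.integrable_mul Hψ) Hψ.integrable_sq]
    exact integral_congr_ae (.of_forall fun x => by simp only [hh']; ring)
  have e2 : ∫ x, (N g x + α * ψ x) ^ 2 =
      (∫ x, N h x ^ 2) + (2 * α * (∫ x, N g x * ψ x) + α ^ 2 * ∫ x, ψ x ^ 2) := by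
    rw [← integral_add_mul_add_mul iN iNψ Hψ.integrable_sq]
    exact integral_congr_ae (.of_forall fun x => by simp only [Nh]; ring)
  rw [e1, e2, hort, Nort hg]
  linarith

/-- Fourier modes diagonalize the corrected linearization in `y`; the rank-one correction is seen
only by `n = 1`, where the shift `n² - 1` is zero. -/
theorem helm_sub_linB_mode {p : ℝ} (hp : 1 < p) (n : ℕ) (g : Prof) :
    ∃ G : DecC, helm (omegaP p) (mode n g) - linB hp (mode n g).fn = prodL (cosC n) G ∧
      ((n ≠ 1 ∧ G = ptD p g + ((n : ℝ) ^ 2 - 1) • prof0 g) ∨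
      (n = 1 ∧ G = ptD p g +
        (Real.pi * ∫ t, (g : ℝ → ℝ) t * psi p (omegaP p) t) • prof0 (psiP hp))) := by
  have e : helm (omegaP p) (mode n g) - linB hp (mode n g).fn =
      prodL (cosC n) (ptD p g + ((n : ℝ) ^ 2 - 1) • prof0 g) +
        ⟪psiL hp, (mode n g).fn⟫_ℝ • psiL hp := by
    rw [← helm_sub_mulL_mode hp, linB_apply]; abel
  have e2 : ⟪psiL hp, (mode n g).fn⟫_ℝ =
      ⟪prodL (cosC n) (prof0 g), prodL (cosC 1) (prof0 (psiP hp))⟫_ℝ :=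
    real_inner_comm _ _
  rcases eq_or_ne n 1 with rfl | hn
  · refine ⟨_, ?_, Or.inr ⟨rfl, rfl⟩⟩
    have h1 : (∫ y, cosC 1 y * cosC 1 y) = Real.pi :=
      (integral_congr_ae (.of_forall fun y => (pow_two (cosN 1 y)).symm)).trans
        (integral_cosN_sq one_ne_zero)
    have h2 : ⟪psiL hp, (mode 1 g).fn⟫_ℝ = Real.pi * ∫ t, (g : ℝ → ℝ) t * psi p (omegaP p) t := by
      refine e2.trans ((inner_prodL _ _ _ _).trans ?_)
      rw [h1]
      exact mul_comm _ _
    rw [e, h2, map_add, map_add, map_smul, map_smul]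
    have h3 : ((1 : ℕ) : ℝ) ^ 2 - 1 = 0 := by norm_num
    rw [h3, zero_smul, add_zero]
    rfl
  · refine ⟨_, ?_, Or.inl ⟨hn, rfl⟩⟩
    rw [e, e2, inner_cos_cos hn, zero_smul, add_zero]

/-- Three cases: for `n = 0` evenness excludes `R'`, for `n = 1` the rank-one term lifts `ψ`, and
for `n ≥ 2` the operator `N ≥ 0` is shifted by at least `3`. -/
theorem exists_linear_mode_ge {p : ℝ} (hp : 1 < p) : ∃ c : ℝ, 0 < c ∧ ∀ n g,
    c * ‖(mode n g).fn‖ ^ 2 ≤ ‖helm (omegaP p) (mode n g) - linB hp (mode n g).fn‖ ^ 2 := by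
  obtain ⟨c, c0, hc⟩ := exists_ptOp_sub_one_ge (one_lt_sidx hp) (kap_pos hp) (kap_gap hp)
  refine ⟨min c 1, lt_min c0 one_pos, fun n g => ?_⟩
  have hK : 0 ≤ ∫ y, cosC n y ^ 2 := integral_nonneg fun y => sq_nonneg _
  have hI : 0 ≤ ∫ x, (g : ℝ → ℝ) x ^ 2 := integral_nonneg fun x => sq_nonneg _
  have hfn : ‖(mode n g).fn‖ ^ 2 = (∫ x, (g : ℝ → ℝ) x ^ 2) * ∫ y, cosC n y ^ 2 :=
    norm_prodL_sq (cosC n) (prof0 g)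
  obtain ⟨G, hG, h⟩ := helm_sub_linB_mode hp n g
  rw [hG, norm_prodL_sq, hfn, ← mul_assoc]
  refine mul_le_mul_of_nonneg_right ?_ hK
  rcases h with ⟨hn, rfl⟩ | ⟨rfl, rfl⟩
  · change _ ≤ ∫ x, (ptOp (sidx p) (kap p) g x + ((n : ℝ) ^ 2 - 1) * (g : ℝ → ℝ) x) ^ 2
    rcases Nat.eq_zero_or_pos n with rfl | hn0
    · have h1 := hc g g.2
      have h2 : min c 1 * ∫ x, (g : ℝ → ℝ) x ^ 2 ≤ c * ∫ x, (g : ℝ → ℝ) x ^ 2 :=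
        mul_le_mul_of_nonneg_right (min_le_left _ _) hI
      have h3 : ((0 : ℕ) : ℝ) ^ 2 - 1 = -1 := by norm_num
      rw [h3]
      exact h2.trans h1
    · have hn2 : (2 : ℝ) ≤ n := by exact_mod_cast (by omega : 2 ≤ n)
      have h1 := ptOp_add_ge (s := sidx p) (κ := kap p) g.2 (μ := (n : ℝ) ^ 2 - 1) (by nlinarith)
      refine le_trans (mul_le_mul_of_nonneg_right ((min_le_right _ _).trans ?_) hI) h1
      have : 1 ≤ (n : ℝ) ^ 2 - 1 := by nlinarith
      nlinarith
  · have h2 : min c 1 * ∫ x, (g : ℝ → ℝ) x ^ 2 ≤ 1 * ∫ x, (g : ℝ → ℝ) x ^ 2 :=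
      mul_le_mul_of_nonneg_right (min_le_right _ _) hI
    rw [one_mul] at h2
    exact h2.trans (ptOp_add_proj_ge hp g.2)

theorem exists_linear_ge {p : ℝ} (hp : 1 < p) : ∃ c : ℝ, 0 < c ∧ ∀ u ∈ Hs,
    c * ‖u.fn‖ ≤ ‖helm (omegaP p) u - linB hp u.fn‖ := by
  obtain ⟨c, c0, hc⟩ := exists_linear_mode_ge hp
  refine ⟨Real.sqrt c, Real.sqrt_pos.2 c0, fun u hu => ?_⟩
  let T : H2 →L[ℝ] L2 := helm (omegaP p) - (linB hp).comp (compL 0)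
  have hT : ∀ u, T u = helm (omegaP p) u - linB hp u.fn := fun _ => rfl
  refine Hs_induction (P := fun u => Real.sqrt c * ‖compL 0 u‖ ≤ ‖T u‖)
    (isClosed_le (continuous_const.mul (compL 0).continuous.norm) T.continuous.norm)
    (fun f => ?_) hu
  refine le_of_sq_le_sq ?_ (norm_nonneg _)
  rw [mul_pow, Real.sq_sqrt c0.le, sumMode_apply, map_sum, map_sum, norm_sum_sq_of_orthogonal,
    norm_sum_sq_of_orthogonal, Finset.mul_sum]
  · exact Finset.sum_le_sum fun n _ => hc n _
  · intro i _ j _ hij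
    obtain ⟨G, hG, -⟩ := helm_sub_linB_mode hp i (f i)
    obtain ⟨G', hG', -⟩ := helm_sub_linB_mode hp j (f j)
    rw [hT, hT, hG, hG', inner_cos_cos hij]
  · intro i _ j _ hij
    rw [compL_mode_zero, compL_mode_zero, inner_cos_cos hij]

/-- The linearized operator, with the kernel direction corrected, is an isomorphism. -/
theorem exists_linear_iso {p : ℝ} (hp : 1 < p) :
    (∃ C : ℝ, ∀ u ∈ Hs, ‖u‖ ≤ C * ‖helm (omegaP p) u - linB hp u.fn‖) ∧
      ∀ f ∈ Ls, ∃ u ∈ Hs, helm (omegaP p) u - linB hp u.fn = f := by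
  obtain ⟨c, c0, hc⟩ := exists_linear_ge hp
  exact exists_helm_sub_eq (omegaP_pos hp) (linB hp) (fun f hf => linB_mem_Ls hp hf)
    (inner_linB hp) c0 hc

/-! ### The nonlinearity -/

theorem hasDerivAt_abs_rpow_mul {p : ℝ} (hp : 1 < p) (t : ℝ) :
    HasDerivAt (fun t : ℝ => |t| ^ (p - 1) * t) (p * |t| ^ (p - 1)) t := by
  rcases lt_trichotomy t 0 with h | rfl | h
  · have h1 : HasDerivAt (fun t : ℝ => -(-t) ^ p) (-(-1 * p * (-t) ^ (p - 1))) t :=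
      ((hasDerivAt_neg t).rpow_const (Or.inl (by linarith))).fun_neg
    refine (h1.congr_deriv ?_).congr_of_eventuallyEq ?_
    · rw [abs_of_neg h]; ring
    · filter_upwards [Iio_mem_nhds h] with x hx
      have hx' : 0 < -x := by simpa using hx
      rw [abs_of_neg hx, Real.rpow_sub_one hx'.ne', div_mul_eq_mul_div, div_eq_iff hx'.ne']
      ring
  · rw [abs_zero, Real.zero_rpow (by linarith), mul_zero, hasDerivAt_iff_tendsto_slope_zero]
    have h1 : Tendsto (fun t : ℝ => |t| ^ (p - 1)) (𝓝[≠] 0) (𝓝 0) := by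
      have : ContinuousAt (fun t : ℝ => |t| ^ (p - 1)) 0 :=
        continuous_abs.continuousAt.rpow_const (Or.inr (by linarith))
      have h2 := this.tendsto
      rw [abs_zero, Real.zero_rpow (by linarith)] at h2
      exact h2.mono_left nhdsWithin_le_nhds
    refine h1.congr' ?_
    filter_upwards [self_mem_nhdsWithin] with x hx
    have hx : x ≠ 0 := hx
    simp only [zero_add, mul_zero, sub_zero, smul_eq_mul]
    field_simp
  · have h1 : HasDerivAt (fun t : ℝ => t ^ p) (p * t ^ (p - 1)) t :=
      Real.hasDerivAt_rpow_const (Or.inl h.ne')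
    refine (h1.congr_deriv ?_).congr_of_eventuallyEq ?_
    · rw [abs_of_pos h]
    · filter_upwards [Ioi_mem_nhds h] with x hx
      have hx : 0 < x := hx
      rw [abs_of_pos hx, Real.rpow_sub_one hx.ne']
      field_simp

theorem continuous_abs_rpow {p : ℝ} (hp : 1 < p) : Continuous (fun t : ℝ => |t| ^ (p - 1)) :=
  continuous_abs.rpow_const fun _ => Or.inr (by linarith)

theorem exists_modulus {f : ℝ → ℝ} (hf : Continuous f) (M : ℝ) {ε : ℝ} (hε : 0 < ε) :
    ∃ δ > 0, ∀ a b : ℝ, |a| ≤ M → |b| ≤ M → |a - b| < δ → |f a - f b| < ε := by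
  have h := (isCompact_Icc (a := -M) (b := M)).uniformContinuousOn_of_continuous hf.continuousOn
  obtain ⟨δ, hδ, h⟩ := Metric.uniformContinuousOn_iff.1 h ε hε
  exact ⟨δ, hδ, fun a b ha hb hab => h a (abs_le.1 ha) b (abs_le.1 hb) hab⟩

/-- The mean value inequality for `t ↦ |t|^{p-1}t - p|a|^{p-1}t`. Only uniform continuity of
`|t|^{p-1}` on bounded sets is needed, so every `p > 1` is covered. -/
theorem exists_taylor {p : ℝ} (hp : 1 < p) (M : ℝ) {ε : ℝ} (hε : 0 < ε) :
    ∃ δ > 0, ∀ a b : ℝ, |a| ≤ M → |b| < δ →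
      |(|a + b| ^ (p - 1) * (a + b)) - |a| ^ (p - 1) * a - p * |a| ^ (p - 1) * b| ≤ ε * |b| := by
  obtain ⟨δ, hδ, h⟩ := exists_modulus ((continuous_abs_rpow hp).const_mul p) (M + 1) hε
  refine ⟨min δ 1, lt_min hδ one_pos, fun a b ha hb => ?_⟩
  have hb1 := hb.trans_le (min_le_left _ _)
  have hb2 := hb.trans_le (min_le_right _ _)
  have hd : ∀ t ∈ uIcc a (a + b), HasDerivWithinAt
      (fun t => |t| ^ (p - 1) * t - p * |a| ^ (p - 1) * t)
      (p * |t| ^ (p - 1) - p * |a| ^ (p - 1)) (uIcc a (a + b)) t := fun t _ =>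
    (((hasDerivAt_abs_rpow_mul hp t).sub ((hasDerivAt_id t).const_mul _)).congr_deriv
      (by simp)).hasDerivWithinAt
  have hbd : ∀ t ∈ uIcc a (a + b), ‖p * |t| ^ (p - 1) - p * |a| ^ (p - 1)‖ ≤ ε := fun t ht => by
    have h1 : |t - a| ≤ |b| := by
      have := abs_sub_left_of_mem_uIcc ht
      simpa using this
    refine (h t a ?_ (by linarith) (h1.trans_lt hb1)).le
    have : |t| ≤ |t - a| + |a| := by simpa using abs_add_le (t - a) a
    linarith
  have := (convex_uIcc a (a + b)).norm_image_sub_le_of_norm_hasDerivWithin_le hd hbd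
    left_mem_uIcc right_mem_uIcc
  rw [add_sub_cancel_left, Real.norm_eq_abs, Real.norm_eq_abs] at this
  refine le_trans (le_of_eq ?_) this
  congr 1; ring

/-- `|w|^{p-1}` as a bounded continuous function. -/
def absPow {p : ℝ} (hp : 1 < p) (w : C₀(Cyl, ℝ)) : Cyl →ᵇ ℝ :=
  BoundedContinuousFunction.ofNormedAddCommGroup (fun z => |w z| ^ (p - 1))
    ((continuous_abs_rpow hp).comp w.continuous) (‖w‖ ^ (p - 1)) fun z => by
      rw [Real.norm_of_nonneg (Real.rpow_nonneg (abs_nonneg _) _)]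
      exact Real.rpow_le_rpow (abs_nonneg _) (C0_abs_le w z) (by linarith)

theorem absPow_apply {p : ℝ} (hp : 1 < p) (w : C₀(Cyl, ℝ)) (z : Cyl) :
    absPow hp w z = |w z| ^ (p - 1) := rfl

theorem continuous_absPow {p : ℝ} (hp : 1 < p) : Continuous (absPow hp) := by
  rw [Metric.continuous_iff]
  intro w ε hε
  obtain ⟨δ, hδ, h⟩ := exists_modulus (continuous_abs_rpow hp) (‖w‖ + 1) (half_pos hε)
  refine ⟨min δ 1, lt_min hδ one_pos, fun v hv => ?_⟩
  rw [dist_eq_norm] at hv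
  refine lt_of_le_of_lt ((BoundedContinuousFunction.dist_le (half_pos hε).le).2 fun z => ?_)
    (half_lt_self hε)
  have h1 : |v z - w z| ≤ ‖v - w‖ := C0_abs_le (v - w) z
  have h2 := C0_abs_le w z
  have h3 : |v z| ≤ |v z - w z| + |w z| := by simpa using abs_add_le (v z - w z) (w z)
  have h4 := hv.trans_le (min_le_right _ _)
  exact (h (v z) (w z) (by linarith) (by linarith)
    (h1.trans_lt (hv.trans_le (min_le_left _ _)))).le

/-- The superposition operator `u ↦ |u|^{p-1}u`. -/
def nem {p : ℝ} (hp : 1 < p) (u : HS) : L2 := mulL (absPow hp (embC u)) (HS.fn u)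

theorem coeFn_nem {p : ℝ} (hp : 1 < p) (u : HS) :
    nem hp u =ᵐ[volume] fun z => |embC u z| ^ (p - 1) * embC u z := by
  filter_upwards [coeFn_mulL (absPow hp (embC u)) (HS.fn u), embC_ae u] with z h1 h2
  rw [nem, h1, h2, absPow_apply]

/-- The derivative of the superposition operator. -/
def nemD {p : ℝ} (hp : 1 < p) (u : HS) : HS →L[ℝ] L2 :=
  p • (mulL (absPow hp (embC u))).comp HS.fn

theorem coeFn_nemD {p : ℝ} (hp : 1 < p) (u v : HS) :
    nemD hp u v =ᵐ[volume] fun z => p * |embC u z| ^ (p - 1) * embC v z := by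
  filter_upwards [coeFn_mulL (absPow hp (embC u)) (HS.fn v), embC_ae v,
    Lp.coeFn_smul p (mulL (absPow hp (embC u)) (HS.fn v))] with z h1 h2 h3
  change (p • mulL (absPow hp (embC u)) (HS.fn v) : L2) z = _
  rw [h3, Pi.smul_apply, h1, h2, absPow_apply, smul_eq_mul, mul_assoc]

theorem continuous_nemD {p : ℝ} (hp : 1 < p) : Continuous (nemD hp) := by
  have h1 : Continuous fun u : HS => mulL (absPow hp (embC u)) :=
    mulL.continuous.comp ((continuous_absPow hp).comp embC.continuous)
  exact (h1.clm_comp continuous_const).const_smul p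

/-- The Sobolev embedding makes `v` uniformly small, so the scalar Taylor estimate holds pointwise
with one `ε` and integrates to an `L²` estimate. -/
theorem hasFDerivAt_nem {p : ℝ} (hp : 1 < p) (u : HS) : HasFDerivAt (nem hp) (nemD hp u) u := by
  rw [hasFDerivAt_iff_isLittleO_nhds_zero, Asymptotics.isLittleO_iff]
  intro ε hε
  obtain ⟨δ, hδ, h⟩ := exists_taylor hp ‖embC u‖ hε
  have hc : Tendsto (fun v : HS => ‖embC v‖) (𝓝 0) (𝓝 0) := by
    have := embC.continuous.norm.tendsto 0
    simpa using this
  filter_upwards [hc.eventually (gt_mem_nhds hδ)] with v hv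
  have h1 : ‖nem hp (u + v) - nem hp u - nemD hp u v‖ ≤ ε * ‖HS.fn v‖ := by
    refine Lp.norm_le_mul_norm_of_ae_le_mul ?_
    filter_upwards [Lp.coeFn_sub (nem hp (u + v) - nem hp u) (nemD hp u v),
      Lp.coeFn_sub (nem hp (u + v)) (nem hp u), coeFn_nem hp (u + v), coeFn_nem hp u,
      coeFn_nemD hp u v, embC_ae v] with z h1 h2 h3 h4 h5 h6
    rw [h1, Pi.sub_apply, h2, Pi.sub_apply, h3, h4, h5, h6, map_add,
      ZeroAtInftyContinuousMap.add_apply]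
    exact h _ _ (C0_abs_le _ z) ((C0_abs_le _ z).trans_lt hv)
  refine h1.trans ?_
  gcongr
  exact (H2.norm_fn_le _).trans (HS.norm_val v).le

theorem contDiff_nem {p : ℝ} (hp : 1 < p) : ContDiff ℝ 1 (nem hp) :=
  contDiff_one_iff_hasFDerivAt.2 ⟨nemD hp, continuous_nemD hp, hasFDerivAt_nem hp⟩

theorem nem_mem_Ls {p : ℝ} (hp : 1 < p) (u : HS) : nem hp u ∈ Ls := by
  have h := mem_Ls_iff.1 (mem_Hs_iff.1 (HS.val_mem u))
  have h0 : (HS.val u).fn =ᵐ[volume] embC u := embC_ae u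
  refine mulL_mem_Ls ?_ ?_ (HS.val_mem u)
  · filter_upwards [h.1, h0, measurePreserving_reflX.quasiMeasurePreserving.ae h0] with z h1 h2 h3
    rw [absPow_apply, absPow_apply, ← h2, ← h3, h1]
  · filter_upwards [h.2, h0, measurePreserving_reflY.quasiMeasurePreserving.ae h0] with z h1 h2 h3
    rw [absPow_apply, absPow_apply, ← h2, ← h3, h1]

/-! ### The implicit function theorem for the auxiliary equation -/

/-- The implicit function theorem in the form needed later: uniqueness in a fixed ball for `h`,
uniform in the parameters, with `η` staying inside that ball. The sup metric on the product splits
the neighbourhood into balls. -/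
theorem exists_implicit {E F : Type*} [NormedAddCommGroup E] [NormedSpace ℝ E] [CompleteSpace E]
    [NormedAddCommGroup F] [NormedSpace ℝ F] [CompleteSpace F] {f : (ℝ × ℝ) × E → F}
    (hf : ContDiff ℝ 1 f) {q₀ : ℝ × ℝ} (h0 : f (q₀, 0) = 0) {T : E →L[ℝ] F}
    (hT : HasFDerivAt (fun h => f (q₀, h)) T 0) (hinj : Function.Injective T)
    (hsurj : Function.Surjective T) :
    ∃ (η : ℝ × ℝ → E) (ρ r : ℝ), 0 < ρ ∧ 0 < r ∧ ContDiffOn ℝ 1 η (Metric.ball q₀ ρ) ∧ η q₀ = 0 ∧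
      ∀ q ∈ Metric.ball q₀ ρ, ‖η q‖ < r ∧ ∀ h, ‖h‖ < r → (f (q, h) = 0 ↔ h = η q) := by
  have hcd : ContDiffAt ℝ 1 f (q₀, 0) := hf.contDiffAt
  have hTe : fderiv ℝ f (q₀, 0) ∘L .inr ℝ (ℝ × ℝ) E = T := by
    have h1 : HasFDerivAt (fun h : E => (q₀, h)) (ContinuousLinearMap.inr ℝ (ℝ × ℝ) E) 0 :=
      hasFDerivAt_prodMk_right q₀ 0
    exact ((hcd.differentiableAt one_ne_zero).hasFDerivAt.comp (0 : E) h1).unique hT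
  have hinv : (fderiv ℝ f (q₀, 0) ∘L .inr ℝ (ℝ × ℝ) E).IsInvertible := by
    rw [hTe]
    exact ⟨ContinuousLinearEquiv.ofBijective T (LinearMap.ker_eq_bot.2 hinj)
      (LinearMap.range_eq_top.2 hsurj), ContinuousLinearEquiv.coe_ofBijective _ _ _⟩
  set η := hcd.implicitFunction one_ne_zero hinv
  have e0 : η q₀ = 0 := hcd.implicitFunction_apply_self one_ne_zero hinv
  have e1 := hcd.eventually_apply_eq_iff_implicitFunction one_ne_zero hinv
  have e2 : ContDiffAt ℝ 1 η q₀ := hcd.contDiffAt_implicitFunction one_ne_zero hinv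
  rw [Metric.eventually_nhds_iff] at e1
  obtain ⟨r, hr, e1⟩ := e1
  have e3 : ∀ᶠ q in 𝓝 q₀, ContDiffAt ℝ 1 η q := e2.eventually (by simp)
  have e4 : ∀ᶠ q in 𝓝 q₀, ‖η q‖ < r := by
    have := e2.continuousAt.norm.tendsto
    rw [e0, norm_zero] at this
    exact this.eventually (gt_mem_nhds hr)
  obtain ⟨ρ, hρ, h⟩ := Metric.eventually_nhds_iff.1 (e3.and e4)
  refine ⟨η, min ρ r, r, lt_min hρ hr, hr, fun q hq => ?_, e0, fun q hq => ⟨?_, fun h' hh' => ?_⟩⟩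
  · exact (h (lt_of_lt_of_le hq (min_le_left _ _))).1.contDiffWithinAt
  · exact (h (lt_of_lt_of_le hq (min_le_left _ _))).2
  · have := e1 (y := (q, h')) (by
      rw [Prod.dist_eq]
      exact max_lt (lt_of_lt_of_le hq (min_le_right _ _)) (by simpa using hh'))
    rw [h0] at this
    rw [this, eq_comm]

/-- The orthogonal projection onto the symmetric functions. -/
def projS : L2 →L[ℝ] LS :=
  LinearMap.mkContinuous (Ls.orthogonalProjectionOnto.toLinearMap : L2 →ₗ[ℝ] LS) 1 fun f =>
    (Ls.orthogonalProjectionOnto.le_opNorm f).trans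
      (mul_le_mul_of_nonneg_right Ls.orthogonalProjectionOnto_norm_le (norm_nonneg f))

theorem val_projS {f : L2} (hf : f ∈ Ls) : LS.val (projS f) = f :=
  Ls.starProjection_eq_self_iff.2 hf

theorem projS_eq_zero_iff {f : L2} (hf : f ∈ Ls) : projS f = 0 ↔ f = 0 := by
  rw [← LS.val_injective.eq_iff, val_projS hf, map_zero]

/-- The soliton in `HS`. -/
def solS {p : ℝ} (hp : 1 < p) : HS := modeS 0 (solP hp)

/-- `ψ cos y` in `HS`. -/
def psiS {p : ℝ} (hp : 1 < p) : HS := modeS 1 (psiP hp)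

/-- `𝓕(ω, u)` in `L²`. -/
def resid {p : ℝ} (hp : 1 < p) (ω : ℝ) (u : HS) : L2 := helm 0 (HS.val u) + ω • HS.fn u - nem hp u

theorem helm_eq (ω : ℝ) (u : HS) : helm ω (HS.val u) = helm 0 (HS.val u) + ω • HS.fn u := by
  rw [helm_apply, helm_apply, zero_smul, add_zero]; rfl

theorem resid_eq {p : ℝ} (hp : 1 < p) (ω : ℝ) (u : HS) :
    resid hp ω u = helm ω (HS.val u) - nem hp u := by
  rw [helm_eq]; rfl

theorem resid_mem_Ls {p : ℝ} (hp : 1 < p) (ω : ℝ) (u : HS) : resid hp ω u ∈ Ls := by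
  rw [resid_eq]
  exact Ls.sub_mem (helm_mem_Ls _ (HS.val_mem u)) (nem_mem_Ls hp u)

theorem contDiff_resid {p : ℝ} (hp : 1 < p) {E : Type*} [NormedAddCommGroup E] [NormedSpace ℝ E]
    {ω : E → ℝ} {u : E → HS} (hω : ContDiff ℝ 1 ω) (hu : ContDiff ℝ 1 u) :
    ContDiff ℝ 1 (fun v => resid hp (ω v) (u v)) := by
  have h1 : ContDiff ℝ 1 (fun v => ((helm 0).comp HS.val) (u v)) :=
    ((helm 0).comp HS.val).contDiff.comp hu
  have h2 : ContDiff ℝ 1 (fun v => HS.fn (u v)) := HS.fn.contDiff.comp hu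
  exact (h1.add (hω.smul h2)).sub ((contDiff_nem hp).comp hu)

theorem coeFn_resid {p : ℝ} (hp : 1 < p) (ω : ℝ) (u : HS) :
    resid hp ω u =ᵐ[volume] nlsF p ω (HS.val u) := by
  rw [resid_eq, helm_apply]
  set U := HS.val u with hU
  have h0 : U.fn =ᵐ[volume] embC u := embC_ae u
  filter_upwards [Lp.coeFn_sub (-U.dxx - U.dyy + ω • U.fn) (nem hp u),
    Lp.coeFn_add (-U.dxx - U.dyy) (ω • U.fn), Lp.coeFn_sub (-U.dxx) U.dyy, Lp.coeFn_neg U.dxx,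
    Lp.coeFn_smul ω U.fn, coeFn_nem hp u, h0] with z h1 h2 h3 h4 h5 h6 h7
  rw [h1, Pi.sub_apply, h2, Pi.add_apply, h3, Pi.sub_apply, h4, Pi.neg_apply, h5, Pi.smul_apply, h6,
    ← h7, nlsF, smul_eq_mul]

/-- `R + a ψ cos y + h` in `HS`. -/
def anz {p : ℝ} (hp : 1 < p) (a : ℝ) (h : HS) : HS := solS hp + a • psiS hp + h

theorem embC_anz_apply {p : ℝ} (hp : 1 < p) (a : ℝ) (h : HS) (z : Cyl) :
    embC (anz hp a h) z = soliton p (omegaP p) z.1 + a * psiCos p z + embC h z := by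
  rw [anz, map_add, map_add, map_smul, solS, psiS, embC_modeS, embC_modeS,
    ZeroAtInftyContinuousMap.add_apply, ZeroAtInftyContinuousMap.add_apply,
    ZeroAtInftyContinuousMap.smul_apply, modeC_apply, modeC_apply, cosN_zero, mul_one, psiCos,
    cosT_eq, smul_eq_mul]
  rfl

theorem embC_anz_ae {p : ℝ} (hp : 1 < p) (a : ℝ) (h : HS) :
    embC (anz hp a h) =ᵐ[volume] ansatz p a (HS.val h) := by
  filter_upwards [embC_ae h] with z hz
  rw [embC_anz_apply, ← hz]; rfl

/-! ### The auxiliary equation as an equation on all even functions -/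

/-- The equation solved by the implicit function theorem. -/
def auxG {p : ℝ} (hp : 1 < p) (v : (ℝ × ℝ) × HS) : L2 :=
  resid hp v.1.1 (anz hp v.1.2 v.2) -
    ⟪psiL hp, resid hp v.1.1 (anz hp v.1.2 v.2)⟫_ℝ • psiL hp + ⟪psiL hp, HS.fn v.2⟫_ℝ • psiL hp

theorem auxG_mem_Ls {p : ℝ} (hp : 1 < p) (v : (ℝ × ℝ) × HS) : auxG hp v ∈ Ls :=
  Ls.add_mem (Ls.sub_mem (resid_mem_Ls _ _ _) (Ls.smul_mem _ (psiL_mem_Ls hp)))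
    (Ls.smul_mem _ (psiL_mem_Ls hp))

/-- The projected residual is orthogonal to `ψ cos y` and the added term is parallel to it, so both
vanish separately. One equation on all of `HS` thus encodes the constraint `h ⊥ ψ cos y` together
with the auxiliary equation. -/
theorem auxG_eq_zero_iff {p : ℝ} (hp : 1 < p) (v : (ℝ × ℝ) × HS) :
    auxG hp v = 0 ↔ ⟪psiL hp, HS.fn v.2⟫_ℝ = 0 ∧ resid hp v.1.1 (anz hp v.1.2 v.2) =
      ⟪psiL hp, resid hp v.1.1 (anz hp v.1.2 v.2)⟫_ℝ • psiL hp := by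
  constructor
  · intro h
    have h1 : ⟪psiL hp, auxG hp v⟫_ℝ = ⟪psiL hp, HS.fn v.2⟫_ℝ := by
      rw [auxG, inner_add_right, inner_sub_right, inner_smul_right, inner_smul_right,
        real_inner_self_eq_norm_sq, norm_psiL]
      ring
    rw [h, inner_zero_right] at h1
    rw [auxG, ← h1, zero_smul, add_zero] at h
    exact ⟨h1.symm, sub_eq_zero.1 h⟩
  · rintro ⟨h1, h2⟩
    rw [auxG, h1, zero_smul, add_zero, sub_eq_zero]
    exact h2

/-- The projection `P_⊥` on `L²`. -/
def perpL {p : ℝ} (hp : 1 < p) : L2 →L[ℝ] L2 :=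
  ContinuousLinearMap.id ℝ L2 - (innerSL ℝ (psiL hp)).smulRight (psiL hp)

theorem perpL_apply {p : ℝ} (hp : 1 < p) (f : L2) :
    perpL hp f = f - ⟪psiL hp, f⟫_ℝ • psiL hp := rfl

/-- `h ↦ ⟨h, ψ cos y⟩ ψ cos y`. -/
def corrL {p : ℝ} (hp : 1 < p) : HS →L[ℝ] L2 :=
  ((innerSL ℝ (psiL hp)).smulRight (psiL hp)).comp HS.fn

theorem corrL_apply {p : ℝ} (hp : 1 < p) (h : HS) :
    corrL hp h = ⟪psiL hp, HS.fn h⟫_ℝ • psiL hp := rfl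

theorem auxG_eq {p : ℝ} (hp : 1 < p) (v : (ℝ × ℝ) × HS) :
    auxG hp v = perpL hp (resid hp v.1.1 (anz hp v.1.2 v.2)) + corrL hp v.2 := by
  rw [perpL_apply, corrL_apply, auxG]

theorem contDiff_auxG {p : ℝ} (hp : 1 < p) : ContDiff ℝ 1 (auxG hp) := by
  have h1 : ContDiff ℝ 1 (fun v : (ℝ × ℝ) × HS => anz hp v.1.2 v.2) :=
    (contDiff_const.add (contDiff_fst.snd.smul contDiff_const)).add contDiff_snd
  have h2 : ContDiff ℝ 1 (fun v : (ℝ × ℝ) × HS => resid hp v.1.1 (anz hp v.1.2 v.2)) :=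
    contDiff_resid hp contDiff_fst.fst h1
  have h3 : ContDiff ℝ 1 (fun v : (ℝ × ℝ) × HS => corrL hp v.2) :=
    (corrL hp).contDiff.comp contDiff_snd
  have h4 : ContDiff ℝ 1 (fun v : (ℝ × ℝ) × HS =>
      perpL hp (resid hp v.1.1 (anz hp v.1.2 v.2))) := (perpL hp).contDiff.comp h2
  rw [show auxG hp = _ from funext (auxG_eq hp)]
  exact h4.add h3

theorem solS_fn_ae {p : ℝ} (hp : 1 < p) (z : Cyl) :
    embC (solS hp) z = soliton p (omegaP p) z.1 := by
  rw [solS, embC_modeS, modeC_apply, cosN_zero, mul_one]; rfl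

theorem resid_solS {p : ℝ} (hp : 1 < p) : resid hp (omegaP p) (solS hp) = 0 := by
  have h : helm (omegaP p) (HS.val (solS hp)) =
      prodL (cosC 0) (-prof2 (solP hp) + (((0 : ℕ) : ℝ) ^ 2 + omegaP p) • prof0 (solP hp)) :=
    helm_mode _ _ _
  rw [resid_eq, h, sub_eq_zero]
  refine Lp.ext ?_
  filter_upwards [coeFn_prodL (cosC 0)
    (-prof2 (solP hp) + (((0 : ℕ) : ℝ) ^ 2 + omegaP p) • prof0 (solP hp)), coeFn_nem hp (solS hp)]
    with z h1 h2
  rw [h1, h2, solS_fn_ae, abs_of_pos (soliton_pos hp _)]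
  change (-deriv (deriv (soliton p (omegaP p))) z.1 +
    (((0 : ℕ) : ℝ) ^ 2 + omegaP p) * soliton p (omegaP p) z.1) * cosN 0 z.2 = _
  rw [cosN_zero, soliton_ode hp]
  push_cast
  ring

theorem nemD_solS {p : ℝ} (hp : 1 < p) (v : HS) :
    nemD hp (solS hp) v = mulL (potB p) (HS.fn v) := by
  refine Lp.ext ?_
  filter_upwards [coeFn_nemD hp (solS hp) v, coeFn_mulL (potB p) (HS.fn v), embC_ae v]
    with z h1 h2 h3
  rw [h1, h2, h3, solS_fn_ae, abs_of_pos (soliton_pos hp _), potB_apply, potl_eq hp]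

theorem helm_psiS {p : ℝ} (hp : 1 < p) :
    helm (omegaP p) (HS.val (psiS hp)) = mulL (potB p) (psiL hp) := by
  have h : helm (omegaP p) (HS.val (psiS hp)) - mulL (potB p) (psiL hp) =
      prodL (cosC 1) (ptD p (psiP hp) + (((1 : ℕ) : ℝ) ^ 2 - 1) • prof0 (psiP hp)) :=
    helm_sub_mulL_mode hp 1 (psiP hp)
  have h2 : ptD p (psiP hp) = 0 := Subtype.ext (funext fun x => ptOp_psi hp x)
  rw [← sub_eq_zero, h, h2]
  simp

/-- The linearized operator is orthogonal to the kernel direction. -/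
theorem inner_psiL_linear {p : ℝ} (hp : 1 < p) (v : HS) :
    ⟪psiL hp, helm (omegaP p) (HS.val v) - mulL (potB p) (HS.fn v)⟫_ℝ = 0 := by
  have h := inner_helm_comm (omegaP p) (HS.val v) (HS.val_mem (psiS hp))
  rw [helm_psiS] at h
  rw [real_inner_comm, inner_sub_left, inner_mulL, sub_eq_zero]
  exact h

/-- The linearization of the equation in `h`. -/
def linT {p : ℝ} (hp : 1 < p) : HS →L[ℝ] L2 := (helm (omegaP p)).comp HS.val - (linB hp).comp HS.fn

theorem linT_apply {p : ℝ} (hp : 1 < p) (v : HS) :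
    linT hp v = helm (omegaP p) (HS.val v) - linB hp (HS.fn v) := rfl

theorem linT_mem_Ls {p : ℝ} (hp : 1 < p) (v : HS) : linT hp v ∈ Ls :=
  Ls.sub_mem (helm_mem_Ls _ (HS.val_mem v)) (linB_mem_Ls hp (HS.val_mem v))

/-- The linearization at `R` is symmetric and annihilates `ψ cos y`, so its range is already
orthogonal to `ψ cos y`. The projection therefore disappears and the derivative is the linearization
plus the rank-one term. -/
theorem hasFDerivAt_auxG {p : ℝ} (hp : 1 < p) :
    HasFDerivAt (fun h => auxG hp ((omegaP p, 0), h)) (linT hp) 0 := by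
  have h0 : ∀ h : HS, anz hp 0 h = solS hp + h := fun h => by rw [anz, zero_smul, add_zero]
  have hn : HasFDerivAt (fun h : HS => nem hp (solS hp + h)) (nemD hp (solS hp)) 0 := by
    have h1 := hasFDerivAt_nem hp (solS hp + 0)
    have h2 := h1.comp (0 : HS) ((hasFDerivAt_id (0 : HS)).const_add (solS hp))
    rw [add_zero] at h2
    exact h2
  have hl : HasFDerivAt (fun h : HS => ((helm (omegaP p)).comp HS.val) (solS hp + h))
      ((helm (omegaP p)).comp HS.val) 0 := by
    simp only [map_add]
    exact ((helm (omegaP p)).comp HS.val).hasFDerivAt.const_add _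
  have hr := ((perpL hp).hasFDerivAt.comp (0 : HS) (hl.sub hn)).add
    ((corrL hp).hasFDerivAt (x := 0))
  have e : (perpL hp).comp ((helm (omegaP p)).comp HS.val - nemD hp (solS hp)) + corrL hp =
      linT hp := by
    refine ContinuousLinearMap.ext fun v => ?_
    change perpL hp (helm (omegaP p) (HS.val v) - nemD hp (solS hp) v) + corrL hp v = _
    rw [nemD_solS, perpL_apply, inner_psiL_linear, zero_smul, sub_zero, corrL_apply, linT_apply,
      linB_apply]
    abel
  rw [e] at hr
  refine hr.congr_of_eventuallyEq (.of_forall fun h => ?_)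
  change auxG hp ((omegaP p, 0), h) = perpL hp (helm (omegaP p) (HS.val (solS hp + h)) -
    nem hp (solS hp + h)) + corrL hp h
  rw [auxG_eq, resid_eq, h0]

/-- The family `η` of solutions of the projected equation. -/
theorem exists_eta {p : ℝ} (hp : 1 < p) :
    ∃ (η : ℝ × ℝ → HS) (ρ r : ℝ), 0 < ρ ∧ 0 < r ∧
      ContDiffOn ℝ 1 η (Metric.ball (omegaP p, 0) ρ) ∧ η (omegaP p, 0) = 0 ∧
      ∀ q ∈ Metric.ball ((omegaP p, 0) : ℝ × ℝ) ρ, ‖η q‖ < r ∧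
        ∀ h, ‖h‖ < r → (auxG hp (q, h) = 0 ↔ h = η q) := by
  obtain ⟨⟨C, hC⟩, hsurj⟩ := exists_linear_iso hp
  -- The equation takes values in even functions, so composing with the projection onto them loses
  -- nothing and gives a target on which the derivative is onto.
  let T : HS →L[ℝ] LS := projS.comp (linT hp)
  have hT : ∀ v, LS.val (T v) = linT hp v := fun v => val_projS (linT_mem_Ls hp v)
  have hd : HasFDerivAt (fun h => projS (auxG hp ((omegaP p, 0), h))) T 0 :=
    projS.hasFDerivAt.comp (0 : HS) (hasFDerivAt_auxG hp)
  have hz : ∀ v, projS (auxG hp v) = 0 ↔ auxG hp v = 0 := fun v =>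
    projS_eq_zero_iff (auxG_mem_Ls hp v)
  have h0 : projS (auxG hp ((omegaP p, 0), 0)) = 0 := by
    rw [hz, auxG_eq_zero_iff]
    have : anz hp 0 0 = solS hp := by simp [anz]
    simp [this, resid_solS hp]
  have inj : Function.Injective T := by
    refine (injective_iff_map_eq_zero T).2 fun v hv => ?_
    have h1 : linT hp v = 0 := by rw [← hT, hv, map_zero]
    have h2 := hC (HS.val v) (HS.val_mem v)
    have h3 : helm (omegaP p) (HS.val v) - linB hp (HS.val v).fn = 0 := h1
    rw [h3, norm_zero, mul_zero, HS.norm_val] at h2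
    exact norm_le_zero_iff.1 h2
  have surj : Function.Surjective T := fun f => by
    obtain ⟨u, hu, hue⟩ := hsurj (LS.val f) (LS.val_mem f)
    exact ⟨HS.mk u hu, LS.val_injective ((hT _).trans hue)⟩
  obtain ⟨η, ρ, r, hρ, hr, h1, h2, h3⟩ := exists_implicit
    (f := fun v => projS (auxG hp v)) (projS.contDiff.comp (contDiff_auxG hp)) h0 hd inj surj
  refine ⟨η, ρ, r, hρ, hr, h1, h2, fun q hq => ⟨(h3 q hq).1, fun h hh => ?_⟩⟩
  rw [← hz]
  exact (h3 q hq).2 h hh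

/-- The auxiliary equation in terms of `L²` functions. -/
theorem auxEq_iff {p : ℝ} (hp : 1 < p) (ω a : ℝ) (h : HS) : AuxEq p ω a (HS.val h) ↔
    resid hp ω (anz hp a h) = ⟪psiL hp, resid hp ω (anz hp a h)⟫_ℝ • psiL hp := by
  have key : ∀ u : HS, projPerp p (nlsF p ω (HS.val u)) =ᵐ[volume] 0 ↔
      resid hp ω u = ⟪psiL hp, resid hp ω u⟫_ℝ • psiL hp := fun u => by
    have h1 := coeFn_resid hp ω u
    have h2 := pairing_eq hp h1.symm
    rw [real_inner_comm] at h2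
    have h3 := coeFn_psiL hp
    have h4 := Lp.coeFn_smul ⟪psiL hp, resid hp ω u⟫_ℝ (psiL hp)
    rw [Lp.ext_iff]
    constructor
    · intro h0
      filter_upwards [h0, h1, h3, h4] with z e0 e1 e3 e4
      rw [projPerp, h2, ← e1, ← e3] at e0
      rw [e4, Pi.smul_apply, smul_eq_mul]
      exact sub_eq_zero.1 e0
    · intro h0
      filter_upwards [h0, h1, h3, h4] with z e0 e1 e3 e4
      rw [projPerp, h2, ← e1, ← e3, e0, e4, Pi.smul_apply, smul_eq_mul]
      exact sub_self _
  have hval : (HS.val (anz hp a h)).fn =ᵐ[volume] ansatz p a (HS.val h) :=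
    (embC_ae _).trans (embC_anz_ae hp a h)
  rw [← key]
  constructor
  · rintro ⟨u, hu, h1⟩
    -- The auxiliary equation allows any `H²` element with the prescribed function, but there is
    -- only one.
    have : u = HS.val (anz hp a h) := by
      rw [← sub_eq_zero]
      refine H2.eq_zero_of_fn ?_
      have h2 : u.fn = (HS.val (anz hp a h)).fn := Lp.ext (hu.trans hval.symm)
      exact sub_eq_zero.2 h2
    rwa [this] at h1
  · exact fun h1 => ⟨_, hval, h1⟩

theorem mem_X2_iff {p : ℝ} (hp : 1 < p) (h : H2) :
    h ∈ X2 p ↔ h ∈ Hs ∧ ⟪psiL hp, h.fn⟫_ℝ = 0 := by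
  rw [mem_Hs_iff_mem_H2sym, real_inner_comm, ← pairing_eq hp (EventuallyEq.refl _ _)]
  rfl

/-! ### The half-period shift -/

theorem cosN_add_pi (n : ℕ) (y : Torus) :
    cosN n (y + ((Real.pi : ℝ) : Torus)) = (-1) ^ n * cosN n y := by
  induction y using QuotientAddGroup.induction_on with
  | H t =>
    change cosN n ((t + Real.pi : ℝ) : Torus) = (-1) ^ n * cosN n ((t : ℝ) : Torus)
    rw [cosN_coe, cosN_coe, mul_add, Real.cos_add_nat_mul_pi]

theorem measurePreserving_shift :
    MeasurePreserving (fun z : Cyl => ((z.1, z.2 + ((Real.pi : ℝ) : Torus)) : Cyl)) :=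
  (MeasurePreserving.id (volume : Measure ℝ)).prod (measurePreserving_add_right volume _)

/-- `f(x, y + π)`. -/
def shiftL : L2 →ₗᵢ[ℝ] L2 := Lp.compMeasurePreservingₗᵢ ℝ _ measurePreserving_shift

theorem coeFn_shiftL (f : L2) :
    shiftL f =ᵐ[volume] fun z => f (z.1, z.2 + ((Real.pi : ℝ) : Torus)) :=
  Lp.coeFn_compMeasurePreserving f measurePreserving_shift

theorem shiftL_prodL (n : ℕ) (G : DecC) :
    shiftL (prodL (cosC n) G) = ((-1 : ℝ) ^ n) • prodL (cosC n) G := by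
  refine Lp.ext ?_
  have h := coeFn_prodL (cosC n) G
  filter_upwards [coeFn_shiftL (prodL (cosC n) G), h,
    measurePreserving_shift.quasiMeasurePreserving.ae h,
    Lp.coeFn_smul ((-1 : ℝ) ^ n) (prodL (cosC n) G)] with z h1 h2 h3 h4
  rw [h1, h3, h4, Pi.smul_apply, h2, smul_eq_mul]
  change (G : ℝ → ℝ) z.1 * cosN n (z.2 + ((Real.pi : ℝ) : Torus)) =
    (-1) ^ n * ((G : ℝ → ℝ) z.1 * cosN n z.2)
  rw [cosN_add_pi]; ring

/-- Change the sign of the odd modes. -/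
def altMode (f : ℕ →₀ Prof) : ℕ →₀ Prof :=
  Finsupp.onFinset f.support (fun n => ((-1 : ℝ) ^ n) • f n) fun n hn => by
    rw [Finsupp.mem_support_iff]
    rintro h
    exact hn (by rw [h, smul_zero])

theorem altMode_apply (f : ℕ →₀ Prof) (n : ℕ) : altMode f n = ((-1 : ℝ) ^ n) • f n := rfl

theorem sumMode_altMode (f : ℕ →₀ Prof) :
    sumMode (altMode f) = ∑ n ∈ f.support, ((-1 : ℝ) ^ n) • mode n (f n) := by
  have h : sumMode (altMode f) = (altMode f).sum fun n g => mode n g := rfl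
  rw [h, altMode, Finsupp.onFinset_sum _ fun n => map_zero _]
  exact Finset.sum_congr rfl fun n _ => map_smul _ _ _

theorem sumC_altMode (f : ℕ →₀ Prof) (z : Cyl) :
    sumC (altMode f) z = sumC f (z.1, z.2 + ((Real.pi : ℝ) : Torus)) := by
  have hs : (altMode f).support ⊆ f.support := Finsupp.support_onFinset_subset
  rw [sumC_apply, sumC_apply, Finset.sum_subset hs]
  · refine Finset.sum_congr rfl fun n _ => ?_
    rw [cosN_add_pi, altMode_apply]
    change ((-1) ^ n * (f n : ℝ → ℝ) z.1) * cosN n z.2 = _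
    ring
  · intro n _ hn
    rw [Finsupp.notMem_support_iff] at hn
    rw [hn]
    exact zero_mul _

theorem norm_sumMode_altMode (f : ℕ →₀ Prof) : ‖sumMode (altMode f)‖ = ‖sumMode f‖ := by
  have h : ‖sumMode (altMode f)‖ ^ 2 = ‖sumMode f‖ ^ 2 := by
    rw [norm_sumMode_sq f, sumMode_altMode, norm_sum_sq_of_orthogonal]
    · refine Finset.sum_congr rfl fun n _ => ?_
      rw [norm_smul, norm_pow, norm_neg, norm_one, one_pow, one_mul]
    · intro i _ j _ hij
      rw [← map_smul (mode i), ← map_smul (mode j), inner_mode_mode hij]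
  nlinarith [norm_nonneg (sumMode (altMode f)), norm_nonneg (sumMode f)]

/-- On finite sums the shift by `π` multiplies the `n`th mode by `(-1)^n`, an isometry, so it
extends to `HS` by density. -/
theorem exists_shiftS : ∃ S : HS →L[ℝ] HS, ∀ f, S (sumModeS f) = sumModeS (altMode f) := by
  let e : FinModes →ₗ[ℝ] HS := sumModeS
  let c : FinModes →ₗ[ℝ] HS :=
    { toFun := fun f => sumModeS (altMode f)
      map_add' := fun f g => by
        have : altMode (f + g) = altMode f + altMode g :=
          Finsupp.ext fun n => smul_add _ _ _
        rw [this, map_add]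
      map_smul' := fun r f => by
        have : altMode (r • f) = r • altMode f :=
          Finsupp.ext fun n => smul_comm _ _ _
        rw [this, map_smul]; rfl }
  have he : DenseRange e := denseRange_sumModeS
  refine exists_extension c e he (C := 1) fun f => ?_
  rw [one_mul]
  exact (norm_sumMode_altMode f).le

/-- The shift by half a period on `HS`. -/
def shiftS : HS →L[ℝ] HS := exists_shiftS.choose

theorem shiftS_sumModeS (f : ℕ →₀ Prof) : shiftS (sumModeS f) = sumModeS (altMode f) :=
  exists_shiftS.choose_spec f

theorem norm_shiftS (u : HS) : ‖shiftS u‖ = ‖u‖ :=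
  HS_induction (P := fun u => ‖shiftS u‖ = ‖u‖)
    (isClosed_eq shiftS.continuous.norm continuous_norm)
    (fun f => by rw [shiftS_sumModeS]; exact norm_sumMode_altMode f) u

theorem continuous_C0_apply (z : Cyl) : Continuous fun w : C₀(Cyl, ℝ) => w z := by
  refine continuous_iff_continuousAt.2 fun w => ?_
  refine tendsto_iff_norm_sub_tendsto_zero.2 ?_
  refine squeeze_zero (fun _ => norm_nonneg _) (fun v => C0_abs_le (v - w) z) ?_
  exact tendsto_iff_norm_sub_tendsto_zero.1 tendsto_id

theorem embC_shiftS (u : HS) (z : Cyl) :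
    embC (shiftS u) z = embC u (z.1, z.2 + ((Real.pi : ℝ) : Torus)) :=
  HS_induction (P := fun u => embC (shiftS u) z = embC u (z.1, z.2 + ((Real.pi : ℝ) : Torus)))
    (isClosed_eq ((continuous_C0_apply _).comp (embC.continuous.comp shiftS.continuous))
      ((continuous_C0_apply _).comp embC.continuous))
    (fun f => by rw [shiftS_sumModeS, embC_sumModeS, embC_sumModeS, sumC_altMode]) u

theorem fn_shiftS (u : HS) : HS.fn (shiftS u) = shiftL (HS.fn u) := by
  refine Lp.ext ?_
  have h := embC_ae u
  filter_upwards [embC_ae (shiftS u), coeFn_shiftL (HS.fn u),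
    measurePreserving_shift.quasiMeasurePreserving.ae h] with z h1 h2 h3
  rw [h1, h2, h3, embC_shiftS]

theorem nem_shiftS {p : ℝ} (hp : 1 < p) (u : HS) : nem hp (shiftS u) = shiftL (nem hp u) := by
  refine Lp.ext ?_
  have h := coeFn_nem hp u
  filter_upwards [coeFn_nem hp (shiftS u), coeFn_shiftL (nem hp u),
    measurePreserving_shift.quasiMeasurePreserving.ae h] with z h1 h2 h3
  rw [h1, h2, h3, embC_shiftS]

theorem helm_shiftS (u : HS) : helm 0 (HS.val (shiftS u)) = shiftL (helm 0 (HS.val u)) := by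
  let A : HS →L[ℝ] L2 := (helm 0).comp HS.val
  refine HS_induction (P := fun u => A (shiftS u) = shiftL (A u))
    (isClosed_eq (A.continuous.comp shiftS.continuous) (shiftL.continuous.comp A.continuous))
    (fun f => ?_) u
  rw [shiftS_sumModeS]
  change helm 0 (sumMode (altMode f)) = shiftL (helm 0 (sumMode f))
  rw [sumMode_altMode, sumMode_apply, map_sum, map_sum, map_sum]
  refine Finset.sum_congr rfl fun n _ => ?_
  rw [map_smul, helm_mode, shiftL_prodL]

theorem resid_shiftS {p : ℝ} (hp : 1 < p) (ω : ℝ) (u : HS) :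
    resid hp ω (shiftS u) = shiftL (resid hp ω u) := by
  rw [resid, resid, helm_shiftS, fn_shiftS, nem_shiftS, map_sub, map_add, map_smul]

theorem embC_injective : Function.Injective embC := by
  refine (injective_iff_map_eq_zero embC).2 fun u hu => ?_
  have h0 : HS.fn u = 0 := by
    refine Lp.ext ?_
    filter_upwards [embC_ae u, Lp.coeFn_zero ℝ 2 (volume : Measure Cyl)] with z h1 h2
    rw [h1, hu, h2]; rfl
  exact HS.val_injective ((H2.eq_zero_of_fn h0).trans (map_zero _).symm)

theorem shiftS_solS {p : ℝ} (hp : 1 < p) : shiftS (solS hp) = solS hp := by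
  refine embC_injective (ZeroAtInftyContinuousMap.ext fun z => ?_)
  rw [embC_shiftS, solS_fn_ae, solS_fn_ae]

theorem shiftL_psiL {p : ℝ} (hp : 1 < p) : shiftL (psiL hp) = -psiL hp := by
  rw [psiL, shiftL_prodL]; simp

theorem shiftL_inner_psiL {p : ℝ} (hp : 1 < p) (f : L2) :
    ⟪psiL hp, shiftL f⟫_ℝ = -⟪psiL hp, f⟫_ℝ := by
  have h : ⟪shiftL (psiL hp), shiftL f⟫_ℝ = ⟪psiL hp, f⟫_ℝ := shiftL.inner_map_map _ _
  rw [shiftL_psiL, inner_neg_left] at h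
  linarith

/-- At `a = 0` the Lagrange multiplier vanishes. -/
theorem multiplier_zero {p : ℝ} (hp : 1 < p) {ω r : ℝ} {h : HS} (hr : ‖h‖ < r)
    (huniq : ∀ h', ‖h'‖ < r → (auxG hp ((ω, 0), h') = 0 ↔ h' = h)) :
    ⟪psiL hp, resid hp ω (anz hp 0 h)⟫_ℝ = 0 := by
  have e : anz hp 0 (shiftS h) = shiftS (anz hp 0 h) := by
    simp [anz, shiftS_solS]
  have h0 := (huniq h hr).2 rfl
  rw [auxG_eq_zero_iff] at h0
  -- At `a = 0` the ansatz commutes with the shift, so the shifted solution solves the same equation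
  -- in the same ball. Uniqueness makes it equal to `h`, while its multiplier has the opposite sign.
  have h1 : auxG hp ((ω, 0), shiftS h) = 0 := by
    rw [auxG_eq_zero_iff]
    simp only [e, resid_shiftS, fn_shiftS, shiftL_inner_psiL]
    refine ⟨by rw [h0.1, neg_zero], ?_⟩
    conv_lhs => rw [h0.2]
    rw [map_smul, shiftL_psiL, smul_neg, neg_smul]
  have h2 := (huniq (shiftS h) (by rwa [norm_shiftS])).1 h1
  have h3 : ⟪psiL hp, resid hp ω (anz hp 0 h)⟫_ℝ = -⟪psiL hp, resid hp ω (anz hp 0 h)⟫_ℝ := by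
    rw [← shiftL_inner_psiL, ← resid_shiftS, ← e, h2]
  linarith

/-! ### The maximum principle -/

/-- The function `2 max(t, 0)²`. -/
def posSq (t : ℝ) : ℝ := |t| * t + t * t

theorem posSq_nonneg (t : ℝ) : 0 ≤ posSq t := by
  rw [posSq, ← abs_mul_abs_self t]
  nlinarith [abs_nonneg t, neg_abs_le t]

theorem posSq_of_nonpos {t : ℝ} (h : t ≤ 0) : posSq t = 0 := by
  rw [posSq, abs_of_nonpos h]; ring

theorem posSq_pos {t : ℝ} (h : 0 < t) : 0 < posSq t := by
  rw [posSq, abs_of_pos h]; positivity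

theorem hasDerivAt_posSq (t : ℝ) : HasDerivAt posSq (2 * (|t| + t)) t := by
  have h1 := hasDerivAt_abs_rpow_mul one_lt_two t
  have e : (2 : ℝ) - 1 = 1 := by norm_num
  simp only [e, Real.rpow_one] at h1
  exact (h1.add ((hasDerivAt_id t).mul (hasDerivAt_id t))).congr_deriv (by simp; ring)

theorem continuous_posSq : Continuous posSq :=
  continuous_iff_continuousAt.2 fun t => (hasDerivAt_posSq t).continuousAt

theorem abs_add_self_nonneg (t : ℝ) : 0 ≤ |t| + t := by linarith [neg_abs_le t]

theorem Dec.posSq {w : ℝ → ℝ} (hw : Dec w) : Dec fun x => posSq (w x) := by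
  obtain ⟨M, M0, hM⟩ := hw.exists_bound
  refine hw.mono (2 * M) fun x => ?_
  have h1 : LineSoliton.posSq (w x) ≤ 2 * (|w x| * |w x|) := by
    rw [LineSoliton.posSq]
    nlinarith [abs_nonneg (w x), le_abs_self (w x), abs_mul_abs_self (w x)]
  rw [abs_of_nonneg (posSq_nonneg _)]
  nlinarith [abs_nonneg (w x), hM x]

theorem IsProf.integral_deriv2_mul_posSq {w : ℝ → ℝ} (hw : IsProf w) :
    ∫ x, deriv (deriv w) x * LineSoliton.posSq (w x) ≤ 0 := by
  have hF : ∀ x, HasDerivAt (fun x => deriv w x * LineSoliton.posSq (w x))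
      (deriv (deriv w) x * LineSoliton.posSq (w x) + deriv w x * (2 * (|w x| + w x) * deriv w x)) x :=
    fun x => (hw.hasDerivAt' x).fun_mul ((hasDerivAt_posSq (w x)).comp x (hw.hasDerivAt x))
  have i1 : Integrable fun x => deriv (deriv w) x * LineSoliton.posSq (w x) :=
    (hw.dec''.mul hw.dec.posSq).integrable (hw.cont''.mul (continuous_posSq.comp hw.cont))
  have i2 : Integrable fun x => deriv w x * (2 * (|w x| + w x) * deriv w x) := by
    have d : Dec fun x => 2 * (|w x| + w x) :=
      (Dec.add (hw.dec.mono 1 fun x => by rw [abs_abs, one_mul]) hw.dec).const_mul 2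
    exact (hw.dec'.mul (d.mul hw.dec')).integrable (hw.cont'.mul
      ((continuous_const.mul (hw.cont.abs.add hw.cont)).mul hw.cont'))
  have hd := hw.dec'.mul hw.dec.posSq
  have h1 := integral_of_hasDerivAt_of_tendsto hF (i1.add i2) hd.tendsto_atBot hd.tendsto_atTop
  rw [integral_add i1 i2, sub_zero] at h1
  have h2 : 0 ≤ ∫ x, deriv w x * (2 * (|w x| + w x) * deriv w x) := integral_nonneg fun x => by
    have := abs_add_self_nonneg (w x)
    have e : deriv w x * (2 * (|w x| + w x) * deriv w x) = 2 * (|w x| + w x) * deriv w x ^ 2 := by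
      ring
    simp only [e]
    positivity
  linarith

/-- Integration by parts with boundary terms that cancel by periodicity; what remains is minus the
integral of a nonnegative weight times `w'²`. -/
theorem intervalIntegral_deriv2_mul_posSq {w w' w'' : ℝ → ℝ} {T : ℝ} (hT : 0 ≤ T)
    (h : ∀ t, HasDerivAt w (w' t) t) (h' : ∀ t, HasDerivAt w' (w'' t) t) (hc : Continuous w'')
    (e : w T = w 0) (e' : w' T = w' 0) : ∫ t in (0 : ℝ)..T, w'' t * posSq (w t) ≤ 0 := by
  have c : Continuous w := continuous_iff_continuousAt.2 fun t => (h t).continuousAt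
  have c' : Continuous w' := continuous_iff_continuousAt.2 fun t => (h' t).continuousAt
  have hF : ∀ t, HasDerivAt (fun t => w' t * posSq (w t))
      (w'' t * posSq (w t) + w' t * (2 * (|w t| + w t) * w' t)) t :=
    fun t => (h' t).fun_mul ((hasDerivAt_posSq (w t)).comp t (h t))
  have c1 : Continuous fun t => w'' t * posSq (w t) := hc.mul (continuous_posSq.comp c)
  have c2 : Continuous fun t => w' t * (2 * (|w t| + w t) * w' t) :=
    c'.mul ((continuous_const.mul (c.abs.add c)).mul c')
  have h1 := intervalIntegral.integral_eq_sub_of_hasDerivAt (a := 0) (b := T)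
    (fun t _ => hF t) ((c1.add c2).intervalIntegrable _ _)
  rw [intervalIntegral.integral_add (c1.intervalIntegrable _ _) (c2.intervalIntegrable _ _), e, e',
    sub_self] at h1
  have h2 : 0 ≤ ∫ t in (0 : ℝ)..T, w' t * (2 * (|w t| + w t) * w' t) :=
    intervalIntegral.integral_nonneg hT fun t _ => by
      have := abs_add_self_nonneg (w t)
      have e : w' t * (2 * (|w t| + w t) * w' t) = 2 * (|w t| + w t) * w' t ^ 2 := by ring
      rw [e]
      positivity
  linarith

/-- `2 max(u, 0)²` in `L²`. -/
def posS (u : HS) : L2 := nem one_lt_two u + mulL (embC u).toBCF (HS.fn u)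

theorem coeFn_posS (u : HS) : posS u =ᵐ[volume] fun z => posSq (embC u z) := by
  filter_upwards [Lp.coeFn_add (nem one_lt_two u) (mulL (embC u).toBCF (HS.fn u)),
    coeFn_nem one_lt_two u, coeFn_mulL (embC u).toBCF (HS.fn u), embC_ae u] with z h1 h2 h3 h4
  have e : (2 : ℝ) - 1 = 1 := by norm_num
  rw [posS, h1, Pi.add_apply, h2, h3, h4, e, Real.rpow_one, posSq]
  rfl

/-- Writing `2 max(u, 0)²` as `|u|u + u·u` makes continuity into `L²` a case of the superposition
operator with exponent `2`, which allows the sign of `⟨-Δu, posS u⟩` to pass to limits. -/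
theorem continuous_posS : Continuous posS := by
  have h1 : Continuous fun u : HS => mulL (embC u).toBCF :=
    mulL.continuous.comp
      (ZeroAtInftyContinuousMap.isometry_toBCF.continuous.comp embC.continuous)
  exact (contDiff_nem one_lt_two).continuous.add (h1.clm_apply HS.fn.continuous)

theorem sumMode_dxx_ae (f : ℕ →₀ Prof) : compL 3 (sumMode f) =ᵐ[volume]
    fun z => ∑ n ∈ f.support, deriv (deriv (f n : ℝ → ℝ)) z.1 * cosN n z.2 := by
  rw [sumMode_apply, map_sum]
  refine (coeFn_finset_sum _ _).trans ?_
  have h : ∀ᵐ z : Cyl, ∀ n ∈ f.support,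
      compL 3 (mode n (f n)) z = deriv (deriv (f n : ℝ → ℝ)) z.1 * cosN n z.2 := by
    rw [Filter.eventually_all_finset]
    exact fun n _ => coeFn_prodL (cosC n) (prof2 (f n))
  filter_upwards [h] with z hz
  exact Finset.sum_congr rfl hz

theorem sumMode_dyy_ae (f : ℕ →₀ Prof) : compL 5 (sumMode f) =ᵐ[volume]
    fun z => ∑ n ∈ f.support, (f n : ℝ → ℝ) z.1 * (-(n : ℝ) ^ 2 * cosN n z.2) := by
  rw [sumMode_apply, map_sum]
  refine (coeFn_finset_sum _ _).trans ?_
  have h : ∀ᵐ z : Cyl, ∀ n ∈ f.support,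
      compL 5 (mode n (f n)) z = (f n : ℝ → ℝ) z.1 * (-(n : ℝ) ^ 2 * cosN n z.2) := by
    rw [Filter.eventually_all_finset]
    intro n _
    rw [compL_mode_five, ← prodL_smul]
    exact coeFn_prodL _ (prof0 (f n))
  filter_upwards [h] with z hz
  exact Finset.sum_congr rfl hz

theorem inner_posS_eq (D : L2) {d : Cyl → ℝ} (hd : D =ᵐ[volume] d) (u : HS) :
    Integrable (fun z => d z * posSq (embC u z)) (volume : Measure Cyl) ∧
      ⟪D, posS u⟫_ℝ = ∫ z, d z * posSq (embC u z) := by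
  have h : (fun z => ⟪D z, posS u z⟫_ℝ) =ᵐ[volume] fun z => d z * posSq (embC u z) := by
    filter_upwards [hd, coeFn_posS u] with z h1 h2
    rw [h1, h2]
    simp [mul_comm]
  exact ⟨(L2.integrable_inner D (posS u)).congr h, (L2.inner_def _ _).trans (integral_congr_ae h)⟩

/-- For fixed `y` a finite sum of modes is itself a profile in `x`, so the one-dimensional
inequality applies slice by slice. -/
theorem inner_dxx_posS_sumModeS (f : ℕ →₀ Prof) :
    ⟪compL 3 (sumMode f), posS (sumModeS f)⟫_ℝ ≤ 0 := by
  obtain ⟨hi, he⟩ := inner_posS_eq _ (sumMode_dxx_ae f) (sumModeS f)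
  rw [he, embC_sumModeS] at *
  refine le_of_eq_of_le (integral_prod_symm _ hi) (integral_nonpos fun y => ?_)
  let g : Prof := ∑ n ∈ f.support, cosN n y • f n
  have hg0 : ∀ x, (g : ℝ → ℝ) x = ∑ n ∈ f.support, (f n : ℝ → ℝ) x * cosN n y := fun x => by
    simp [g, mul_comm]
  have hg2 : ∀ x, deriv (deriv (g : ℝ → ℝ)) x =
      ∑ n ∈ f.support, deriv (deriv (f n : ℝ → ℝ)) x * cosN n y := fun x => by
    have h1 : prof2 g = ∑ n ∈ f.support, cosN n y • prof2 (f n) := by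
      simp only [g, map_sum, map_smul]
    have h2 := congrFun (congrArg Subtype.val h1) x
    rw [Submodule.coe_sum, Finset.sum_apply] at h2
    refine h2.trans (Finset.sum_congr rfl fun n _ => ?_)
    exact mul_comm _ _
  have h := g.2.integral_deriv2_mul_posSq
  simp only [hg0, hg2] at h
  simp only [sumC_apply]
  exact h

theorem inner_dyy_posS_sumModeS (f : ℕ →₀ Prof) :
    ⟪compL 5 (sumMode f), posS (sumModeS f)⟫_ℝ ≤ 0 := by
  obtain ⟨hi, he⟩ := inner_posS_eq _ (sumMode_dyy_ae f) (sumModeS f)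
  rw [he, embC_sumModeS] at *
  refine le_of_eq_of_le (integral_prod _ hi) (integral_nonpos fun x => ?_)
  simp only [sumC_apply]
  rw [integral_torus]
  refine intervalIntegral_deriv2_mul_posSq (w := fun t : ℝ => ∑ n ∈ f.support,
    (f n : ℝ → ℝ) x * cosN n t) (w' := fun t : ℝ => ∑ n ∈ f.support,
    (f n : ℝ → ℝ) x * (-(n : ℝ) * sinN n t)) (by positivity)
    (fun t => HasDerivAt.fun_sum fun n _ => (hasDerivAt_cosN n t).const_mul _)
    (fun t => HasDerivAt.fun_sum fun n _ => (hasDerivAt_sinN n t).const_mul _) ?_ ?_ ?_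
  · refine continuous_finsetSum _ fun n _ => continuous_const.mul (continuous_const.mul ?_)
    exact (continuous_cosN n).comp (AddCircle.continuous_mk' _)
  · simp only [AddCircle.coe_period]; rfl
  · simp only [AddCircle.coe_period]; rfl

theorem inner_helm_posS (u : HS) : 0 ≤ ⟪helm 0 (HS.val u), posS u⟫_ℝ := by
  let A : HS →L[ℝ] L2 := (helm 0).comp HS.val
  refine HS_induction (P := fun u => 0 ≤ ⟪A u, posS u⟫_ℝ)
    (isClosed_le continuous_const (A.continuous.inner continuous_posS)) (fun f => ?_) u
  change 0 ≤ ⟪helm 0 (sumMode f), posS (sumModeS f)⟫_ℝ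
  rw [helm_apply, zero_smul, add_zero, inner_sub_left, inner_neg_left]
  have h1 := inner_dxx_posS_sumModeS f
  have h2 := inner_dyy_posS_sumModeS f
  rw [compL_three] at h1
  rw [compL_five] at h2
  linarith

/-- The weak maximum principle: a function that is strictly subharmonic where it is positive is
nonpositive. -/
theorem embC_nonpos_of_subharmonic (u : HS)
    (h : ∀ᵐ z : Cyl, 0 < embC u z → helm 0 (HS.val u) z < 0) (z : Cyl) : embC u z ≤ 0 := by
  obtain ⟨hi, he⟩ := inner_posS_eq (helm 0 (HS.val u)) (EventuallyEq.refl _ _) u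
  have h0 := inner_helm_posS u
  rw [he] at h0
  -- The integral of `(-Δu) · 2 max(u, 0)²` is nonnegative by integration by parts, while its
  -- integrand is pointwise nonpositive by hypothesis. Hence it vanishes, so `u ≤ 0` almost
  -- everywhere, and everywhere by continuity.
  have hle : ∀ᵐ z : Cyl, 0 ≤ -(helm 0 (HS.val u) z * posSq (embC u z)) := by
    filter_upwards [h] with z hz
    rcases le_or_gt (embC u z) 0 with h1 | h1
    · rw [posSq_of_nonpos h1]; simp
    · nlinarith [hz h1, posSq_pos h1]
  have hz0 : ∫ z, -(helm 0 (HS.val u) z * posSq (embC u z)) = 0 := by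
    refine le_antisymm ?_ (integral_nonneg_of_ae hle)
    rw [integral_neg]; linarith
  have hae := (integral_eq_zero_iff_of_nonneg_ae hle hi.neg).1 hz0
  have hmax : (fun z => max (embC u z) 0) =ᵐ[volume] fun _ => (0 : ℝ) := by
    filter_upwards [h, hae] with z hz h1
    refine max_eq_right (le_of_not_gt fun h2 => ?_)
    have h1 : -(helm 0 (HS.val u) z * posSq (embC u z)) = 0 := h1
    nlinarith [hz h2, posSq_pos h2]
  have := congrFun (continuous_eq_of_ae ((embC u).continuous.max continuous_const)
    continuous_const hmax) z
  exact max_eq_right_iff.1 this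

/-! ### Barriers -/

/-- `√(1 + x²)`. -/
def jap (x : ℝ) : ℝ := Real.sqrt (1 + x ^ 2)

theorem jap_sq (x : ℝ) : jap x ^ 2 = 1 + x ^ 2 := Real.sq_sqrt (by positivity)

theorem jap_pos (x : ℝ) : 0 < jap x := Real.sqrt_pos.2 (by positivity)

theorem one_le_jap (x : ℝ) : 1 ≤ jap x := by
  nlinarith [jap_sq x, jap_pos x, sq_nonneg x]

theorem abs_le_jap (x : ℝ) : |x| ≤ jap x := by
  nlinarith [jap_sq x, jap_pos x, sq_abs x, abs_nonneg x]

theorem jap_le (x : ℝ) : jap x ≤ 1 + |x| := by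
  nlinarith [jap_sq x, jap_pos x, sq_abs x, abs_nonneg x]

theorem jap_neg (x : ℝ) : jap (-x) = jap x := by simp [jap]

theorem contDiff_jap : ContDiff ℝ (⊤ : ℕ∞) jap :=
  ContDiff.sqrt (contDiff_const.add (contDiff_id.pow 2)) fun x => by positivity

theorem hasDerivAt_jap (x : ℝ) : HasDerivAt jap (x / jap x) x := by
  have h : HasDerivAt (fun x : ℝ => 1 + x ^ 2) (2 * x) x := by
    simpa using ((hasDerivAt_id x).fun_pow 2).const_add 1
  refine (h.sqrt (by positivity)).congr_deriv ?_
  rw [mul_div_mul_left _ _ two_ne_zero]; rfl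

theorem hasDerivAt_div_jap (x : ℝ) : HasDerivAt (fun x => x / jap x) (1 / jap x ^ 3) x := by
  have h0 := (jap_pos x).ne'
  refine ((hasDerivAt_id x).fun_div (hasDerivAt_jap x) h0).congr_deriv ?_
  have := jap_sq x
  simp only [id]
  field_simp
  linarith

theorem hasDerivAt_two_div_jap (x : ℝ) :
    HasDerivAt (fun x => 2 / jap x) (-(2 * x / jap x ^ 3)) x := by
  have h0 := (jap_pos x).ne'
  refine ((hasDerivAt_const x (2 : ℝ)).fun_div (hasDerivAt_jap x) h0).congr_deriv ?_
  field_simp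
  ring

theorem hasDerivAt_two_mul_div_jap (x : ℝ) :
    HasDerivAt (fun x => 2 * x / jap x ^ 3) (2 / jap x ^ 3 - 6 * x ^ 2 / jap x ^ 5) x := by
  have h0 := (jap_pos x).ne'
  refine (((hasDerivAt_id x).const_mul 2).fun_div ((hasDerivAt_jap x).fun_pow 3)
    (pow_ne_zero 3 h0)).congr_deriv ?_
  simp only [id]
  field_simp
  push_cast
  ring

/-- With `θ = k√(1 + x²)` one has `θ'² ≤ k²` and `θ'' ≥ 0`, so `e^{-θ}` is a supersolution for rate
`k` on the whole line. The square root smooths the corner of `|x|`. -/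
theorem isProf_upB {k : ℝ} (hk : 0 < k) :
    IsProf (fun x => Real.exp (-(k * jap x))) ∧
      ∀ x, deriv (deriv fun x => Real.exp (-(k * jap x))) x ≤ k ^ 2 * Real.exp (-(k * jap x)) := by
  have b2 : ∀ x, 0 ≤ 1 / jap x ^ 3 ∧ 1 / jap x ^ 3 ≤ 1 := fun x => by
    have := one_le_jap x
    refine ⟨by have := jap_pos x; positivity, ?_⟩
    exact div_le_one_of_le₀ (one_le_pow₀ this) (by have := jap_pos x; positivity)
  have b1 : ∀ x, |x / jap x| ≤ 1 := fun x => by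
    rw [abs_div, abs_of_pos (jap_pos x)]
    exact div_le_one_of_le₀ (abs_le_jap x) (jap_pos x).le
  obtain ⟨h1, -, h3⟩ := isProf_exp_neg (θ := fun x => k * jap x) (θ₁ := fun x => k * (x / jap x))
    (θ₂ := fun x => k * (1 / jap x ^ 3)) (c := k) (M := k) (contDiff_const.mul contDiff_jap)
    (fun x => by rw [jap_neg]) (fun x => (hasDerivAt_jap x).const_mul k)
    (fun x => (hasDerivAt_div_jap x).const_mul k) hk
    (fun x => by nlinarith [abs_le_jap x])
    (fun x => by rw [abs_mul, abs_of_pos hk]; nlinarith [b1 x])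
    (fun x => by rw [abs_mul, abs_of_pos hk, abs_of_nonneg (b2 x).1]; nlinarith [(b2 x).2])
  refine ⟨h1, fun x => ?_⟩
  rw [h3]
  refine mul_le_mul_of_nonneg_right ?_ (Real.exp_pos _).le
  have e1 : (x / jap x) ^ 2 ≤ 1 := by
    rw [← sq_abs]; exact pow_le_one₀ (abs_nonneg _) (b1 x)
  have e2 : (k * (x / jap x)) ^ 2 = k ^ 2 * (x / jap x) ^ 2 := by ring
  have e3 : 0 ≤ k * (1 / jap x ^ 3) := mul_nonneg hk.le (b2 x).1
  have e4 : k ^ 2 * (x / jap x) ^ 2 ≤ k ^ 2 * 1 := mul_le_mul_of_nonneg_left e1 (sq_nonneg k)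
  linarith

/-- For a subsolution the slope must be at least `k`, but that of `√(1 + x²)` is below `1`. The
correction `-2/√(1 + x²)` raises the slope above `1` and makes `θ'' ≤ 0` once `|x| ≥ 1`, while
changing `θ` by a bounded amount only. -/
theorem isProf_lowB {k : ℝ} (hk : 0 < k) :
    IsProf (fun x => Real.exp (-(k * (jap x - 2 / jap x)))) ∧
      ∀ x, 1 ≤ |x| → k ^ 2 * Real.exp (-(k * (jap x - 2 / jap x))) ≤
        deriv (deriv fun x => Real.exp (-(k * (jap x - 2 / jap x)))) x := by
  have i1 : ∀ x, 0 ≤ 1 / jap x ∧ 1 / jap x ≤ 1 := fun x =>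
    ⟨by have := jap_pos x; positivity, div_le_one_of_le₀ (one_le_jap x) (jap_pos x).le⟩
  have i2 : ∀ x, x ^ 2 * (1 / jap x) ^ 2 = 1 - (1 / jap x) ^ 2 := fun x => by
    have h0 := (jap_pos x).ne'
    have := jap_sq x
    field_simp
    linarith
  have hd1 : ∀ x, HasDerivAt (fun x => k * (jap x - 2 / jap x))
      (k * (x / jap x + 2 * x / jap x ^ 3)) x := fun x =>
    (((hasDerivAt_jap x).fun_sub (hasDerivAt_two_div_jap x)).const_mul k).congr_deriv (by ring)
  have hd2 : ∀ x, HasDerivAt (fun x => k * (x / jap x + 2 * x / jap x ^ 3))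
      (k * (3 / jap x ^ 3 - 6 * x ^ 2 / jap x ^ 5)) x := fun x =>
    (((hasDerivAt_div_jap x).fun_add (hasDerivAt_two_mul_div_jap x)).const_mul k).congr_deriv
      (by ring)
  have f1 : ∀ x, x / jap x + 2 * x / jap x ^ 3 = x * (1 / jap x) * (1 + 2 * (1 / jap x) ^ 2) :=
    fun x => by have h0 := (jap_pos x).ne'; field_simp
  have f2 : ∀ x, 3 / jap x ^ 3 - 6 * x ^ 2 / jap x ^ 5 =
      (1 / jap x) ^ 3 * (6 * (1 / jap x) ^ 2 - 3) := fun x => by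
    have e : 3 / jap x ^ 3 - 6 * x ^ 2 / jap x ^ 5 =
        (1 / jap x) ^ 3 * (3 - 6 * (x ^ 2 * (1 / jap x) ^ 2)) := by
      have h0 := (jap_pos x).ne'; field_simp
    rw [e, i2]; ring
  have s1 : ∀ x, (1 / jap x) ^ 2 ≤ 1 := fun x => pow_le_one₀ (i1 x).1 (i1 x).2
  have s3 : ∀ x, (1 / jap x) ^ 3 ≤ 1 := fun x => pow_le_one₀ (i1 x).1 (i1 x).2
  have s4 : ∀ x, 0 ≤ (1 / jap x) ^ 3 := fun x => pow_nonneg (i1 x).1 3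
  have hJ2 : ∀ x, 2 / jap x = 2 * (1 / jap x) := fun x => by ring
  obtain ⟨h1, -, h3⟩ := isProf_exp_neg (θ := fun x => k * (jap x - 2 / jap x)) (c := k)
    (M := 9 * k) (contDiff_const.mul (contDiff_jap.sub (contDiff_const.div contDiff_jap
      fun x => (jap_pos x).ne')))
    (fun x => by rw [jap_neg]) hd1 hd2 hk
    (fun x => by
      have h := i1 x
      have e : k * |x| ≤ k * jap x := mul_le_mul_of_nonneg_left (abs_le_jap x) hk.le
      have e' : k * (1 / jap x) ≤ k * 1 := mul_le_mul_of_nonneg_left h.2 hk.le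
      rw [hJ2]
      nlinarith)
    (fun x => by
      have hx : |x * (1 / jap x)| ≤ 1 := by
        rw [mul_one_div, abs_div, abs_of_pos (jap_pos x)]
        exact div_le_one_of_le₀ (abs_le_jap x) (jap_pos x).le
      have hy : |1 + 2 * (1 / jap x) ^ 2| ≤ 3 := by
        rw [abs_of_nonneg (by positivity)]; linarith [s1 x]
      rw [f1, abs_mul, abs_of_pos hk, abs_mul]
      have : |x * (1 / jap x)| * |1 + 2 * (1 / jap x) ^ 2| ≤ 1 * 3 :=
        mul_le_mul hx hy (abs_nonneg _) zero_le_one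
      nlinarith)
    (fun x => by
      have hy : |6 * (1 / jap x) ^ 2 - 3| ≤ 3 := by
        rw [abs_le]; constructor <;> linarith [s1 x, sq_nonneg (1 / jap x)]
      rw [f2, abs_mul, abs_of_pos hk, abs_mul, abs_of_nonneg (s4 x)]
      have : (1 / jap x) ^ 3 * |6 * (1 / jap x) ^ 2 - 3| ≤ 1 * 3 :=
        mul_le_mul (s3 x) hy (abs_nonneg _) zero_le_one
      nlinarith)
  refine ⟨h1, fun x hx => ?_⟩
  rw [h3]
  refine mul_le_mul_of_nonneg_right ?_ (Real.exp_pos _).le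
  have hs : (1 / jap x) ^ 2 ≤ 1 / 2 := by
    rw [div_pow, one_pow, jap_sq]
    refine one_div_le_one_div_of_le two_pos ?_
    nlinarith [sq_abs x]
  rw [f1, f2]
  have hg : 1 ≤ (x * (1 / jap x) * (1 + 2 * (1 / jap x) ^ 2)) ^ 2 := by
    have e : (x * (1 / jap x) * (1 + 2 * (1 / jap x) ^ 2)) ^ 2 =
        (x ^ 2 * (1 / jap x) ^ 2) * (1 + 2 * (1 / jap x) ^ 2) ^ 2 := by ring
    rw [e, i2]
    have h0 := sq_nonneg (1 / jap x)
    set t := (1 / jap x) ^ 2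
    have : (1 - t) * (1 + 2 * t) ^ 2 - 1 = t * (3 - 4 * t ^ 2) := by ring
    have : 0 ≤ t * (3 - 4 * t ^ 2) := mul_nonneg h0 (by nlinarith)
    linarith
  have hn : (1 / jap x) ^ 3 * (6 * (1 / jap x) ^ 2 - 3) ≤ 0 :=
    mul_nonpos_of_nonneg_of_nonpos (s4 x) (by linarith)
  have e1 : k ^ 2 * 1 ≤ k ^ 2 * (x * (1 / jap x) * (1 + 2 * (1 / jap x) ^ 2)) ^ 2 :=
    mul_le_mul_of_nonneg_left hg (sq_nonneg k)
  have e2 : k * ((1 / jap x) ^ 3 * (6 * (1 / jap x) ^ 2 - 3)) ≤ 0 :=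
    mul_nonpos_of_nonneg_of_nonpos hk.le hn
  rw [mul_pow]
  linarith

/-- The upper barrier. -/
def upB {k : ℝ} (hk : 0 < k) : Prof := ⟨_, (isProf_upB hk).1⟩

/-- The lower barrier. -/
def lowB {k : ℝ} (hk : 0 < k) : Prof := ⟨_, (isProf_lowB hk).1⟩

theorem upB_apply {k : ℝ} (hk : 0 < k) (x : ℝ) :
    (upB hk : ℝ → ℝ) x = Real.exp (-(k * jap x)) := rfl

theorem lowB_apply {k : ℝ} (hk : 0 < k) (x : ℝ) :
    (lowB hk : ℝ → ℝ) x = Real.exp (-(k * (jap x - 2 / jap x))) := rfl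

theorem upB_pos {k : ℝ} (hk : 0 < k) (x : ℝ) : 0 < (upB hk : ℝ → ℝ) x := Real.exp_pos _

theorem lowB_pos {k : ℝ} (hk : 0 < k) (x : ℝ) : 0 < (lowB hk : ℝ → ℝ) x := Real.exp_pos _

theorem upB_le {k : ℝ} (hk : 0 < k) (x : ℝ) :
    (upB hk : ℝ → ℝ) x ≤ Real.exp (-(k * |x|)) := by
  rw [upB_apply]
  exact Real.exp_le_exp.2 (by nlinarith [abs_le_jap x])

theorem le_upB {k : ℝ} (hk : 0 < k) (x : ℝ) :
    Real.exp (-(k * (1 + |x|))) ≤ (upB hk : ℝ → ℝ) x := by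
  rw [upB_apply]
  exact Real.exp_le_exp.2 (by nlinarith [jap_le x])

theorem le_lowB {k : ℝ} (hk : 0 < k) (x : ℝ) :
    Real.exp (-(k * (1 + |x|))) ≤ (lowB hk : ℝ → ℝ) x := by
  rw [lowB_apply]
  have : 0 < 2 / jap x := div_pos two_pos (jap_pos x)
  exact Real.exp_le_exp.2 (by nlinarith [jap_le x])

theorem lowB_le {k : ℝ} (hk : 0 < k) (x : ℝ) : (lowB hk : ℝ → ℝ) x ≤ Real.exp k := by
  rw [lowB_apply]
  have : 2 / jap x ≤ 2 := div_le_self two_pos.le (one_le_jap x)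
  exact Real.exp_le_exp.2 (by nlinarith [one_le_jap x])

/-! ### Comparison of solutions with the barriers -/

theorem helm_ae {p : ℝ} (hp : 1 < p) {ω l : ℝ} {u : HS} (h : resid hp ω u = l • psiL hp) :
    helm 0 (HS.val u) =ᵐ[volume] fun z =>
      l * psiCos p z - ω * embC u z + |embC u z| ^ (p - 1) * embC u z := by
  have e : helm 0 (HS.val u) = l • psiL hp - ω • HS.fn u + nem hp u := by
    rw [← h, resid]; abel
  rw [e]
  filter_upwards [Lp.coeFn_add (l • psiL hp - ω • HS.fn u) (nem hp u),
    Lp.coeFn_sub (l • psiL hp) (ω • HS.fn u), Lp.coeFn_smul l (psiL hp),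
    Lp.coeFn_smul ω (HS.fn u), coeFn_psiL hp, embC_ae u, coeFn_nem hp u]
    with z h1 h2 h3 h4 h5 h6 h7
  rw [h1, Pi.add_apply, h2, Pi.sub_apply, h3, h4, Pi.smul_apply, Pi.smul_apply, h5, h6, h7,
    smul_eq_mul, smul_eq_mul]

theorem helm_modeS_zero_ae (g : Prof) :
    helm 0 (HS.val (modeS 0 g)) =ᵐ[volume] fun z => -deriv (deriv (g : ℝ → ℝ)) z.1 := by
  have h : helm 0 (HS.val (modeS 0 g)) =
      prodL (cosC 0) (-prof2 g + (((0 : ℕ) : ℝ) ^ 2 + 0) • prof0 g) := helm_mode _ _ _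
  rw [h]
  refine (coeFn_prodL _ _).trans (.of_forall fun z => ?_)
  change (-deriv (deriv (g : ℝ → ℝ)) z.1 + (((0 : ℕ) : ℝ) ^ 2 + 0) * (g : ℝ → ℝ) z.1) *
    cosN 0 z.2 = _
  rw [cosN_zero]; simp

theorem embC_modeS_zero (g : Prof) (z : Cyl) : embC (modeS 0 g) z = (g : ℝ → ℝ) z.1 := by
  rw [embC_modeS, modeC_apply, cosN_zero, mul_one]

theorem lower_barrier {p : ℝ} (hp : 1 < p) {ω l k c K : ℝ} {u : HS}
    (hres : resid hp ω u = l • psiL hp) (hk : 0 < k) (hc : 0 < c) (hK : 1 ≤ K)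
    (hq : ∀ z : Cyl, K ≤ |z.1| → |embC u z| ^ (p - 1) ≤ ω)
    (hin : ∀ z : Cyl, |z.1| ≤ K → c * (lowB hk : ℝ → ℝ) z.1 ≤ embC u z)
    (hl : ∀ z : Cyl, |l * psiCos p z| < (k ^ 2 - ω) * (c * (lowB hk : ℝ → ℝ) z.1)) (z : Cyl) :
    c * (lowB hk : ℝ → ℝ) z.1 ≤ embC u z := by
  have he : ∀ z, embC (c • modeS 0 (lowB hk) - u) z = c * (lowB hk : ℝ → ℝ) z.1 - embC u z :=
    fun z => by
      rw [map_sub, map_smul, ZeroAtInftyContinuousMap.sub_apply,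
        ZeroAtInftyContinuousMap.smul_apply, embC_modeS_zero, smul_eq_mul]
  have h := embC_nonpos_of_subharmonic (c • modeS 0 (lowB hk) - u) ?_ z
  · rw [he] at h; linarith
  have e : helm 0 (HS.val (c • modeS 0 (lowB hk) - u)) =
      c • helm 0 (HS.val (modeS 0 (lowB hk))) - helm 0 (HS.val u) := by
    rw [map_sub, map_sub, map_smul, map_smul]
  rw [e]
  filter_upwards [Lp.coeFn_sub (c • helm 0 (HS.val (modeS 0 (lowB hk)))) (helm 0 (HS.val u)),
    Lp.coeFn_smul c (helm 0 (HS.val (modeS 0 (lowB hk)))), helm_modeS_zero_ae (lowB hk),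
    helm_ae hp hres] with z h1 h2 h3 h4 hpos
  rw [he] at hpos
  rw [h1, Pi.sub_apply, h2, Pi.smul_apply, h3, h4, smul_eq_mul]
  -- On the inner slab the barrier lies below the solution, so the difference can be positive only
  -- where the nonlinearity is small. The source is absorbed by the strict gap `k² - ω`.
  have hzK : K ≤ |z.1| := le_of_not_gt fun hlt => by linarith [hin z hlt.le]
  have hb : k ^ 2 * (lowB hk : ℝ → ℝ) z.1 ≤ deriv (deriv (lowB hk : ℝ → ℝ)) z.1 :=
    (isProf_lowB hk).2 z.1 (hK.trans hzK)
  have hcb := mul_le_mul_of_nonneg_left hb hc.le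
  have hb0 : 0 < c * (lowB hk : ℝ → ℝ) z.1 := mul_pos hc (lowB_pos hk _)
  have hq0 : 0 ≤ |embC u z| ^ (p - 1) := Real.rpow_nonneg (abs_nonneg _) _
  have hl1 := hl z
  have hl2 := neg_abs_le (l * psiCos p z)
  have hmul := mul_le_mul_of_nonneg_left (by linarith : embC u z ≤ c * (lowB hk : ℝ → ℝ) z.1)
    (sub_nonneg.2 (hq z hzK))
  have hqb := mul_nonneg hq0 hb0.le
  nlinarith

theorem upper_barrier {p : ℝ} (hp : 1 < p) {ω l k c K τ : ℝ} {u : HS}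
    (hres : resid hp ω u = l • psiL hp) (hk : 0 < k) (hc : 0 < c)
    (hq : ∀ z : Cyl, K ≤ |z.1| → |embC u z| ^ (p - 1) ≤ τ)
    (hin : ∀ z : Cyl, |z.1| ≤ K → embC u z ≤ c * (upB hk : ℝ → ℝ) z.1)
    (hl : ∀ z : Cyl, |l * psiCos p z| < (ω - τ - k ^ 2) * (c * (upB hk : ℝ → ℝ) z.1)) (z : Cyl) :
    embC u z ≤ c * (upB hk : ℝ → ℝ) z.1 := by
  have he : ∀ z, embC (u - c • modeS 0 (upB hk)) z = embC u z - c * (upB hk : ℝ → ℝ) z.1 :=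
    fun z => by
      rw [map_sub, map_smul, ZeroAtInftyContinuousMap.sub_apply,
        ZeroAtInftyContinuousMap.smul_apply, embC_modeS_zero, smul_eq_mul]
  have h := embC_nonpos_of_subharmonic (u - c • modeS 0 (upB hk)) ?_ z
  · rw [he] at h; linarith
  have e : helm 0 (HS.val (u - c • modeS 0 (upB hk))) =
      helm 0 (HS.val u) - c • helm 0 (HS.val (modeS 0 (upB hk))) := by
    rw [map_sub, map_sub, map_smul, map_smul]
  rw [e]
  filter_upwards [Lp.coeFn_sub (helm 0 (HS.val u)) (c • helm 0 (HS.val (modeS 0 (upB hk)))),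
    Lp.coeFn_smul c (helm 0 (HS.val (modeS 0 (upB hk)))), helm_modeS_zero_ae (upB hk),
    helm_ae hp hres] with z h1 h2 h3 h4 hpos
  rw [he] at hpos
  rw [h1, Pi.sub_apply, h2, Pi.smul_apply, h3, h4, smul_eq_mul]
  have hzK : K ≤ |z.1| := le_of_not_gt fun hlt => by linarith [hin z hlt.le]
  have hb : deriv (deriv (upB hk : ℝ → ℝ)) z.1 ≤ k ^ 2 * (upB hk : ℝ → ℝ) z.1 :=
    (isProf_upB hk).2 z.1
  have hcb := mul_le_mul_of_nonneg_left hb hc.le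
  have hb0 : 0 < c * (upB hk : ℝ → ℝ) z.1 := mul_pos hc (upB_pos hk _)
  have hl1 := hl z
  have hl2 := le_abs_self (l * psiCos p z)
  have hl3 := abs_nonneg (l * psiCos p z)
  have hgap : 0 < ω - τ - k ^ 2 := (mul_pos_iff_of_pos_right hb0).1 (hl3.trans_lt hl1)
  -- Where the difference is positive the solution exceeds a positive barrier, so no prior
  -- positivity is needed to estimate the nonlinear term.
  have hφ : 0 < embC u z := by linarith
  have hq1 := mul_le_mul_of_nonneg_right (hq z hzK) hφ.le
  have hmul := mul_le_mul_of_nonneg_left (by linarith : c * (upB hk : ℝ → ℝ) z.1 ≤ embC u z)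
    (by nlinarith [sq_nonneg k] : 0 ≤ ω - τ)
  nlinarith

/-! ### Exponential bounds along the solution family -/

theorem exists_mul_exp_le (C : ℝ) {c μ : ℝ} (hc : 0 < c) (hμ : 0 < μ) :
    ∃ K, 1 ≤ K ∧ ∀ t, K ≤ t → C * Real.exp (-c * t) ≤ μ := by
  have h : Tendsto (fun t : ℝ => C * Real.exp (-c * t)) atTop (𝓝 (C * 0)) := by
    refine (Real.tendsto_exp_atBot.comp ?_).const_mul C
    exact tendsto_id.const_mul_atTop_of_neg (neg_lt_zero.2 hc)
  rw [mul_zero] at h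
  obtain ⟨K, hK⟩ := eventually_atTop.1 (h.eventually (gt_mem_nhds hμ))
  exact ⟨max 1 K, le_max_left _ _, fun t ht => (hK t ((le_max_right _ _).trans ht)).le⟩

/-- A continuous function vanishing on a compact part of an axis is uniformly small near it. -/
theorem exists_forall_abs_lt_near_axis {f : ℝ × ℝ → ℝ} {s : Set ℝ} {b e : ℝ} (hs : IsCompact s)
    (hb : 0 < b) (hf : ContinuousOn f (s ×ˢ Icc (-b) b)) (h0 : ∀ x ∈ s, f (x, 0) = 0)
    (he : 0 < e) : ∃ d, 0 < d ∧ d < b ∧ ∀ x ∈ s, ∀ a, |a| < d → |f (x, a)| < e := by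
  have hu := (hs.prod isCompact_Icc).uniformContinuousOn_of_continuous hf
  obtain ⟨d, hd, h⟩ := Metric.uniformContinuousOn_iff.1 hu e he
  refine ⟨min d (b / 2), lt_min hd (by linarith), by linarith [min_le_right d (b / 2)], ?_⟩
  intro x hx a ha
  have ha1 := abs_lt.1 (ha.trans_le (min_le_right _ _))
  have h1 := h (x, a) ⟨hx, by constructor <;> linarith⟩ (x, 0) ⟨hx, by constructor <;> linarith⟩ (by
    rw [Prod.dist_eq, dist_self, Real.dist_eq, sub_zero]
    exact max_lt hd (ha.trans_le (min_le_left _ _)))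
  rwa [h0 x hx, Real.dist_eq, sub_zero] at h1

theorem exists_abs_psiCos_le {p : ℝ} (hp : 1 < p) :
    ∃ D, 0 < D ∧ ∀ z : Cyl, |psiCos p z| ≤ D * Real.exp (-(sidx p * kap p * |z.1|)) := by
  refine ⟨(|psiAmpl p| + 1) * Real.exp (sidx p * Real.log 2), by positivity, fun z => ?_⟩
  have h1 : |psiCos p z| ≤ |psiAmpl p| * sechPow (sidx p) (kap p) z.1 := by
    rw [psiCos, psi_eq hp, cosT_eq, abs_mul, abs_mul, abs_of_pos (sechPow_pos _ _ _)]
    exact mul_le_of_le_one_right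
      (mul_nonneg (abs_nonneg _) (sechPow_pos _ _ _).le) (abs_cosN_le _ _)
  have h2 : sechPow (sidx p) (kap p) z.1 ≤
      Real.exp (sidx p * Real.log 2) * Real.exp (-(sidx p * kap p * |z.1|)) := by
    rw [← Real.exp_add, sechPow]
    have := mul_le_mul_of_nonneg_left (le_log_cosh (kap p * z.1)) (sidx_pos hp).le
    rw [abs_mul, abs_of_pos (kap_pos hp)] at this
    exact Real.exp_le_exp.2 (by linarith)
  rw [mul_assoc]
  exact h1.trans (mul_le_mul (by linarith) h2 (sechPow_pos _ _ _).le (by positivity))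

theorem exp_mul_exp_le {k σ : ℝ} (hkσ : k ≤ σ) (x : ℝ) :
    Real.exp (-σ) * Real.exp (-(k * |x|)) ≤ Real.exp (-(k * (1 + |x|))) := by
  rw [← Real.exp_add]
  exact Real.exp_le_exp.2 (by linarith)

theorem abs_mul_psiCos_le {p l k σ D : ℝ} (hkσ : k ≤ σ) (hD0 : 0 < D)
    (hD : ∀ z : Cyl, |psiCos p z| ≤ D * Real.exp (-(σ * |z.1|))) (z : Cyl) :
    |l * psiCos p z| ≤ |l| * D * Real.exp (-(k * |z.1|)) := by
  rw [abs_mul, mul_assoc]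
  refine mul_le_mul_of_nonneg_left ((hD z).trans (mul_le_mul_of_nonneg_left ?_ hD0.le))
    (abs_nonneg _)
  exact Real.exp_le_exp.2 (by nlinarith [abs_nonneg z.1])

/-- The barrier has height `m e^{-σ}`: since it is at most `e^k ≤ e^σ` before scaling, it lies below
`m` on the slab. The source decays at rate `σ ≥ k`, so smallness of `l` at the origin of the
estimate suffices for all `x`. -/
theorem lower_decay {p : ℝ} (hp : 1 < p) {ω l k σ m K g D : ℝ} {u : HS}
    (hres : resid hp ω u = l • psiL hp) (hk : 0 < k) (hkσ : k ≤ σ) (hm : 0 < m) (hK : 1 ≤ K)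
    (hg : 0 < g) (hgk : g ≤ k ^ 2 - ω) (hD0 : 0 < D)
    (hD : ∀ z : Cyl, |psiCos p z| ≤ D * Real.exp (-(σ * |z.1|)))
    (hq : ∀ z : Cyl, K ≤ |z.1| → |embC u z| ^ (p - 1) ≤ ω)
    (hin : ∀ z : Cyl, |z.1| ≤ K → m ≤ embC u z)
    (hl : |l| * D < g * (m * Real.exp (-σ) * Real.exp (-σ))) (z : Cyl) :
    m * Real.exp (-σ) * Real.exp (-σ) * Real.exp (-(k * |z.1|)) ≤ embC u z := by
  have hc : 0 < m * Real.exp (-σ) := mul_pos hm (Real.exp_pos _)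
  have hlow : ∀ z : Cyl, m * Real.exp (-σ) * Real.exp (-σ) * Real.exp (-(k * |z.1|)) ≤
      m * Real.exp (-σ) * (lowB hk : ℝ → ℝ) z.1 := fun z => by
    rw [mul_assoc (m * Real.exp (-σ))]
    exact mul_le_mul_of_nonneg_left ((exp_mul_exp_le hkσ _).trans (le_lowB hk _)) hc.le
  refine (hlow z).trans (lower_barrier hp hres hk hc hK hq (fun z hz => ?_) (fun z => ?_) z)
  · refine le_trans ?_ (hin z hz)
    have h1 : (lowB hk : ℝ → ℝ) z.1 ≤ Real.exp σ := (lowB_le hk _).trans (Real.exp_le_exp.2 hkσ)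
    calc m * Real.exp (-σ) * (lowB hk : ℝ → ℝ) z.1 ≤ m * Real.exp (-σ) * Real.exp σ :=
          mul_le_mul_of_nonneg_left h1 hc.le
      _ = m := by rw [mul_assoc, ← Real.exp_add]; simp
  · calc |l * psiCos p z| ≤ |l| * D * Real.exp (-(k * |z.1|)) := abs_mul_psiCos_le hkσ hD0 hD z
      _ < g * (m * Real.exp (-σ) * Real.exp (-σ)) * Real.exp (-(k * |z.1|)) :=
          mul_lt_mul_of_pos_right hl (Real.exp_pos _)
      _ = g * (m * Real.exp (-σ) * Real.exp (-σ) * Real.exp (-(k * |z.1|))) := by ring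
      _ ≤ (k ^ 2 - ω) * (m * Real.exp (-σ) * (lowB hk : ℝ → ℝ) z.1) :=
          mul_le_mul hgk (hlow z) (by positivity) (hg.le.trans hgk)

/-- The height is large enough to put the barrier above `M` on the slab; the extra `1` bounds it
below independently of `M` and `K`, so the smallness required of `l` involves only `g`, `σ` and `D`.
-/
theorem upper_decay {p : ℝ} (hp : 1 < p) {ω l k σ M K τ g D : ℝ} {u : HS}
    (hres : resid hp ω u = l • psiL hp) (hk : 0 < k) (hkσ : k ≤ σ) (hM : 0 < M)
    (hg : 0 < g) (hgk : g ≤ ω - τ - k ^ 2) (hD0 : 0 < D)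
    (hD : ∀ z : Cyl, |psiCos p z| ≤ D * Real.exp (-(σ * |z.1|)))
    (hq : ∀ z : Cyl, K ≤ |z.1| → |embC u z| ^ (p - 1) ≤ τ)
    (hin : ∀ z : Cyl, embC u z ≤ M) (hl : |l| * D < g * Real.exp (-σ)) (z : Cyl) :
    embC u z ≤ (M * Real.exp (σ * (1 + K)) + 1) * Real.exp (-(k * |z.1|)) := by
  set c := M * Real.exp (σ * (1 + K)) + 1 with hcdef
  have hc1 : 1 ≤ c := by have := mul_pos hM (Real.exp_pos (σ * (1 + K))); linarith
  have hc : 0 < c := by linarith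
  refine (upper_barrier hp hres hk hc hq (fun z hz => ?_) (fun z => ?_) z).trans
    (mul_le_mul_of_nonneg_left (upB_le hk _) hc.le)
  · have h1 : Real.exp (-(σ * (1 + K))) ≤ (upB hk : ℝ → ℝ) z.1 := by
      refine le_trans (Real.exp_le_exp.2 (neg_le_neg ?_)) (le_upB hk z.1)
      exact mul_le_mul hkσ (by linarith) (by positivity) (hk.le.trans hkσ)
    calc embC u z ≤ M := hin z
      _ = M * Real.exp (σ * (1 + K)) * Real.exp (-(σ * (1 + K))) := by
          rw [mul_assoc, ← Real.exp_add]; simp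
      _ ≤ c * (upB hk : ℝ → ℝ) z.1 := mul_le_mul (by linarith) h1 (Real.exp_pos _).le hc.le
  · have h1 : Real.exp (-σ) * Real.exp (-(k * |z.1|)) ≤ c * (upB hk : ℝ → ℝ) z.1 :=
      ((exp_mul_exp_le hkσ _).trans (le_upB hk _)).trans
        (le_mul_of_one_le_left (upB_pos hk _).le hc1)
    calc |l * psiCos p z| ≤ |l| * D * Real.exp (-(k * |z.1|)) := abs_mul_psiCos_le hkσ hD0 hD z
      _ < g * Real.exp (-σ) * Real.exp (-(k * |z.1|)) :=
          mul_lt_mul_of_pos_right hl (Real.exp_pos _)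
      _ = g * (Real.exp (-σ) * Real.exp (-(k * |z.1|))) := by ring
      _ ≤ (ω - τ - k ^ 2) * (c * (upB hk : ℝ → ℝ) z.1) :=
          mul_le_mul hgk h1 (by positivity) (hg.le.trans hgk)

theorem rpow_le_of_le_rpow_inv {q t b : ℝ} (hq : 0 < q) (ht : 0 ≤ t) (hb : 0 ≤ b)
    (h : t ≤ b ^ q⁻¹) : t ^ q ≤ b :=
  (Real.rpow_le_rpow ht h hq.le).trans_eq (Real.rpow_inv_rpow hb (ne_of_gt hq))

/-- Two-sided exponential bounds, with constants depending only on the listed quantities, for a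
solution with small multiplier that is close to the line soliton. -/
theorem exists_decay_const {p : ℝ} (hp : 1 < p) {m K M ε : ℝ} (hm : 0 < m) (hK : 1 ≤ K)
    (hM : 0 < M) (hε : 0 < ε) (hε1 : ε < sidx p * kap p - √(omegaP p + 1 / 2))
    (hε2 : ε < √(omegaP p / 2)) :
    ∃ l₀ C : ℝ, 0 < l₀ ∧ 1 < C ∧ ∀ (ω l : ℝ) (u : HS), omegaP p / 2 ≤ ω → ω ≤ omegaP p + 1 / 2 →
      resid hp ω u = l • psiL hp → |l| < l₀ →
      (∀ z : Cyl, K ≤ |z.1| → |embC u z| ^ (p - 1) ≤ omegaP p / 4) →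
      (∀ z : Cyl, |z.1| ≤ K → m ≤ embC u z) → (∀ z, embC u z ≤ M) → ∀ z : Cyl,
      C⁻¹ * Real.exp (-(√ω + ε) * |z.1|) ≤ embC u z ∧
      embC u z ≤ C * Real.exp (-(√ω - ε) * |z.1|) ∧ 0 < embC u z := by
  obtain ⟨D, hD0, hD⟩ := exists_abs_psiCos_le hp
  set σ := sidx p * kap p with hσdef
  have hW := omegaP_pos hp
  set W := omegaP p with hWdef
  have hq : 0 < p - 1 := by linarith
  set c := m * Real.exp (-σ) * Real.exp (-σ) with hcdef
  have hc : 0 < c := mul_pos (mul_pos hm (Real.exp_pos _)) (Real.exp_pos _)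
  -- Since `ε < √(W/2) ≤ √ω`, the quantity `ω - (√ω - ε)² = 2ε√ω - ε²` is at least `ε√(W/2) = 2τ`.
  -- Half is spent on the nonlinearity, half on the source.
  set τ := ε * √(W / 2) / 2 with hτdef
  have hsW : 0 < √(W / 2) := Real.sqrt_pos.2 (by linarith)
  have hτ : 0 < τ := by positivity
  set C' := M * Real.exp (σ * (1 + K)) + 1 with hC'
  have hsqW : 0 < √W := Real.sqrt_pos.2 hW
  -- The radius beyond which the crude bound gives `φ^{p-1} ≤ τ`. It is chosen before `ω`, `l` and
  -- `u`, so the final constant is uniform.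
  obtain ⟨K₂, hK₂, hK₂'⟩ := exists_mul_exp_le C' (c := √W / 4) (μ := τ ^ (p - 1)⁻¹)
    (by positivity) (by positivity)
  set C'' := M * Real.exp (σ * (1 + K₂)) + 1 with hC''
  have hC''1 : 1 < C'' := by have := mul_pos hM (Real.exp_pos (σ * (1 + K₂))); linarith
  set e := min (ε ^ 2 * c) (min (3 * W / 16 * Real.exp (-σ)) (τ * Real.exp (-σ))) with he
  have he0 : 0 < e := by
    refine lt_min (by positivity) (lt_min ?_ ?_) <;> positivity
  have hcinv : 0 < c⁻¹ := inv_pos.2 hc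
  refine ⟨e / D, c⁻¹ + C'', div_pos he0 hD0, by linarith, ?_⟩
  intro ω l u hω1 hω2 hres hl hout hin hMu z
  have hlD : |l| * D < e := (lt_div_iff₀ hD0).1 hl
  have hω : 0 < ω := by linarith
  have hs := Real.sq_sqrt hω.le
  have hs1 : √(W / 2) ≤ √ω := Real.sqrt_le_sqrt hω1
  have hs2 : √ω ≤ √(W + 1 / 2) := Real.sqrt_le_sqrt hω2
  -- Here `k² - ω = 2ε√ω + ε² ≥ ε²`, and `√ω + ε ≤ σ` is where the first bound on `ε` enters.
  have hlow : ∀ z : Cyl, c * Real.exp (-((√ω + ε) * |z.1|)) ≤ embC u z :=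
    lower_decay hp (g := ε ^ 2) hres (by linarith) (by linarith) hm hK (by positivity)
      (by nlinarith) hD0 hD (fun z hz => (hout z hz).trans (by linarith)) hin
      (hlD.trans_le (min_le_left _ _))
  have hpos : ∀ z : Cyl, 0 < embC u z := fun z =>
    (mul_pos hc (Real.exp_pos _)).trans_le (hlow z)
  -- The crude pass, with rate `√W/4` and nonlinearity at most `W/4`: the gap is at least `W/2 - W/4
  -- - W/16 = 3W/16`.
  have hup1 : ∀ z : Cyl, embC u z ≤ C' * Real.exp (-(√W / 4 * |z.1|)) :=
    upper_decay hp (g := 3 * W / 16) (τ := W / 4) hres (by positivity)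
      (by
        have : √W ≤ √(W + 1 / 2) := Real.sqrt_le_sqrt (by linarith)
        linarith) hM (by positivity)
      (by nlinarith [Real.sq_sqrt hW.le]) hD0 hD hout hMu
      (hlD.trans_le ((min_le_right _ _).trans (min_le_left _ _)))
  -- The sharp pass. Positivity from the lower bound turns the crude upper bound into a bound on
  -- `|φ|`.
  have hup2 : ∀ z : Cyl, embC u z ≤ C'' * Real.exp (-((√ω - ε) * |z.1|)) :=
    upper_decay hp (g := τ) (τ := τ) hres (by linarith) (by linarith) hM hτ
      (by nlinarith) hD0 hD
      (fun z hz => rpow_le_of_le_rpow_inv hq (abs_nonneg _) hτ.le (by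
        rw [abs_of_pos (hpos z)]
        refine (hup1 z).trans ?_
        have := hK₂' _ hz
        rwa [neg_mul] at this)) hMu
      (hlD.trans_le ((min_le_right _ _).trans (min_le_right _ _)))
  refine ⟨?_, ?_, hpos z⟩
  · rw [neg_mul]
    refine le_trans (mul_le_mul_of_nonneg_right ?_ (Real.exp_pos _).le) (hlow z)
    exact inv_le_of_inv_le₀ hc (by linarith)
  · rw [neg_mul]
    exact (hup2 z).trans (mul_le_mul_of_nonneg_right (by linarith) (Real.exp_pos _).le)

theorem sqrt_lt_sidx_mul_kap {p : ℝ} (hp : 1 < p) : √(omegaP p + 1 / 2) < sidx p * kap p := by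
  rw [Real.sqrt_lt' (mul_pos (sidx_pos hp) (kap_pos hp)), mul_pow, sidx_sq_mul hp]
  linarith

/-- The line soliton is small far out and bounded below on a compact set. -/
theorem exists_soliton_bounds {p : ℝ} (hp : 1 < p) {μ : ℝ} (hμ : 0 < μ) :
    ∃ K m : ℝ, 1 ≤ K ∧ 0 < m ∧ (∀ x, K ≤ |x| → soliton p (omegaP p) x ≤ μ) ∧
      ∀ x, |x| ≤ K → m ≤ soliton p (omegaP p) x := by
  obtain ⟨C, c, hc, h⟩ := (isProf_soliton hp).dec
  obtain ⟨K, hK, hK'⟩ := exists_mul_exp_le C hc hμ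
  obtain ⟨x₀, -, hx₀⟩ := (isCompact_Icc (a := -K) (b := K)).exists_isMinOn
    ⟨0, by constructor <;> linarith⟩
    (isProf_soliton hp).smooth.continuous.continuousOn
  exact ⟨K, _, hK, soliton_pos hp x₀, fun x hx => (le_abs_self _).trans ((h x).trans (hK' _ hx)),
    fun x hx => hx₀ (abs_le.1 hx)⟩

theorem continuous_inner_resid {p : ℝ} (hp : 1 < p) :
    Continuous (fun v : ℝ × HS => ⟪psiL hp, resid hp v.1 v.2⟫_ℝ) :=
  (innerSL ℝ (psiL hp)).continuous.comp
    (contDiff_resid hp (contDiff_fst (E := ℝ) (F := HS)) contDiff_snd).continuous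

theorem continuousOn_fst_prodMk {f : ℝ × HS → ℝ} (hf : Continuous f) {g : ℝ × ℝ → HS}
    {s : Set (ℝ × ℝ)} (hg : ContinuousOn g s) : ContinuousOn (fun q => f (q.1, g q)) s :=
  hf.comp_continuousOn (continuousOn_fst.prodMk hg)

theorem continuousOn_anz {p : ℝ} (hp : 1 < p) {η : ℝ × ℝ → HS} {s : Set (ℝ × ℝ)}
    (hη : ContinuousOn η s) : ContinuousOn (fun q : ℝ × ℝ => anz hp q.2 (η q)) s :=
  (continuousOn_const.add (continuousOn_snd.smul continuousOn_const)).add hη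

theorem continuousOn_multiplier {p : ℝ} (hp : 1 < p) {η : ℝ × ℝ → HS} {s : Set (ℝ × ℝ)}
    (hη : ContinuousOn η s) :
    ContinuousOn (fun q : ℝ × ℝ => ⟪psiL hp, resid hp q.1 (anz hp q.2 (η q))⟫_ℝ) s :=
  continuousOn_fst_prodMk (continuous_inner_resid hp) (continuousOn_anz hp hη)

theorem anz_zero {p : ℝ} (hp : 1 < p) : anz hp 0 0 = solS hp := by
  rw [anz, zero_smul, add_zero, add_zero]

theorem exists_embC_anz_close {p : ℝ} (hp : 1 < p) {η : ℝ × ℝ → HS}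
    (hη : ContinuousAt η (omegaP p, 0)) (hη0 : η (omegaP p, 0) = 0) {ν : ℝ} (hν : 0 < ν) :
    ∃ ρ, 0 < ρ ∧ ∀ q ∈ Metric.ball ((omegaP p, 0) : ℝ × ℝ) ρ, ∀ z : Cyl,
      |embC (anz hp q.2 (η q)) z - soliton p (omegaP p) z.1| ≤ ν := by
  have h : ContinuousAt (fun q : ℝ × ℝ => embC (anz hp q.2 (η q))) (omegaP p, 0) :=
    embC.continuous.continuousAt.comp
      ((continuousAt_const.add (continuousAt_snd.smul continuousAt_const)).add hη)
  obtain ⟨ρ, hρ, hq⟩ := Metric.continuousAt_iff.1 h ν hν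
  refine ⟨ρ, hρ, fun q hqb z => ?_⟩
  have h1 := (hq hqb).le
  rw [dist_eq_norm] at h1
  refine le_trans (le_of_eq ?_) ((C0_abs_le _ z).trans h1)
  rw [ZeroAtInftyContinuousMap.sub_apply, hη0, ← solS_fn_ae hp z, anz_zero hp]

theorem val_mem_X2 {p : ℝ} (hp : 1 < p) {q : ℝ × ℝ} {h : HS} (h0 : auxG hp (q, h) = 0) :
    HS.val h ∈ X2 p :=
  (mem_X2_iff hp _).2 ⟨HS.val_mem h, ((auxG_eq_zero_iff hp _).1 h0).1⟩

theorem auxEq_iff_eq_val {p : ℝ} (hp : 1 < p) {ω a r : ℝ} {e : HS}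
    (huniq : ∀ h, ‖h‖ < r → (auxG hp ((ω, a), h) = 0 ↔ h = e)) {h : H2} (hX : h ∈ X2 p)
    (hr : ‖h‖ < r) : AuxEq p ω a h ↔ h = HS.val e := by
  obtain ⟨hs, ho⟩ := (mem_X2_iff hp h).1 hX
  have h1 : AuxEq p ω a h ↔ auxG hp ((ω, a), HS.mk h hs) = 0 := by
    rw [auxG_eq_zero_iff]
    exact (auxEq_iff hp ω a (HS.mk h hs)).trans ⟨fun h => ⟨ho, h⟩, fun h => h.2⟩
  have h2 : ‖HS.mk h hs‖ < r := by rwa [← HS.norm_val, HS.val_mk]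
  rw [h1, huniq _ h2, ← HS.val_injective.eq_iff, HS.val_mk]

/-- The solution family of the auxiliary equation on a closed square around `(ω_p, 0)` on which it
is uniformly close to the line soliton. -/
theorem exists_family {p : ℝ} (hp : 1 < p) : ∃ (η : ℝ × ℝ → HS) (δ r m K M : ℝ),
    0 < δ ∧ δ ≤ 1 / 2 ∧ δ ≤ omegaP p / 2 ∧ 0 < r ∧ 0 < m ∧ 1 ≤ K ∧ 0 < M ∧
    ContDiffOn ℝ 1 η (Icc (omegaP p - δ) (omegaP p + δ) ×ˢ Icc (-δ) δ) ∧
    ∀ q ∈ Icc (omegaP p - δ) (omegaP p + δ) ×ˢ Icc (-δ) δ, ‖η q‖ < r ∧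
      (∀ h, ‖h‖ < r → (auxG hp (q, h) = 0 ↔ h = η q)) ∧
      (∀ z : Cyl, K ≤ |z.1| → |embC (anz hp q.2 (η q)) z| ^ (p - 1) ≤ omegaP p / 4) ∧
      (∀ z : Cyl, |z.1| ≤ K → m ≤ embC (anz hp q.2 (η q)) z) ∧
      ∀ z, embC (anz hp q.2 (η q)) z ≤ M := by
  have hW := omegaP_pos hp
  obtain ⟨η, ρ, r, hρ, hr, hη, hη0, hηr⟩ := exists_eta hp
  -- Half of the admissible size: far out the soliton takes one half and the distance to the soliton
  -- the other.
  set μ := (omegaP p / 4) ^ (p - 1)⁻¹ / 2 with hμdef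
  have hμ : 0 < μ := by positivity
  obtain ⟨K, m, hK, hm, hKout, hKin⟩ := exists_soliton_bounds hp hμ
  have hηc : ContinuousAt η (omegaP p, 0) :=
    hη.continuousOn.continuousAt (Metric.ball_mem_nhds _ hρ)
  obtain ⟨ρ₁, hρ₁, hclose⟩ := exists_embC_anz_close hp hηc hη0
    (lt_min hμ (half_pos hm) : 0 < min μ (m / 2))
  -- Half radii keep the closed square inside both open balls, as the compactness in `ω` requires.
  -- The other two bounds keep `ω` in `[ω_p/2, ω_p + 1/2]`, where the decay estimates hold.
  set δ := min (min (ρ / 2) (ρ₁ / 2)) (min (1 / 2) (omegaP p / 2)) with hδdef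
  have hδ : 0 < δ := lt_min (lt_min (by linarith) (by linarith)) 
    (lt_min (by norm_num) (by linarith))
  have hδ1 : δ ≤ ρ / 2 := (min_le_left _ _).trans (min_le_left _ _)
  have hδ2 : δ ≤ ρ₁ / 2 := (min_le_left _ _).trans (min_le_right _ _)
  have hball : ∀ R, δ ≤ R / 2 → Icc (omegaP p - δ) (omegaP p + δ) ×ˢ Icc (-δ) δ ⊆
      Metric.ball ((omegaP p, 0) : ℝ × ℝ) R := fun R hR q hq => by
    obtain ⟨⟨h1, h2⟩, h3, h4⟩ := hq
    rw [Metric.mem_ball, Prod.dist_eq, Real.dist_eq, Real.dist_eq, sub_zero]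
    exact max_lt (abs_lt.2 ⟨by linarith, by linarith⟩) (abs_lt.2 ⟨by linarith, by linarith⟩)
  refine ⟨η, δ, r, m / 2, K, ‖embC (solS hp)‖ + μ, hδ, (min_le_right _ _).trans (min_le_left _ _),
    (min_le_right _ _).trans (min_le_right _ _), hr, half_pos hm, hK, by positivity,
    hη.mono (hball ρ hδ1), fun q hq => ?_⟩
  obtain ⟨h1, h2⟩ := hηr q (hball ρ hδ1 hq)
  have h3 := fun z => abs_le.1 (hclose q (hball ρ₁ hδ2 hq) z)
  have m1 := min_le_left μ (m / 2)
  have m2 := min_le_right μ (m / 2)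
  refine ⟨h1, h2, fun z hz => ?_, fun z hz => ?_, fun z => ?_⟩
  · refine rpow_le_of_le_rpow_inv (by linarith) (abs_nonneg _) (by linarith) ?_
    have h4 := h3 z
    have h5 := soliton_pos hp z.1
    have h6 := hKout z.1 hz
    have h7 : (omegaP p / 4) ^ (p - 1)⁻¹ = 2 * μ := by rw [hμdef]; ring
    rw [h7]
    exact abs_le.2 ⟨by linarith, by linarith⟩
  · linarith [h3 z, hKin z.1 hz]
  · have h4 := (le_abs_self _).trans (C0_abs_le (embC (solS hp)) z)
    rw [solS_fn_ae] at h4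
    linarith [h3 z]

end LineSoliton

end

/-! ### The main theorem -/

theorem mainTheorem2 (p : ℝ) (hp : 1 < p) :
    ∃ (a₀ δ₀ r₀ : ℝ) (η : ℝ × ℝ → LineSoliton.H2) (φ : ℝ → ℝ → LineSoliton.Cyl → ℝ),
      0 < a₀ ∧ a₀ ≤ 1 ∧ 0 < δ₀ ∧ δ₀ < LineSoliton.omegaP p ∧ 0 < r₀ ∧
      -- `η` is the `C¹` family of solutions of the auxiliary equation in the `r₀`-ball of `X₂`
      ContDiffOn ℝ 1 η
        (Set.Ioo (LineSoliton.omegaP p - δ₀) (LineSoliton.omegaP p + δ₀) ×ˢ Set.Ioo (-a₀) a₀) ∧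
      (∀ ω ∈ Set.Ioo (LineSoliton.omegaP p - δ₀) (LineSoliton.omegaP p + δ₀),
        ∀ a ∈ Set.Ioo (-a₀) a₀,
          η (ω, a) ∈ LineSoliton.X2 p ∧ ‖η (ω, a)‖ < r₀ ∧
          (∀ h ∈ LineSoliton.X2 p, ‖h‖ < r₀ →
            (LineSoliton.AuxEq p ω a h ↔ h = η (ω, a))) ∧
          -- `φ(ω, a)` is the continuous representative of `R_{ω_p} + a ψ_{ω_p} cos y + η(ω, a)`
          Continuous (φ ω a) ∧
          φ ω a =ᵐ[MeasureTheory.volume] LineSoliton.ansatz p a (η (ω, a))) ∧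
      ∃ ε₁ : ℝ, 0 < ε₁ ∧ ∀ ε : ℝ, 0 < ε → ε < ε₁ →
        ∃ aε C₁ : ℝ, 0 < aε ∧ aε < a₀ ∧ 1 < C₁ ∧
          ∀ ω ∈ Set.Ioo (LineSoliton.omegaP p - δ₀) (LineSoliton.omegaP p + δ₀),
          ∀ a ∈ Set.Ioo (-aε) aε, ∀ (x : ℝ) (y : LineSoliton.Torus),
            C₁⁻¹ * Real.exp (-(Real.sqrt ω + ε) * |x|) ≤ φ ω a (x, y) ∧
            φ ω a (x, y) ≤ C₁ * Real.exp (-(Real.sqrt ω - ε) * |x|) ∧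
            0 < φ ω a (x, y) := by
  obtain ⟨η, δ, r, m, K, M, hδ, hδ1, hδ2, hr, hm, hK, hM, hη, hfam⟩ := LineSoliton.exists_family hp
  have hW := LineSoliton.omegaP_pos hp
  have hmem : ∀ ω ∈ Set.Ioo (LineSoliton.omegaP p - δ) (LineSoliton.omegaP p + δ),
      ∀ a ∈ Set.Ioo (-δ) δ, ((ω, a) : ℝ × ℝ) ∈
        Set.Icc (LineSoliton.omegaP p - δ) (LineSoliton.omegaP p + δ) ×ˢ Set.Icc (-δ) δ :=
    fun ω hω a ha => ⟨Set.Ioo_subset_Icc_self hω, Set.Ioo_subset_Icc_self ha⟩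
  refine ⟨δ, δ, r, fun q => LineSoliton.HS.val (η q),
    fun ω a => LineSoliton.embC (LineSoliton.anz hp a (η (ω, a))), hδ, by linarith, hδ,
    by linarith, hr, ?_, fun ω hω a ha => ?_, ?_⟩
  · exact LineSoliton.HS.val.contDiff.comp_contDiffOn
      (hη.mono (Set.prod_mono Set.Ioo_subset_Icc_self Set.Ioo_subset_Icc_self))
  · obtain ⟨h1, h2, -⟩ := hfam _ (hmem ω hω a ha)
    refine ⟨LineSoliton.val_mem_X2 hp ((h2 _ h1).2 rfl), ?_, fun h hX hh => ?_, ?_, ?_⟩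
    · rwa [LineSoliton.HS.norm_val]
    · exact LineSoliton.auxEq_iff_eq_val hp h2 hX hh
    · exact map_continuous _
    · exact LineSoliton.embC_anz_ae hp a _
  -- The first bound keeps `√ω + ε` below the decay rate `√(ω_p + 1)` of `ψ`; the second keeps `√ω -
  -- ε` positive.
  refine ⟨min (LineSoliton.sidx p * LineSoliton.kap p - √(LineSoliton.omegaP p + 1 / 2))
    √(LineSoliton.omegaP p / 2), lt_min (sub_pos.2 (LineSoliton.sqrt_lt_sidx_mul_kap hp))
    (Real.sqrt_pos.2 (by linarith)), fun ε hε hε1 => ?_⟩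
  obtain ⟨l₀, C, hl₀, hC, hdecay⟩ := LineSoliton.exists_decay_const hp hm hK hM hε
    (hε1.trans_le (min_le_left _ _)) (hε1.trans_le (min_le_right _ _))
  -- The multiplier is continuous on the closed square and zero on `a = 0`, so one `d` serves every
  -- `ω`. Only this threshold and the decay constant depend on `ε`.
  obtain ⟨d, hd, hdδ, hsmall⟩ := LineSoliton.exists_forall_abs_lt_near_axis isCompact_Icc hδ
    (LineSoliton.continuousOn_multiplier hp hη.continuousOn) (fun ω hω =>
      have hq := hfam (ω, 0) ⟨hω, by constructor <;> linarith⟩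
      LineSoliton.multiplier_zero hp hq.1 hq.2.1) hl₀
  refine ⟨d, C, hd, hdδ, hC, fun ω hω a ha x y => ?_⟩
  obtain ⟨h1, h2, h3, h4, h5⟩ := hfam _ (hmem ω hω a ⟨by linarith [ha.1], by linarith [ha.2]⟩)
  exact hdecay ω _ _ (by linarith [hω.1]) (by linarith [hω.2])
    ((LineSoliton.auxG_eq_zero_iff hp _).1 ((h2 _ h1).2 rfl)).2
    (hsmall ω (Set.Ioo_subset_Icc_self hω) a (abs_lt.2 ha)) h3 h4 h5 (x, y)
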